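/- Fix a smooth cut-off $\psi$ on $[0,\infty)$ with $0\le\psi\le1$, $\psi=1$ on $[0,1/2]$ and $\psi=0$ on $[3/4,\infty)$. For $0<\varepsilon<1$ put $F(\eta)=-\dfrac{\varepsilon\psi(\varepsilon\eta)}{1-\varepsilon\eta}$ and $V(\eta)=-\int_0^\eta F(y)\,dy$. Let $M\ge0$, $K>0$, and let $h$, $S$ be measurable, $S$ being $2\pi$-periodic in $\phi$, with $|h(\phi)|\le M$ for $\sin\phi>0$ and $|S(\eta,\phi)|\le Me^{-K\eta}$ for $\eta\ge0$. Write $\bar f(\eta)=\frac1{2\pi}\int_{-\pi}^{\pi}f(\eta,\phi)\,d\phi$ and $\mathcal Pf(\eta)=-\frac12\int_{\sin\phi<0}f(\eta,\phi)\sin\phi\,d\phi$. The $\varepsilon$-Milne problem with diffusive boundary is, for $(\eta,\phi)\in[0,\infty)\times[-\pi,\pi)$, $$\sin\phi\,\frac{\partial f}{\partial\eta}+F(\eta)\cos\phi\,\frac{\partial f}{\partial\phi}+f-\bar f=S,\qquad f(0,\phi)=h(\phi)+\mathcal Pf(0)\ \ (\sin\phi>0),\qquad \lim_{\eta\to\infty}f(\eta,\phi)=f_\infty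 .\tag{D}$$ The in-flow problem (I) is the same with boundary condition $f(0,\phi)=h(\phi)$ for $\sin\phi>0$. Here $f_\infty$ is a real constant, $f$ is measurable and $2\pi$-periodic in $\phi$, and the equation is understood along the characteristics $\dot\eta=\sin\phi$, $\dot\phi=F(\eta)\cos\phi$ in $\{\eta\ge0\}$: $\bar f-f+S$ is integrable along each characteristic arc, and its integral is the increment of $f$. The compatibility condition is $$\int_{\sin\phi>0}h(\phi)\sin\phi\,d\phi+\int_0^\infty\!\!\int_{-\pi}^{\pi}e^{-V(s)}S(s,\phi)\,d\phi\,ds=0,\tag{CC}$$ and the normalization is $\mathcal Pf(0)=0$. Then: 1. If (D) has a bounded solution, (CC) holds; in particular $\int_{\sin\phi>0}h\sin\phi\,d\phi=0$ if $S=0$. 2. Suppose (CC) holds, and let $f$ be a solution of (I) that is bounded or satisfies $f-f_\infty\in L^2([0,\infty)\times[-\pi,\pi))$. Then $f$ solves (D), $\mathcal Pf(0)=0$ and $f-f_\infty\in L^2$. It is the unique solution of (D) with $\mathcal Pf(0)=0$ and $f-f_\infty\in L^2$: any other one has the same limit and equals $f$ almost everywhere. 3. For every $K_{*}>0$ there are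 constants $C,\kappa>0$, depending only on $K_*$ and $\psi$, such that, whenever $0<\varepsilon<1$, $K\ge K_*$ and (CC) holds, (D) has a bounded solution $f$ with $\mathcal Pf(0)=0$ and $$\sup_{\eta\ge0,\,\phi}|f-f_\infty|\le C\Big(1+M+\frac MK\Big),\qquad \sup_{\eta\ge0,\,\phi}\big|e^{K_0\eta}(f-f_\infty)\big|\le C\Big(1+M+\frac MK\Big)\quad(0<K_0\le\kappa).$$ If $S=0$, moreover $\inf_{\sin\phi>0}h\le f(\eta,\phi)\le\sup_{\sin\phi>0}h$ for all $\eta\ge0$ and all $\phi$. Any bounded solution of (D) with $\mathcal Pf(0)=0$ has the same limit $f_\infty$ and coincides with $f$ at every point outside the grazing set $\{\eta=0,\ \sin\phi=0\}$, where the problem imposes nothing. -/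

import Mathlib

open Real Set MeasureTheory Filter Topology
open scoped ContDiff

noncomputable section

namespace Milne

/-- The cut-off profiles: smooth, with values in `[0, 1]`, equal to `1` on `[0, 1/2]` and to `0` on
`[3/4, ∞)`. -/
structure IsCutoff (ψ : ℝ → ℝ) : Prop where
  smooth : ContDiff ℝ ∞ ψ
  nonneg : ∀ μ, 0 ≤ μ → 0 ≤ ψ μ
  le_one : ∀ μ, 0 ≤ μ → ψ μ ≤ 1
  eq_one : ∀ μ, 0 ≤ μ → μ ≤ 1 / 2 → ψ μ = 1
  eq_zero : ∀ μ, 3 / 4 ≤ μ → ψ μ = 0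

/-- The force `F(ε; η) = -ε ψ(εη) / (1 - εη)`. The numerator vanishes near `εη = 1`. -/
def force (ψ : ℝ → ℝ) (ε η : ℝ) : ℝ := -(ε * ψ (ε * η)) / (1 - ε * η)

/-- The potential `V(ε; η)`, that is `V(ε; 0) = 0` and `∂V/∂η = -F`. -/
def potential (ψ : ℝ → ℝ) (ε η : ℝ) : ℝ := -∫ y in (0 : ℝ)..η, force ψ ε y

/-- The in-flow directions `sin φ > 0` in `[-π, π)`. -/
def inflow : Set ℝ := {φ ∈ Ico (-π) π | 0 < sin φ}

/-- The out-flow directions `sin φ < 0` in `[-π, π)`. -/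
def outflow : Set ℝ := {φ ∈ Ico (-π) π | sin φ < 0}

/-- The angular average `f̄(η) = (1 / 2π) ∫_{-π}^{π} f(η, φ) dφ`. -/
def avg (f : ℝ → ℝ → ℝ) (η : ℝ) : ℝ := (1 / (2 * π)) * ∫ φ in (-π)..π, f η φ

/-- The diffusive boundary operator `P f(η) = -(1/2) ∫_{sin φ < 0} f(η, φ) sin φ dφ`. -/
def boundaryP (f : ℝ → ℝ → ℝ) (η : ℝ) : ℝ := -(1 / 2) * ∫ φ in outflow, f η φ * sin φ

/-- `t ↦ (X t, Φ t)`, `a ≤ t ≤ b`, is a characteristic curve, contained in the half space `η ≥ 0`,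
of the transport operator `sin φ ∂_η + F(η) cos φ ∂_φ`. -/
def IsCharacteristic (F : ℝ → ℝ) (a b : ℝ) (X Φ : ℝ → ℝ) : Prop :=
  ∀ t ∈ Icc a b, 0 ≤ X t ∧
    HasDerivWithinAt X (sin (Φ t)) (Icc a b) t ∧
    HasDerivWithinAt Φ (F (X t) * cos (Φ t)) (Icc a b) t

/-- `f` solves `sin φ ∂_η f + F(η) cos φ ∂_φ f + f - f̄ = S` on `[0, ∞) × (ℝ / 2πℤ)`, in the sense
of integration along the characteristics. -/
structure IsTransportSolution (F : ℝ → ℝ) (S f : ℝ → ℝ → ℝ) : Prop where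
  measurable : Measurable fun p : ℝ × ℝ => f p.1 p.2
  periodic : ∀ η φ, f η (φ + 2 * π) = f η φ
  integrable : ∀ᵐ η ∂(volume.restrict (Ici (0 : ℝ))), IntervalIntegrable (f η) volume (-π) π
  along : ∀ (a b : ℝ) (X Φ : ℝ → ℝ), a ≤ b → IsCharacteristic F a b X Φ →
    IntervalIntegrable (fun t => avg f (X t) - f (X t) (Φ t) + S (X t) (Φ t)) volume a b ∧
    f (X b) (Φ b) - f (X a) (Φ a) =
      ∫ t in a..b, (avg f (X t) - f (X t) (Φ t) + S (X t) (Φ t))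

/-- `f`, with limit `fInf` at infinity, solves the Milne problem with in-flow boundary condition
`f(0, φ) = h(φ)` for `sin φ > 0`. -/
structure IsInflowSolution (F : ℝ → ℝ) (h : ℝ → ℝ) (S f : ℝ → ℝ → ℝ) (fInf : ℝ) : Prop where
  transport : IsTransportSolution F S f
  boundary : ∀ φ ∈ inflow, f 0 φ = h φ
  limit : ∀ φ, Tendsto (fun η => f η φ) atTop (𝓝 fInf)

/-- `f`, with limit `fInf` at infinity, solves the Milne problem with diffusive boundary condition
`f(0, φ) = h(φ) + P f(0)` for `sin φ > 0`. -/
structure IsDiffusiveSolution (F : ℝ → ℝ) (h : ℝ → ℝ) (S f : ℝ → ℝ → ℝ) (fInf : ℝ) : Prop where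
  transport : IsTransportSolution F S f
  integrable_outflow : IntegrableOn (fun φ => f 0 φ * sin φ) outflow
  boundary : ∀ φ ∈ inflow, f 0 φ = h φ + boundaryP f 0
  limit : ∀ φ, Tendsto (fun η => f η φ) atTop (𝓝 fInf)

/-- The boundary data and the source term, with `|h| ≤ M` for `sin φ > 0` and
`|S| ≤ M exp (-K η)`. -/
structure IsData (M K : ℝ) (h : ℝ → ℝ) (S : ℝ → ℝ → ℝ) : Prop where
  measurable_h : Measurable h
  measurable_S : Measurable fun p : ℝ × ℝ => S p.1 p.2
  periodic_S : ∀ η φ, S η (φ + 2 * π) = S η φ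
  bound_h : ∀ φ ∈ inflow, |h φ| ≤ M
  bound_S : ∀ η, 0 ≤ η → ∀ φ, |S η φ| ≤ M * exp (-(K * η))

/-- The compatibility condition
`∫_{sin φ > 0} h sin φ dφ + ∫_0^∞ ∫_{-π}^{π} exp (-V(s)) S(s, φ) dφ ds = 0`. -/
def Compatible (V : ℝ → ℝ) (h : ℝ → ℝ) (S : ℝ → ℝ → ℝ) : Prop :=
  (∫ φ in inflow, h φ * sin φ) +
    (∫ s in Ici (0 : ℝ), ∫ φ in (-π)..π, exp (-V s) * S s φ) = 0

/-- `f ∈ L^∞([0, ∞) × [-π, π))`, the norm being the supremum. -/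
def IsBounded (f : ℝ → ℝ → ℝ) : Prop := ∃ B, ∀ η, 0 ≤ η → ∀ φ, |f η φ| ≤ B

/-- `f - c ∈ L²([0, ∞) × [-π, π))`. -/
def IsL2 (f : ℝ → ℝ → ℝ) (c : ℝ) : Prop :=
  IntegrableOn (fun p : ℝ × ℝ => (f p.1 p.2 - c) ^ 2) (Ici (0 : ℝ) ×ˢ Ico (-π) π)

/-- Equality at every point of the half space but those of the grazing set `η = 0`, `sin φ = 0`. -/
def EqOffGrazing (f g : ℝ → ℝ → ℝ) : Prop :=
  ∀ η φ, 0 ≤ η → (η ≠ 0 ∨ sin φ ≠ 0) → f η φ = g η φ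

/-- Equality almost everywhere in `[0, ∞) × [-π, π)`. -/
def EqAE (f g : ℝ → ℝ → ℝ) : Prop :=
  ∀ᵐ p ∂((volume : Measure (ℝ × ℝ)).restrict (Ici (0 : ℝ) ×ˢ Ico (-π) π)), f p.1 p.2 = g p.1 p.2

end Milne

end

noncomputable section

namespace Milne
open scoped NNReal

/-! The force enters only through a Lipschitz condition and `-4 ≤ F ≤ 0`, which is why the decay
constants do not depend on `ε`. Nonpositivity makes `sin φ` nonincreasing along characteristics, so
the position is a concave function of time. The energy `cos φ * exp (-V)` is conserved.

Most estimates rest on one explicit function, `barrier`, the product of `exp (-(k * η))` and `2 / k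
^ 2 + 2 / k * sin φ - cos (2 * φ)`. Its source is at most `-1/2 * exp (-(k * η))`. Combined with the
growing supersolution `η - sin φ`, it yields the maximum principle `comparison` in half spaces. It
also absorbs decaying sources in `lower_bound`, a Doeblin minorization: a nonnegative solution is
bounded below, one unit further in, by a fixed fraction of its mass in a thin layer, up to the
source. Applied to `f - m` and `m' - f`, this contracts the oscillation (`oscillation_step`) and
gives exponential decay to a constant (`exists_decay`).

Existence comes from a monotone iteration on the angular average (`exists_fixed_avg`). The boundary
data are continued to `η < 0` as a function of the energy, so the boundary value problem becomes a
resolvent of a flow on the whole plane. The iteration runs between multiples of a bounded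
supersolution built from the barrier. If `S = 0` it runs between the constants `inf h` and `sup h`,
which proves the maximum principle for the solution.

Compatibility is a flux balance. Integrating the equation against `exp (-V)` removes the collision
term, so a bounded in-flow solution has `2 * P f(0)` equal to the left side of (CC). Under (CC), the
in-flow problem is therefore the normalized diffusive problem. Conversely, a diffusive solution is
an in-flow solution with data `h + P f(0)`; the constant adds exactly `2 * P f(0)` to the incoming
flux, and (CC) remains. The divergence theorem needed here, `green`, concerns functions regular only
along characteristics. It is proved by integrating over each energy line and then over energies, the
lines asymptotic to a level being negligible by a Sard argument.

Uniqueness of bounded solutions is the maximum principle. In `L²` it is an energy identity for `d ^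
2 * weight`, where `weight` is a constant minus the reflected barrier and makes the energy strictly
dissipated (`ae_eq_zero_of_sq_integrable`). The decaying bounded solution is itself in the `L²`
class, which transfers the flux balance to every `L²` solution. -/

/-! ### The flow of the characteristics. -/

/-- A globally Lipschitz, nonpositive force bounded by `4`. -/
structure Admissible (F : ℝ → ℝ) : Prop where
  lip : ∃ L : ℝ≥0, LipschitzWith L F
  nonpos : ∀ x, F x ≤ 0
  ge : ∀ x, -4 ≤ F x

/-- The vector field whose integral curves are the characteristics. -/
def field (F : ℝ → ℝ) (p : ℝ × ℝ) : ℝ × ℝ := (sin p.2, F p.1 * cos p.2)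

lemma Admissible.continuous {F : ℝ → ℝ} (hF : Admissible F) : Continuous F :=
  hF.lip.choose_spec.continuous

lemma Admissible.abs_apply_le {F : ℝ → ℝ} (hF : Admissible F) (x : ℝ) : |F x| ≤ 4 :=
  abs_le.2 ⟨hF.ge x, (hF.nonpos x).trans (by norm_num)⟩

lemma Admissible.lipschitz_field {F : ℝ → ℝ} (hF : Admissible F) :
    ∃ K : ℝ≥0, LipschitzWith K (field F) := by
  obtain ⟨L, hL⟩ := hF.lip
  refine ⟨L + 5, LipschitzWith.of_dist_le_mul fun p q => ?_⟩
  have h1 : dist p.1 q.1 ≤ dist p q := le_max_left _ _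
  have h2 : dist p.2 q.2 ≤ dist p q := le_max_right _ _
  have hs : |sin p.2 - sin q.2| ≤ dist p.2 q.2 := Real.abs_sin_sub_sin_le p.2 q.2
  have hc : |cos p.2 - cos q.2| ≤ dist p.2 q.2 := Real.abs_cos_sub_cos_le p.2 q.2
  have hd : 0 ≤ dist p q := dist_nonneg
  have hFd : |F p.1 - F q.1| ≤ L * dist p.1 q.1 := hL.dist_le_mul _ _
  have hL0 : (0 : ℝ) ≤ L := L.2
  refine max_le ?_ ?_
  · change |sin p.2 - sin q.2| ≤ _
    push_cast
    nlinarith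
  · change |F p.1 * cos p.2 - F q.1 * cos q.2| ≤ _
    have : F p.1 * cos p.2 - F q.1 * cos q.2
        = (F p.1 - F q.1) * cos p.2 + F q.1 * (cos p.2 - cos q.2) := by ring
    rw [this]
    refine (abs_add_le _ _).trans ?_
    rw [abs_mul, abs_mul]
    have e1 : |F p.1 - F q.1| * |cos p.2| ≤ L * dist p q := by
      calc |F p.1 - F q.1| * |cos p.2| ≤ |F p.1 - F q.1| * 1 := by
            gcongr; exact Real.abs_cos_le_one _
        _ ≤ L * dist p q := by rw [mul_one]; exact hFd.trans (by gcongr)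
    have e2 : |F q.1| * |cos p.2 - cos q.2| ≤ 4 * dist p q := by
      have := hF.abs_apply_le q.1
      gcongr
      exact hc.trans h2
    push_cast
    nlinarith

lemma Admissible.norm_field_le {F : ℝ → ℝ} (hF : Admissible F) (p : ℝ × ℝ) :
    ‖field F p‖ ≤ 4 := by
  refine max_le ?_ ?_
  · exact (Real.abs_sin_le_one _).trans (by norm_num)
  · change |F p.1 * cos p.2| ≤ 4
    rw [abs_mul]
    have := hF.abs_apply_le p.1
    have := Real.abs_cos_le_one p.2
    have := abs_nonneg (F p.1)
    nlinarith [abs_nonneg (cos p.2)]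

/-- Local solutions on the intervals `(-(n + 1), n + 1)` agree by uniqueness, so they glue to a
global curve. -/
lemma exists_integralCurve {v : ℝ × ℝ → ℝ × ℝ} {K : ℝ≥0} (hK : LipschitzWith K v) {B : ℝ≥0}
    (hB : ∀ p, ‖v p‖ ≤ B) (p : ℝ × ℝ) :
    ∃ α : ℝ → ℝ × ℝ, α 0 = p ∧ ∀ t, HasDerivAt α (v (α t)) t := by
  have hloc : ∀ n : ℕ, ∃ α : ℝ → ℝ × ℝ, α 0 = p ∧
      ∀ t ∈ Ioo (-(n + 1 : ℝ)) (n + 1), HasDerivAt α (v (α t)) t := by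
    intro n
    have h0 : (0 : ℝ) ∈ Icc (-(n + 1 : ℝ)) (n + 1) := ⟨by linarith [n.cast_nonneg (α := ℝ)], by positivity⟩
    -- Speed at most `B` keeps the curve in the ball of radius `B * (n + 1)`, so a single
    -- Picard-Lindelöf step covers the whole interval.
    have hPL : IsPicardLindelof (fun _ : ℝ => v) (⟨0, h0⟩ : Icc (-(n + 1 : ℝ)) (n + 1)) p
        (B * (n + 1)) 0 B K :=
      { lipschitzOnWith := fun _ _ => hK.lipschitzOnWith
        continuousOn := fun _ _ => continuousOn_const
        norm_le := fun _ _ x _ => hB x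
        mul_max_le := by simp }
    obtain ⟨α, h0, hα⟩ := hPL.exists_eq_forall_mem_Icc_hasDerivWithinAt₀
    exact ⟨α, h0, fun t ht => (hα t (Ioo_subset_Icc_self ht)).hasDerivAt (Icc_mem_nhds ht.1 ht.2)⟩
  choose α hα0 hα using hloc
  have hagree : ∀ m n : ℕ, m ≤ n → EqOn (α m) (α n) (Ioo (-(m + 1 : ℝ)) (m + 1)) := by
    intro m n hmn
    have hmn' : (m : ℝ) ≤ n := by exact_mod_cast hmn
    refine ODE_solution_unique_of_mem_Ioo (v := fun _ => v) (s := fun _ => univ) (K := K) (t₀ := 0)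
      (fun _ _ => hK.lipschitzOnWith)
      ⟨by linarith [m.cast_nonneg (α := ℝ)], by positivity⟩
      (fun t ht => ⟨hα m t ht, trivial⟩) (fun t ht => ⟨hα n t ⟨?_, ?_⟩, trivial⟩)
      ((hα0 m).trans (hα0 n).symm)
    · linarith [ht.1]
    · linarith [ht.2]
  set N : ℝ → ℕ := fun t => ⌈|t|⌉₊ with hN
  have hmem : ∀ t, t ∈ Ioo (-(N t + 1 : ℝ)) (N t + 1) := fun t => by
    have := Nat.le_ceil |t|
    exact abs_lt.1 (by linarith : |t| < N t + 1)
  have hval : ∀ n : ℕ, ∀ t ∈ Ioo (-(n + 1 : ℝ)) (n + 1), α (N t) t = α n t := by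
    intro n t ht
    rcases le_total (N t) n with h | h
    · exact hagree _ _ h (hmem t)
    · exact (hagree _ _ h ht).symm
  refine ⟨fun t => α (N t) t, by simp [hα0], fun t => ?_⟩
  have hev : (fun s => α (N s) s) =ᶠ[𝓝 t] α (N t) := by
    filter_upwards [Ioo_mem_nhds (hmem t).1 (hmem t).2] with s hs using hval _ s hs
  exact (hα (N t) t (hmem t)).congr_of_eventuallyEq hev

/-- `γ` is the flow of the characteristics. -/
structure IsFlow (F : ℝ → ℝ) (γ : ℝ → ℝ × ℝ → ℝ × ℝ) : Prop where
  zero : ∀ p, γ 0 p = p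
  deriv_fst : ∀ p t, HasDerivAt (fun t => (γ t p).1) (sin (γ t p).2) t
  deriv_snd : ∀ p t, HasDerivAt (fun t => (γ t p).2) (F (γ t p).1 * cos (γ t p).2) t
  cont : Continuous fun x : ℝ × (ℝ × ℝ) => γ x.1 x.2
  add : ∀ s t p, γ (s + t) p = γ s (γ t p)
  shift : ∀ t p, γ t (p.1, p.2 + 2 * π) = ((γ t p).1, (γ t p).2 + 2 * π)
  unique : ∀ a b X Φ, IsCharacteristic F a b X Φ →
    ∀ s ∈ Icc a b, ∀ t ∈ Icc a b, (X t, Φ t) = γ (t - s) (X s, Φ s)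

/-- Grönwall's inequality; negative times reduce to positive ones by reversing the field. -/
lemma lipschitz_of_integralCurves {v : ℝ × ℝ → ℝ × ℝ} {K : ℝ≥0} (hK : LipschitzWith K v)
    {α β : ℝ → ℝ × ℝ} (hα : ∀ t, HasDerivAt α (v (α t)) t) (hβ : ∀ t, HasDerivAt β (v (β t)) t)
    (t : ℝ) : dist (α t) (β t) ≤ dist (α 0) (β 0) * exp (K * |t|) := by
  rcases le_total 0 t with ht | ht
  · have := dist_le_of_trajectories_ODE (v := fun _ => v) (K := K) (a := 0) (b := t)
      (fun _ => hK) (fun s _ => (hα s).continuousAt.continuousWithinAt)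
      (fun s _ => (hα s).hasDerivWithinAt) (fun s _ => (hβ s).continuousAt.continuousWithinAt)
      (fun s _ => (hβ s).hasDerivWithinAt) le_rfl t ⟨ht, le_rfl⟩
    simpa [abs_of_nonneg ht] using this
  · have hneg : ∀ {α : ℝ → ℝ × ℝ}, (∀ t, HasDerivAt α (v (α t)) t) →
        ∀ s, HasDerivAt (fun s => α (-s)) (-v (α (-s))) s := by
      intro α hα s
      have := (hα (-s)).scomp s (hasDerivAt_neg s)
      simpa [Function.comp_def] using this
    have hK' : LipschitzWith K fun p => -v p := hK.neg
    have := dist_le_of_trajectories_ODE (v := fun _ p => -v p) (K := K) (a := 0) (b := -t)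
      (fun _ => hK')
      (fun s _ => (hneg hα s).continuousAt.continuousWithinAt)
      (fun s _ => (hneg hα s).hasDerivWithinAt)
      (fun s _ => (hneg hβ s).continuousAt.continuousWithinAt)
      (fun s _ => (hneg hβ s).hasDerivWithinAt) le_rfl (-t) ⟨by linarith, le_rfl⟩
    simpa [abs_of_nonpos ht] using this

lemma exists_flow {F : ℝ → ℝ} (hF : Admissible F) : ∃ γ, IsFlow F γ := by
  obtain ⟨K, hK⟩ := hF.lipschitz_field
  choose γ h0 hd using exists_integralCurve hK (B := 4) (fun p => by simpa using hF.norm_field_le p)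
  have huniq : ∀ (α β : ℝ → ℝ × ℝ), (∀ t, HasDerivAt α (field F (α t)) t) →
      (∀ t, HasDerivAt β (field F (β t)) t) → α 0 = β 0 → α = β := by
    intro α β hα hβ h
    exact ODE_solution_unique_univ (v := fun _ => field F) (s := fun _ => univ) (t₀ := 0)
      (fun _ => hK.lipschitzOnWith) (fun t => ⟨hα t, trivial⟩) (fun t => ⟨hβ t, trivial⟩) h
  refine ⟨fun t p => γ p t, ⟨h0, fun p t => ?_, fun p t => ?_, ?_, fun s t p => ?_,
    fun t p => ?_, ?_⟩⟩
  · exact ((ContinuousLinearMap.fst ℝ ℝ ℝ).hasFDerivAt.comp_hasDerivAt t (hd p t))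
  · exact ((ContinuousLinearMap.snd ℝ ℝ ℝ).hasFDerivAt.comp_hasDerivAt t (hd p t))
  -- Joint continuity: Grönwall controls the change of starting point, the speed bound `4` the
  -- change of time.
  · have key : ∀ x y : ℝ × (ℝ × ℝ), dist (γ x.2 x.1) (γ y.2 y.1)
        ≤ dist x.2 y.2 * exp (K * |x.1|) + 4 * dist x.1 y.1 := by
      intro x y
      refine (dist_triangle _ (γ y.2 x.1) _).trans (add_le_add ?_ ?_)
      · have := lipschitz_of_integralCurves hK (hd x.2) (hd y.2) x.1
        rwa [h0, h0] at this
      · have := Convex.norm_image_sub_le_of_norm_hasDerivWithin_le (f := γ y.2) (s := univ)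
          (C := 4) (fun t _ => (hd y.2 t).hasDerivWithinAt)
          (fun t _ => hF.norm_field_le _) convex_univ (mem_univ y.1) (mem_univ x.1)
        rw [dist_eq_norm, dist_eq_norm]
        exact this
    rw [continuous_iff_continuousAt]
    intro y
    have hlim : Tendsto (fun x : ℝ × (ℝ × ℝ) => dist x.2 y.2 * exp (K * |x.1|)
        + 4 * dist x.1 y.1) (𝓝 y) (𝓝 0) := by
      have hc : Continuous (fun x : ℝ × (ℝ × ℝ) => dist x.2 y.2 * exp (K * |x.1|)
        + 4 * dist x.1 y.1) := by fun_prop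
      simpa using hc.tendsto y
    exact tendsto_iff_dist_tendsto_zero.2
      (squeeze_zero (fun _ => dist_nonneg) (fun x => key x y) hlim)
  · have := huniq (fun s => γ p (s + t)) (γ (γ p t))
      (fun s => (hd p (s + t)).comp_add_const s t) (hd _) (by simp [h0])
    exact congrFun this s
  · have := huniq (γ (p.1, p.2 + 2 * π)) (fun t => ((γ p t).1, (γ p t).2 + 2 * π))
      (hd _) (fun t => ?_) (by simp [h0])
    · exact congrFun this t
    · have h1 : HasDerivAt (fun t => (γ p t).1) (sin (γ p t).2) t :=
        ((ContinuousLinearMap.fst ℝ ℝ ℝ).hasFDerivAt.comp_hasDerivAt t (hd p t))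
      have h2 : HasDerivAt (fun t => (γ p t).2) (F (γ p t).1 * cos (γ p t).2) t :=
        ((ContinuousLinearMap.snd ℝ ℝ ℝ).hasFDerivAt.comp_hasDerivAt t (hd p t))
      have := h1.prodMk (h2.add_const (2 * π))
      simpa [field] using this
  · intro a b X Φ hX
    have hforw : ∀ s ∈ Icc a b, ∀ t ∈ Icc a b, s ≤ t → (X t, Φ t) = γ (X s, Φ s) (t - s) := by
      intro s hs t ht hst
      have hsub : Icc s t ⊆ Icc a b := Icc_subset_Icc hs.1 ht.2
      have hder : ∀ r ∈ Icc a b, HasDerivWithinAt (fun r => (X r, Φ r)) (field F (X r, Φ r))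
          (Icc a b) r := fun r hr => (hX r hr).2.1.prodMk (hX r hr).2.2
      have hγ : ∀ r, HasDerivAt (fun r => γ (X s, Φ s) (r - s)) (field F (γ (X s, Φ s) (r - s))) r :=
        fun r => (hd _ (r - s)).comp_sub_const r s
      refine ODE_solution_unique (v := fun _ => field F) (K := K) (a := s) (b := t)
        (fun _ => hK) (f := fun r => (X r, Φ r)) (g := fun r => γ (X s, Φ s) (r - s))
        (fun r hr => ((hder r (hsub hr)).continuousWithinAt).mono hsub) (fun r hr => ?_)
        (fun r _ => (hγ r).continuousAt.continuousWithinAt) (fun r _ => (hγ r).hasDerivWithinAt)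
        (by simp [h0]) ⟨hst, le_rfl⟩
      have hr' : r ∈ Ico a b := ⟨hs.1.trans hr.1, hr.2.trans_le ht.2⟩
      exact (hder r (Ico_subset_Icc_self hr')).mono_of_mem_nhdsWithin
        (Icc_mem_nhdsGE_of_mem hr')
    have hadd : ∀ s t p, γ p (s + t) = γ (γ p t) s := by
      intro s t p
      have := huniq (fun s => γ p (s + t)) (γ (γ p t))
        (fun s => (hd p (s + t)).comp_add_const s t) (hd _) (by simp [h0])
      exact congrFun this s
    intro s hs t ht
    rcases le_total s t with hst | hst
    · exact hforw s hs t ht hst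
    · rw [hforw t ht s hs hst, ← hadd]
      simp [h0]

namespace IsFlow

variable {F : ℝ → ℝ} {γ : ℝ → ℝ × ℝ → ℝ × ℝ}

lemma isCharacteristic (hγ : IsFlow F γ) (p : ℝ × ℝ) (c : ℝ) {a b : ℝ}
    (h : ∀ t ∈ Icc a b, 0 ≤ (γ (t + c) p).1) :
    IsCharacteristic F a b (fun t => (γ (t + c) p).1) (fun t => (γ (t + c) p).2) := fun t ht =>
  ⟨h t ht, ((hγ.deriv_fst p (t + c)).comp_add_const t c).hasDerivWithinAt,
    ((hγ.deriv_snd p (t + c)).comp_add_const t c).hasDerivWithinAt⟩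

lemma cont_left (hγ : IsFlow F γ) (p : ℝ × ℝ) : Continuous fun t => γ t p :=
  hγ.cont.comp (by fun_prop : Continuous fun t : ℝ => (t, p))

/-- The sign of the force enters here: the derivative of `sin φ` is `F * cos φ ^ 2`. Hence a path
followed backward from an incoming direction keeps moving toward the wall, at least as steeply as it
started. -/
lemma antitone_sin (hF : Admissible F) (hγ : IsFlow F γ) (p : ℝ × ℝ) :
    Antitone fun t => sin (γ t p).2 := by
  have hd : ∀ t, HasDerivAt (fun t => sin (γ t p).2)
      (cos (γ t p).2 * (F (γ t p).1 * cos (γ t p).2)) t := fun t => (hγ.deriv_snd p t).sin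
  refine antitone_of_deriv_nonpos (fun t => (hd t).differentiableAt) fun t => ?_
  rw [(hd t).deriv]
  nlinarith [hF.nonpos (γ t p).1, sq_nonneg (cos (γ t p).2)]

lemma abs_fst_sub_le (hγ : IsFlow F γ) (p : ℝ × ℝ) (t : ℝ) : |(γ t p).1 - p.1| ≤ |t| := by
  have := Convex.norm_image_sub_le_of_norm_hasDerivWithin_le (f := fun t => (γ t p).1) (s := univ)
    (C := 1) (fun t _ => (hγ.deriv_fst p t).hasDerivWithinAt)
    (fun t _ => Real.abs_sin_le_one _) convex_univ (mem_univ 0) (mem_univ t)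
  simpa [hγ.zero] using this

/-- Along a characteristic the position lies below its tangents. -/
lemma fst_sub_le (hF : Admissible F) (hγ : IsFlow F γ) (p : ℝ × ℝ) {s t : ℝ} (hst : s ≤ t) :
    (γ t p).1 - (γ s p).1 ≤ sin (γ s p).2 * (t - s) ∧
    sin (γ t p).2 * (t - s) ≤ (γ t p).1 - (γ s p).1 := by
  have hdiff : ∀ x, DifferentiableAt ℝ (fun t => (γ t p).1) x :=
    fun x => (hγ.deriv_fst p x).differentiableAt
  have hd : ∀ x, deriv (fun t => (γ t p).1) x = sin (γ x p).2 := fun x => (hγ.deriv_fst p x).deriv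
  constructor
  · refine (convex_Icc s t).image_sub_le_mul_sub_of_deriv_le (f := fun t => (γ t p).1)
      (fun x _ => (hdiff x).continuousAt.continuousWithinAt)
      (fun x _ => (hdiff x).differentiableWithinAt) (fun x hx => ?_) s ⟨le_rfl, hst⟩ t ⟨hst, le_rfl⟩ hst
    rw [interior_Icc] at hx
    rw [hd]
    exact hγ.antitone_sin hF p hx.1.le
  · refine (convex_Icc s t).mul_sub_le_image_sub_of_le_deriv (f := fun t => (γ t p).1)
      (fun x _ => (hdiff x).continuousAt.continuousWithinAt)
      (fun x _ => (hdiff x).differentiableWithinAt) (fun x hx => ?_) s ⟨le_rfl, hst⟩ t ⟨hst, le_rfl⟩ hst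
    rw [interior_Icc] at hx
    rw [hd]
    exact hγ.antitone_sin hF p hx.2.le

end IsFlow

/-! ### Potential and conserved energy. -/

/-- The potential `-∫_0^η F` of a force. -/
def pot (F : ℝ → ℝ) (η : ℝ) : ℝ := -∫ y in (0 : ℝ)..η, F y

lemma Admissible.hasDerivAt_pot {F : ℝ → ℝ} (hF : Admissible F) (η : ℝ) :
    HasDerivAt (pot F) (-F η) η :=
  (intervalIntegral.integral_hasDerivAt_right (hF.continuous.intervalIntegrable _ _)
    (hF.continuous.stronglyMeasurableAtFilter _ _) hF.continuous.continuousAt).neg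

lemma Admissible.continuous_pot {F : ℝ → ℝ} (hF : Admissible F) : Continuous (pot F) :=
  continuous_iff_continuousAt.2 fun η => (hF.hasDerivAt_pot η).continuousAt

@[simp] lemma pot_zero (F : ℝ → ℝ) : pot F 0 = 0 := by simp [pot]

lemma Admissible.monotone_pot {F : ℝ → ℝ} (hF : Admissible F) : Monotone (pot F) := by
  refine monotone_of_deriv_nonneg (fun η => (hF.hasDerivAt_pot η).differentiableAt) fun η => ?_
  rw [(hF.hasDerivAt_pot η).deriv]
  linarith [hF.nonpos η]

/-- The conserved quantity `cos φ exp (-V(η))`. -/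
def energy (F : ℝ → ℝ) (p : ℝ × ℝ) : ℝ := cos p.2 * exp (-pot F p.1)

lemma Admissible.continuous_energy {F : ℝ → ℝ} (hF : Admissible F) : Continuous (energy F) := by
  have := hF.continuous_pot
  unfold energy
  fun_prop

lemma IsFlow.energy_eq {F : ℝ → ℝ} {γ : ℝ → ℝ × ℝ → ℝ × ℝ} (hF : Admissible F) (hγ : IsFlow F γ)
    (p : ℝ × ℝ) (t : ℝ) : energy F (γ t p) = energy F p := by
  have hd : ∀ t, HasDerivAt (fun t => energy F (γ t p)) 0 t := fun t => by
    have h1 := (hγ.deriv_snd p t).cos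
    have h2 := (((hF.hasDerivAt_pot (γ t p).1).comp t (hγ.deriv_fst p t)).neg).exp
    have := h1.mul h2
    refine this.congr_deriv ?_
    ring
  have := is_const_of_deriv_eq_zero (fun t => (hd t).differentiableAt) (fun t => (hd t).deriv) t 0
  simpa [hγ.zero] using this

/-! ### Absolutely continuous functions along characteristics. -/

/-- `y` is an absolutely continuous function on `[a, b]` with derivative `g`. -/
def IsPrim (a b : ℝ) (y g : ℝ → ℝ) : Prop :=
  IntervalIntegrable g volume a b ∧ ∀ t ∈ Icc a b, y t = y a + ∫ s in a..t, g s

namespace IsPrim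

variable {a b : ℝ} {y z g h : ℝ → ℝ}

lemma mono_int (hy : IsPrim a b y g) {s t : ℝ} (hs : s ∈ Icc a b) (ht : t ∈ Icc a b) :
    IntervalIntegrable g volume s t :=
  hy.1.mono_set <| uIcc_subset_uIcc (Icc_subset_uIcc hs) (Icc_subset_uIcc ht)

lemma continuousOn (hab : a ≤ b) (hy : IsPrim a b y g) : ContinuousOn y (Icc a b) := by
  have h1 : ContinuousOn (fun t => y a + ∫ s in a..t, g s) (Icc a b) := by
    have := intervalIntegral.continuousOn_primitive_interval (f := g) (μ := volume) (a := a) (b := b)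
      (by rw [uIcc_of_le hab]; exact (intervalIntegrable_iff_integrableOn_Icc_of_le hab).1 hy.1)
    rw [uIcc_of_le hab] at this
    exact continuousOn_const.add this
  exact h1.congr hy.2

lemma congr_right (hab : a ≤ b) (hy : IsPrim a b y g) (hgh : ∀ t ∈ Icc a b, g t = h t) :
    IsPrim a b y h := by
  refine ⟨hy.1.congr fun t ht => hgh t ?_, fun t ht => ?_⟩
  · rw [uIoc_of_le hab] at ht; exact Ioc_subset_Icc_self ht
  · rw [hy.2 t ht]
    congr 1
    refine intervalIntegral.integral_congr fun s hs => hgh s ?_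
    rw [uIcc_of_le ht.1] at hs
    exact ⟨hs.1, hs.2.trans ht.2⟩

lemma add (hy : IsPrim a b y g) (hz : IsPrim a b z h) :
    IsPrim a b (fun t => y t + z t) (fun t => g t + h t) := by
  refine ⟨hy.1.add hz.1, fun t ht => ?_⟩
  have ha : a ∈ Icc a b := ⟨le_rfl, ht.1.trans ht.2⟩
  rw [intervalIntegral.integral_add (hy.mono_int ha ht) (hz.mono_int ha ht)]
  linear_combination hy.2 t ht + hz.2 t ht

lemma const_mul (c : ℝ) (hy : IsPrim a b y g) :
    IsPrim a b (fun t => c * y t) (fun t => c * g t) := by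
  refine ⟨hy.1.const_mul c, fun t ht => ?_⟩
  rw [intervalIntegral.integral_const_mul]
  linear_combination c * hy.2 t ht

lemma const (a b c : ℝ) : IsPrim a b (fun _ => c) (fun _ => 0) :=
  ⟨intervalIntegrable_const, fun t _ => by simp⟩

lemma of_hasDeriv (hab : a ≤ b) (hy : ∀ t ∈ Icc a b, HasDerivWithinAt y (g t) (Icc a b) t)
    (hg : ContinuousOn g (Icc a b)) : IsPrim a b y g := by
  refine ⟨hg.intervalIntegrable_of_Icc hab, fun t ht => ?_⟩
  rw [intervalIntegral.integral_eq_sub_of_hasDerivAt_of_le ht.1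
    (fun s hs => ((hy s ⟨hs.1, hs.2.trans ht.2⟩).continuousWithinAt).mono
      (Icc_subset_Icc_right ht.2))
    (fun s hs => (hy s ⟨hs.1.le, hs.2.le.trans ht.2⟩).hasDerivAt
      (Icc_mem_nhds hs.1 (hs.2.trans_le ht.2)))
    ((hg.mono (Icc_subset_Icc_right ht.2)).intervalIntegrable_of_Icc ht.1)]
  ring

/-- Integration by parts for the primitives of `g` and `h`, whose derivatives equal `g` and `h`
almost everywhere by Lebesgue differentiation. -/
lemma mul (hab : a ≤ b) (hy : IsPrim a b y g) (hz : IsPrim a b z h) :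
    IsPrim a b (fun t => y t * z t) (fun t => g t * z t + y t * h t) := by
  have hyc := hy.continuousOn hab
  have hzc := hz.continuousOn hab
  have hint : IntervalIntegrable (fun t => g t * z t + y t * h t) volume a b :=
    (hy.1.mul_continuousOn (by rwa [uIcc_of_le hab])).add
      (hz.1.continuousOn_mul (by rwa [uIcc_of_le hab]))
  refine ⟨hint, fun t ht => ?_⟩
  have ha : a ∈ Icc a b := ⟨le_rfl, hab⟩
  have hgt := hy.mono_int ha ht
  have hht := hz.mono_int ha ht
  have acy := (hgt.absolutelyContinuousOnInterval_intervalIntegral (c := a) (by simp))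
  have acz := (hht.absolutelyContinuousOnInterval_intervalIntegral (c := a) (by simp))
  have accy : ∀ c : ℝ, AbsolutelyContinuousOnInterval (fun _ : ℝ => c) a t := fun c =>
    (contDiff_const.contDiffOn : ContDiffOn ℝ 1 (fun _ : ℝ => c) _).absolutelyContinuousOnInterval
  have acY : AbsolutelyContinuousOnInterval (fun r => y a + ∫ s in a..r, g s) a t :=
    (accy (y a)).add acy
  have acZ : AbsolutelyContinuousOnInterval (fun r => z a + ∫ s in a..r, h s) a t :=
    (accy (z a)).add acz
  have key := acY.integral_deriv_mul_eq_sub acZ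
  simp only [intervalIntegral.integral_same, add_zero] at key
  rw [← hy.2 t ht, ← hz.2 t ht] at key
  have hcongr : ∫ s in a..t, g s * z s + y s * h s =
      ∫ x in a..t, deriv (fun r => y a + ∫ s in a..r, g s) x * (z a + ∫ s in a..x, h s) +
        (y a + ∫ s in a..x, g s) * deriv (fun r => z a + ∫ s in a..r, h s) x := by
    apply intervalIntegral.integral_congr_ae
    filter_upwards [hgt.ae_hasDerivAt_integral, hht.ae_hasDerivAt_integral] with x hx1 hx2 hx
    rw [uIoc_of_le ht.1] at hx
    have hxm : x ∈ uIcc a t := by rw [uIcc_of_le ht.1]; exact Ioc_subset_Icc_self hx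
    have hxI : x ∈ Icc a b := ⟨hx.1.le, hx.2.trans ht.2⟩
    have d1 := ((hx1 hxm a (by simp)).const_add (y a)).deriv
    have d2 := ((hx2 hxm a (by simp)).const_add (z a)).deriv
    rw [d1, d2, ← hy.2 x hxI, ← hz.2 x hxI]
  rw [hcongr, key]
  ring

lemma comp_sub (hy : IsPrim a b y g) (c : ℝ) :
    IsPrim (a + c) (b + c) (fun t => y (t - c)) (fun t => g (t - c)) := by
  refine ⟨by simpa using hy.1.comp_sub_right c, fun t ht => ?_⟩
  have := hy.2 (t - c) ⟨by linarith [ht.1], by linarith [ht.2]⟩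
  simp only [add_sub_cancel_right]
  rw [this, intervalIntegral.integral_comp_sub_right (fun s => g s) c]
  simp

/-- Variation of constants for `y' = q - y`. -/
lemma exp_mul (hab : a ≤ b) {q : ℝ → ℝ} (hy : IsPrim a b y (fun t => q t - y t)) :
    IsPrim a b (fun t => exp t * y t) (fun t => exp t * q t) := by
  have he : IsPrim a b (fun t => exp t) (fun t => exp t) :=
    of_hasDeriv hab (fun t _ => (Real.hasDerivAt_exp t).hasDerivWithinAt)
      Real.continuous_exp.continuousOn
  exact (he.mul hab hy).congr_right hab (h := fun t => exp t * q t) fun t _ => by ring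

lemma of_exp_mul (hab : a ≤ b) {q : ℝ → ℝ}
    (hy : IsPrim a b (fun t => exp t * y t) (fun t => exp t * q t)) :
    IsPrim a b y (fun t => q t - y t) := by
  have he : IsPrim a b (fun t => exp (-t)) (fun t => -exp (-t)) :=
    of_hasDeriv hab (fun t _ => by simpa using (hasDerivAt_neg t).exp.hasDerivWithinAt)
      (by fun_prop)
  have h := (he.mul hab hy).congr_right hab (h := fun t => q t - y t) fun t _ => by
    have : exp (-t) * exp t = 1 := by rw [← exp_add]; simp
    linear_combination (q t - y t) * this
  refine ⟨h.1, fun t ht => ?_⟩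
  have e : ∀ t, exp (-t) * (exp t * y t) = y t := fun t => by
    rw [← mul_assoc, ← exp_add]; simp
  simpa only [e] using h.2 t ht

end IsPrim

/-- `g` is absolutely continuous along the characteristics in the half space `η ≥ 0`, with
derivative `Q`. -/
def HasTransport (F : ℝ → ℝ) (g Q : ℝ → ℝ → ℝ) : Prop :=
  ∀ (a b : ℝ) (X Φ : ℝ → ℝ), a ≤ b → IsCharacteristic F a b X Φ →
    IntervalIntegrable (fun t => Q (X t) (Φ t)) volume a b ∧
    g (X b) (Φ b) - g (X a) (Φ a) = ∫ t in a..b, Q (X t) (Φ t)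

lemma IsCharacteristic.mono {F : ℝ → ℝ} {a b s t : ℝ} {X Φ : ℝ → ℝ}
    (h : IsCharacteristic F a b X Φ) (hs : a ≤ s) (ht : t ≤ b) : IsCharacteristic F s t X Φ := by
  intro r hr
  have hsub := Icc_subset_Icc hs ht
  obtain ⟨h0, h1, h2⟩ := h r (hsub hr)
  exact ⟨h0, h1.mono hsub, h2.mono hsub⟩

namespace HasTransport

variable {F : ℝ → ℝ} {g g' Q Q' : ℝ → ℝ → ℝ}

lemma isPrim (h : HasTransport F g Q) {a b : ℝ} {X Φ : ℝ → ℝ} (hab : a ≤ b)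
    (hX : IsCharacteristic F a b X Φ) :
    IsPrim a b (fun t => g (X t) (Φ t)) (fun t => Q (X t) (Φ t)) :=
  ⟨(h a b X Φ hab hX).1, fun t ht => by
    rw [← (h a t X Φ ht.1 (hX.mono le_rfl ht.2)).2]; ring⟩

lemma of_isPrim (h : ∀ (a b : ℝ) (X Φ : ℝ → ℝ), a ≤ b → IsCharacteristic F a b X Φ →
    IsPrim a b (fun t => g (X t) (Φ t)) (fun t => Q (X t) (Φ t))) : HasTransport F g Q :=
  fun a b X Φ hab hX => ⟨(h a b X Φ hab hX).1, by
    linear_combination (h a b X Φ hab hX).2 b ⟨hab, le_rfl⟩⟩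

lemma congr_right (h : HasTransport F g Q) (hQ : ∀ η, 0 ≤ η → ∀ φ, Q η φ = Q' η φ) :
    HasTransport F g Q' :=
  of_isPrim fun _ _ _ _ hab hX => (h.isPrim hab hX).congr_right hab fun t ht => hQ _ (hX t ht).1 _

lemma add (h : HasTransport F g Q) (h' : HasTransport F g' Q') :
    HasTransport F (fun η φ => g η φ + g' η φ) (fun η φ => Q η φ + Q' η φ) :=
  of_isPrim fun _ _ _ _ hab hX => (h.isPrim hab hX).add (h'.isPrim hab hX)

lemma const_mul (c : ℝ) (h : HasTransport F g Q) :
    HasTransport F (fun η φ => c * g η φ) (fun η φ => c * Q η φ) :=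
  of_isPrim fun _ _ _ _ hab hX => (h.isPrim hab hX).const_mul c

lemma const (F : ℝ → ℝ) (c : ℝ) : HasTransport F (fun _ _ => c) (fun _ _ => 0) :=
  of_isPrim fun a b _ _ _ _ => IsPrim.const a b c

lemma mul (h : HasTransport F g Q) (h' : HasTransport F g' Q') :
    HasTransport F (fun η φ => g η φ * g' η φ) (fun η φ => Q η φ * g' η φ + g η φ * Q' η φ) :=
  of_isPrim fun _ _ _ _ hab hX => (h.isPrim hab hX).mul hab (h'.isPrim hab hX)

/-- Every characteristic is a translate in time of a piece of a flow line, so flow lines started at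
time `0` suffice. -/
lemma of_flow {γ : ℝ → ℝ × ℝ → ℝ × ℝ} (hγ : IsFlow F γ)
    (h : ∀ (p : ℝ × ℝ) (T : ℝ), 0 ≤ T → (∀ s ∈ Icc 0 T, 0 ≤ (γ s p).1) →
      IsPrim 0 T (fun s => g (γ s p).1 (γ s p).2) (fun s => Q (γ s p).1 (γ s p).2)) :
    HasTransport F g Q := by
  refine of_isPrim fun a b X Φ hab hX => ?_
  have e : ∀ t ∈ Icc a b, (X t, Φ t) = γ (t - a) (X a, Φ a) := fun t ht =>
    hγ.unique a b X Φ hX a ⟨le_rfl, hab⟩ t ht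
  have h1 := (h (X a, Φ a) (b - a) (by linarith) fun s hs => by
    have := e (s + a) ⟨by linarith [hs.1], by linarith [hs.2]⟩
    rw [add_sub_cancel_right] at this
    rw [← this]
    exact (hX (s + a) ⟨by linarith [hs.1], by linarith [hs.2]⟩).1).comp_sub a
  simp only [zero_add, sub_add_cancel] at h1
  have eX : ∀ t ∈ Icc a b, (γ (t - a) (X a, Φ a)).1 = X t := fun t ht => by rw [← e t ht]
  have eΦ : ∀ t ∈ Icc a b, (γ (t - a) (X a, Φ a)).2 = Φ t := fun t ht => by rw [← e t ht]
  have h2 := h1.congr_right hab (h := fun t => Q (X t) (Φ t)) fun t ht => by rw [eX t ht, eΦ t ht]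
  refine ⟨h2.1, fun t ht => ?_⟩
  have := h2.2 t ht
  simp only [eX t ht, eΦ t ht, eX a ⟨le_rfl, hab⟩, eΦ a ⟨le_rfl, hab⟩] at this
  exact this

/-- The chain rule for separated products, from which the barrier and the linear supersolution are
obtained. -/
lemma prod (hF : Admissible F) {e e' β β' : ℝ → ℝ} (he : ∀ x, HasDerivAt e (e' x) x)
    (hβ : ∀ x, HasDerivAt β (β' x) x) (hec : Continuous e') (hβc : Continuous β') :
    HasTransport F (fun η φ => e η * β φ)
      (fun η φ => e' η * sin φ * β φ + e η * (β' φ * (F η * cos φ))) := by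
  refine of_isPrim fun a b X Φ hab hX => ?_
  have cX : ContinuousOn X (Icc a b) := fun t ht => (hX t ht).2.1.continuousWithinAt
  have cΦ : ContinuousOn Φ (Icc a b) := fun t ht => (hX t ht).2.2.continuousWithinAt
  have ce : Continuous e := continuous_iff_continuousAt.2 fun x => (he x).continuousAt
  have cβ : Continuous β := continuous_iff_continuousAt.2 fun x => (hβ x).continuousAt
  refine IsPrim.of_hasDeriv hab (fun t ht => ?_) ?_
  · obtain ⟨_, h1, h2⟩ := hX t ht
    exact ((he (X t)).comp_hasDerivWithinAt t h1).mul ((hβ (Φ t)).comp_hasDerivWithinAt t h2)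
  · have c1 := hec.comp_continuousOn cX
    have c2 := ce.comp_continuousOn cX
    have c3 := cβ.comp_continuousOn cΦ
    have c4 := hβc.comp_continuousOn cΦ
    have c5 := hF.continuous.comp_continuousOn cX
    have c6 := Real.continuous_sin.comp_continuousOn cΦ
    have c7 := Real.continuous_cos.comp_continuousOn cΦ
    exact ((c1.mul c6).mul c3).add (c2.mul (c4.mul (c5.mul c7)))

/-- The value at a point in terms of the values on the backward characteristic. -/
lemma backward {γ : ℝ → ℝ × ℝ → ℝ × ℝ} (hγ : IsFlow F γ) {f q : ℝ → ℝ → ℝ}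
    (h : HasTransport F f (fun η φ => q η φ - f η φ)) (p : ℝ × ℝ) {T : ℝ} (hT : 0 ≤ T)
    (hp : ∀ s ∈ Icc 0 T, 0 ≤ (γ (-s) p).1) :
    IntervalIntegrable (fun s => exp (-s) * q (γ (-s) p).1 (γ (-s) p).2) volume 0 T ∧
    f p.1 p.2 = exp (-T) * f (γ (-T) p).1 (γ (-T) p).2 +
      ∫ s in (0 : ℝ)..T, exp (-s) * q (γ (-s) p).1 (γ (-s) p).2 := by
  have hT' : -T ≤ 0 := by linarith
  have hch := hγ.isCharacteristic p 0 (a := -T) (b := 0) fun t ht => by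
    have := hp (-t) ⟨by linarith [ht.2], by linarith [ht.1]⟩
    simpa using this
  have h1 := (h.isPrim hT' hch).exp_mul hT'
  simp only [add_zero] at h1
  have h2 := h1.2 0 ⟨hT', le_rfl⟩
  simp only [exp_zero, one_mul, hγ.zero] at h2
  refine ⟨?_, ?_⟩
  · have := (IntervalIntegrable.iff_comp_neg (by finiteness)).1 h1.1.symm
    simpa using this
  · rw [h2]
    congr 1
    have := intervalIntegral.integral_comp_neg (a := 0) (b := T)
      (fun t => exp t * q (γ t p).1 (γ t p).2)
    rw [this, neg_zero]

end HasTransport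

/-! ### Angular averages and linear operations on solutions. -/

lemma avg_add {f g : ℝ → ℝ → ℝ} {η : ℝ} (hf : IntervalIntegrable (f η) volume (-π) π)
    (hg : IntervalIntegrable (g η) volume (-π) π) :
    avg (fun η φ => f η φ + g η φ) η = avg f η + avg g η := by
  simp only [avg]
  rw [intervalIntegral.integral_add hf hg]
  ring

lemma avg_const_mul (c : ℝ) (f : ℝ → ℝ → ℝ) (η : ℝ) :
    avg (fun η φ => c * f η φ) η = c * avg f η := by
  simp only [avg]
  rw [intervalIntegral.integral_const_mul]
  ring

lemma avg_const (c η : ℝ) : avg (fun _ _ => c) η = c := by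
  simp only [avg, intervalIntegral.integral_const, smul_eq_mul]
  field_simp
  ring

lemma avg_mono {f g : ℝ → ℝ → ℝ} {η : ℝ} (hf : IntervalIntegrable (f η) volume (-π) π)
    (hg : IntervalIntegrable (g η) volume (-π) π) (h : ∀ φ, f η φ ≤ g η φ) :
    avg f η ≤ avg g η := by
  simp only [avg]
  have := pi_pos
  refine mul_le_mul_of_nonneg_left ?_ (by positivity)
  exact intervalIntegral.integral_mono (by linarith) hf hg h

lemma avg_le {f : ℝ → ℝ → ℝ} {η N : ℝ} (hf : IntervalIntegrable (f η) volume (-π) π)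
    (h : ∀ φ, f η φ ≤ N) : avg f η ≤ N := by
  have := avg_mono (g := fun _ _ => N) hf intervalIntegrable_const h
  rwa [avg_const] at this

lemma le_avg {f : ℝ → ℝ → ℝ} {η N : ℝ} (hf : IntervalIntegrable (f η) volume (-π) π)
    (h : ∀ φ, N ≤ f η φ) : N ≤ avg f η := by
  have := avg_mono (f := fun _ _ => N) intervalIntegrable_const hf h
  rwa [avg_const] at this

/-- `f` solves the transport equation with source `S`, and all its angular averages are honest. -/
structure IsSol (F : ℝ → ℝ) (S f : ℝ → ℝ → ℝ) : Prop where
  transport : HasTransport F f (fun η φ => avg f η - f η φ + S η φ)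
  int : ∀ η, 0 ≤ η → IntervalIntegrable (f η) volume (-π) π

namespace IsSol

variable {F : ℝ → ℝ} {S S' f f' : ℝ → ℝ → ℝ}

lemma add (h : IsSol F S f) (h' : IsSol F S' f') :
    IsSol F (fun η φ => S η φ + S' η φ) (fun η φ => f η φ + f' η φ) :=
  ⟨(h.transport.add h'.transport).congr_right fun η hη φ => by
    rw [avg_add (h.int η hη) (h'.int η hη)]; ring, fun η hη => (h.int η hη).add (h'.int η hη)⟩

lemma const_mul (c : ℝ) (h : IsSol F S f) :
    IsSol F (fun η φ => c * S η φ) (fun η φ => c * f η φ) :=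
  ⟨(h.transport.const_mul c).congr_right fun η hη φ => by
    rw [avg_const_mul]; ring, fun η hη => (h.int η hη).const_mul c⟩

lemma const (F : ℝ → ℝ) (c : ℝ) : IsSol F (fun _ _ => 0) (fun _ _ => c) :=
  ⟨(HasTransport.const F c).congr_right fun η _ φ => by rw [avg_const]; ring,
    fun _ _ => intervalIntegrable_const⟩

lemma congr_right (h : IsSol F S f) (hS : ∀ η, 0 ≤ η → ∀ φ, S η φ = S' η φ) : IsSol F S' f :=
  ⟨h.transport.congr_right fun η hη φ => by rw [hS η hη φ], h.int⟩

end IsSol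

/-! ### Explicit sub- and supersolutions. -/

/-- The angular profile of the exponential barrier. -/
def ang (k φ : ℝ) : ℝ := 2 / k ^ 2 + 2 / k * sin φ - cos (2 * φ)

/-- An exponentially decaying strict subsolution of the homogeneous equation. -/
def barrier (k η φ : ℝ) : ℝ := exp (-(k * η)) * ang k φ

/-- The source term of `barrier`. -/
def barrierSource (F : ℝ → ℝ) (k η φ : ℝ) : ℝ :=
  -(exp (-(k * η)) *
    (1 - k * sin φ * cos (2 * φ) - F η * cos φ ^ 2 * (2 / k + 4 * sin φ)))

lemma continuous_ang (k : ℝ) : Continuous (ang k) := by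
  unfold ang; fun_prop

lemma integral_ang (k : ℝ) : ∫ φ in (-π)..π, ang k φ = 2 * π * (2 / k ^ 2) := by
  have h1 : ∫ φ in (-π)..π, cos (2 * φ) = 0 := by
    rw [intervalIntegral.integral_comp_mul_left (fun x => cos x) two_ne_zero]
    simp
  have h2 : ∫ φ in (-π)..π, 2 / k * sin φ = 0 := by simp
  have h3 : ∫ φ in (-π)..π, (2 / k ^ 2 : ℝ) = 2 * π * (2 / k ^ 2) := by
    simp only [intervalIntegral.integral_const, smul_eq_mul]; ring
  unfold ang
  rw [intervalIntegral.integral_sub, intervalIntegral.integral_add, h1, h2, h3]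
  · ring
  all_goals exact Continuous.intervalIntegrable (by fun_prop) _ _

lemma avg_mul_ang (e : ℝ → ℝ) (k η : ℝ) :
    avg (fun η φ => e η * ang k φ) η = e η * (2 / k ^ 2) := by
  simp only [avg]
  rw [intervalIntegral.integral_const_mul, integral_ang]
  have := pi_pos
  field_simp

/-- With `t = 2 / k ≥ 4` the profile is at least `t ^ 2 / 2 - t - 1 > 0`. -/
lemma ang_bounds {k : ℝ} (hk : 0 < k) (hk' : k ≤ 1 / 2) (φ : ℝ) :
    0 ≤ ang k φ ∧ ang k φ ≤ 2 / k ^ 2 + 2 / k + 1 := by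
  have h1 : 4 ≤ 2 / k := by rw [le_div_iff₀ hk]; linarith
  have h2 : 2 / k ^ 2 = (2 / k) ^ 2 / 2 := by field_simp
  have hs := Real.neg_one_le_sin φ
  have hs' := Real.sin_le_one φ
  have hc := Real.neg_one_le_cos (2 * φ)
  have hc' := Real.cos_le_one (2 * φ)
  unfold ang
  rw [h2]
  constructor <;> nlinarith

lemma hasDerivAt_ang (k φ : ℝ) : HasDerivAt (ang k) (2 / k * cos φ + 2 * sin (2 * φ)) φ := by
  have h1 := (Real.hasDerivAt_sin φ).const_mul (2 / k)
  have h2 := ((hasDerivAt_id φ).const_mul 2).cos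
  have := (h1.const_add (2 / k ^ 2)).sub h2
  refine this.congr_deriv ?_
  simp [mul_comm]

/-- The coefficients of `ang` are tuned for cancellation. Differentiating the mean `2 / k ^ 2` in
`η` cancels the `2 / k * sin φ` of `f - avg f`, while the terms `2 * sin φ ^ 2` and `cos (2 * φ)`
add up to `1`, which makes the source strictly negative. -/
lemma isSol_barrier {F : ℝ → ℝ} (hF : Admissible F) {k : ℝ} (hk : 0 < k) :
    IsSol F (barrierSource F k) (barrier k) := by
  have he : ∀ x, HasDerivAt (fun η => exp (-(k * η))) (-k * exp (-(k * x))) x := fun x => by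
    have := (((hasDerivAt_id x).const_mul k).neg).exp
    refine this.congr_deriv ?_
    simp [mul_comm]
  have h := HasTransport.prod hF he (hasDerivAt_ang k) (by fun_prop) (by fun_prop)
  refine ⟨h.congr_right fun η _ φ => ?_, fun η _ =>
    (continuous_const.mul (continuous_ang k)).intervalIntegrable _ _⟩
  have : avg (barrier k) η = exp (-(k * η)) * (2 / k ^ 2) := avg_mul_ang _ k η
  rw [this]
  simp only [barrierSource, barrier, ang]
  rw [sin_two_mul, cos_two_mul]
  have hs : sin φ ^ 2 = 1 - cos φ ^ 2 := by rw [← sin_sq_add_cos_sq φ]; ring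
  field_simp
  linear_combination (-2 * k ^ 2) * hs

/-- For `k ≤ 1/2` one has `2 / k + 4 * sin φ ≥ 0`, so the force term has the favourable sign
whatever its size, and `k * sin φ * cos (2 * φ)` costs at most `1/2`. -/
lemma barrierSource_le {F : ℝ → ℝ} (hF : Admissible F) {k : ℝ} (hk : 0 < k) (hk' : k ≤ 1 / 2)
    (η φ : ℝ) : barrierSource F k η φ ≤ -(1 / 2 * exp (-(k * η))) := by
  unfold barrierSource
  rw [neg_le_neg_iff, mul_comm (1 / 2 : ℝ)]
  refine mul_le_mul_of_nonneg_left ?_ (exp_pos _).le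
  have h1 : 4 ≤ 2 / k := by rw [le_div_iff₀ hk]; linarith
  have h2 : 0 ≤ -F η * cos φ ^ 2 * (2 / k + 4 * sin φ) := by
    have := hF.nonpos η
    have := Real.neg_one_le_sin φ
    exact mul_nonneg (mul_nonneg (by linarith) (sq_nonneg _)) (by linarith)
  have h3 : |sin φ * cos (2 * φ)| ≤ 1 := by
    rw [abs_mul]
    exact mul_le_one₀ (Real.abs_sin_le_one _) (abs_nonneg _) (Real.abs_cos_le_one _)
  have h4 := (abs_le.1 h3).2
  nlinarith

/-- The linearly growing solution of the flat problem is a supersolution. -/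
lemma isSol_linear {F : ℝ → ℝ} (hF : Admissible F) :
    IsSol F (fun η φ => -F η * cos φ ^ 2) (fun η φ => η - sin φ) := by
  have h1 := HasTransport.prod hF (e := fun x => x) (e' := fun _ => 1) (β := fun _ => 1)
    (β' := fun _ => 0) (fun x => hasDerivAt_id x) (fun x => hasDerivAt_const x 1)
    continuous_const continuous_const
  have h2 := HasTransport.prod hF (e := fun _ => -1) (e' := fun _ => 0) (β := sin)
    (β' := cos) (fun x => hasDerivAt_const x (-1)) (fun x => Real.hasDerivAt_sin x)
    continuous_const Real.continuous_cos
  have h3 := h1.add h2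
  have e : (fun η φ : ℝ => η * 1 + -1 * sin φ) = fun η φ => η - sin φ := by
    ext η φ; ring
  rw [e] at h3
  refine ⟨h3.congr_right fun η _ φ => ?_, fun η _ => Continuous.intervalIntegrable (by fun_prop) _ _⟩
  have : avg (fun η φ => η - sin φ) η = η := by
    simp only [avg]
    rw [intervalIntegral.integral_sub (by simp) (by simp)]
    simp only [intervalIntegral.integral_const, integral_sin, smul_eq_mul, cos_neg, sub_self]
    have := pi_pos
    field_simp
    ring
  rw [this]
  ring

/-! ### The maximum principle in a half space. -/

lemma exists_first_le {u : ℝ → ℝ} (hu : Continuous u) {c T : ℝ} (h0 : c < u 0)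
    (hT : ∃ s ∈ Icc 0 T, u s ≤ c) :
    ∃ τ, 0 < τ ∧ τ ≤ T ∧ u τ = c ∧ ∀ s, 0 ≤ s → s < τ → c < u s := by
  set A := {s | 0 ≤ s ∧ u s ≤ c} with hA
  have hcl : IsClosed A := (isClosed_le continuous_const continuous_id).inter
    (isClosed_le hu continuous_const)
  obtain ⟨s, hs, hus⟩ := hT
  have hne : A.Nonempty := ⟨s, hs.1, hus⟩
  have hbdd : BddBelow A := ⟨0, fun x hx => hx.1⟩
  have hmem := hcl.csInf_mem hne hbdd
  set τ := sInf A
  have hlt : ∀ s, 0 ≤ s → s < τ → c < u s := fun s hs hsτ => by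
    by_contra hcon
    exact absurd (csInf_le hbdd ⟨hs, not_lt.1 hcon⟩) (not_le.2 hsτ)
  have hpos : 0 < τ := lt_of_le_of_ne hmem.1 fun h => by
    have := hmem.2; rw [← h] at this; linarith
  refine ⟨τ, hpos, (csInf_le hbdd ⟨hs.1, hus⟩).trans hs.2, le_antisymm hmem.2 ?_, hlt⟩
  have htend : Tendsto u (𝓝[<] τ) (𝓝 (u τ)) := hu.continuousAt.continuousWithinAt
  refine ge_of_tendsto htend ?_
  filter_upwards [Ioo_mem_nhdsLT hpos] with s hs using (hlt s hs.1.le hs.2).le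

lemma integral_exp_neg (T : ℝ) : ∫ s in (0 : ℝ)..T, exp (-s) = 1 - exp (-T) := by
  rw [intervalIntegral.integral_comp_neg (fun x => exp x)]
  simp

lemma IsSol.backward {F : ℝ → ℝ} {γ : ℝ → ℝ × ℝ → ℝ × ℝ} (hγ : IsFlow F γ) {S f : ℝ → ℝ → ℝ}
    (h : IsSol F S f) (p : ℝ × ℝ) {T : ℝ} (hT : 0 ≤ T) (hp : ∀ s ∈ Icc 0 T, 0 ≤ (γ (-s) p).1) :
    IntervalIntegrable (fun s => exp (-s) * (avg f (γ (-s) p).1 + S (γ (-s) p).1 (γ (-s) p).2))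
      volume 0 T ∧
    f p.1 p.2 = exp (-T) * f (γ (-T) p).1 (γ (-T) p).2 +
      ∫ s in (0 : ℝ)..T, exp (-s) * (avg f (γ (-s) p).1 + S (γ (-s) p).1 (γ (-s) p).2) :=
  HasTransport.backward hγ (q := fun η φ => avg f η + S η φ)
    (h.transport.congr_right fun η _ φ => by ring) p hT hp

/-- If the supremum `N` were positive, following each characteristic back for unit time, or to its
exit through `η₀`, would bound `g` by a number smaller than `N`. -/
lemma strict_comparison {F : ℝ → ℝ} (hF : Admissible F) {γ : ℝ → ℝ × ℝ → ℝ × ℝ} (hγ : IsFlow F γ)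
    {Q g : ℝ → ℝ → ℝ} (hg : IsSol F Q g) {η₀ R c B : ℝ} (h0 : 0 ≤ η₀) (hc : 0 < c)
    (hQ : ∀ η, η₀ < η → ∀ φ, Q η φ ≤ 0) (hQc : ∀ η, η₀ < η → η ≤ R + 1 → ∀ φ, Q η φ ≤ -c)
    (hB : ∀ η, η₀ < η → ∀ φ, g η φ ≤ B) (hR : ∀ η, η₀ < η → R ≤ η → ∀ φ, g η φ ≤ 0)
    (hbd : ∀ φ, 0 < sin φ → g η₀ φ ≤ 0) : ∀ η, η₀ < η → ∀ φ, g η φ ≤ 0 := by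
  by_contra! hcon
  obtain ⟨η₁, hη₁, φ₁, hpos⟩ := hcon
  set A : Set ℝ := {x | ∃ η φ, η₀ < η ∧ x = g η φ} with hA
  have hbdd : BddAbove A := ⟨B, by rintro x ⟨η, φ, h, rfl⟩; exact hB η h φ⟩
  have hne : A.Nonempty := ⟨_, η₁, φ₁, hη₁, rfl⟩
  set N := sSup A with hN
  have hle : ∀ η, η₀ < η → ∀ φ, g η φ ≤ N := fun η h φ => le_csSup hbdd ⟨η, φ, h, rfl⟩
  have hN0 : 0 < N := hpos.trans_le (hle _ hη₁ _)
  have havg : ∀ η, η₀ < η → avg g η ≤ N := fun η h =>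
    avg_le (hg.int η (h0.trans h.le)) (hle η h)
  have he1 : exp (-1) < 1 := by rw [exp_lt_one_iff]; norm_num
  -- The three entries bound `g` on a path that stays inside for unit time, on a path that exits
  -- earlier, and beyond level `R`. Each is below `N`.
  set N' := max (max (N - c * (1 - exp (-1))) ((1 - exp (-1)) * N)) 0 with hN'
  have hN'N : N' < N := by
    have := exp_pos (-1)
    refine max_lt (max_lt ?_ ?_) hN0
    · nlinarith
    · nlinarith
  refine absurd (csSup_le hne (a := N') ?_) (not_le.2 hN'N)
  rintro x ⟨η, φ, hη, rfl⟩
  rcases le_or_gt R η with hRη | hRη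
  · exact (hR η hη hRη φ).trans (le_max_right _ _)
  have hcont : Continuous fun s => (γ (-s) (η, φ)).1 :=
    (continuous_fst.comp (hγ.cont_left (η, φ))).comp continuous_neg
  by_cases hexit : ∃ s ∈ Icc (0 : ℝ) 1, (γ (-s) (η, φ)).1 ≤ η₀
  · obtain ⟨τ, hτ0, hτ1, hτ, hlt⟩ := exists_first_le hcont (by simpa [hγ.zero] using hη) hexit
    have hsin : 0 < sin (γ (-τ) (η, φ)).2 := by
      have := (hγ.fst_sub_le hF (η, φ) (s := -τ) (t := 0) (by linarith)).1
      rw [hτ, hγ.zero] at this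
      simp only [zero_sub, neg_neg] at this
      by_contra hneg
      nlinarith [not_lt.1 hneg]
    obtain ⟨hint, heq⟩ := hg.backward hγ (η, φ) hτ0.le fun s hs => by
      rcases hs.2.lt_or_eq with h | h
      · exact h0.trans (hlt s hs.1 h).le
      · rw [h, hτ]; exact h0
    have h1 : g (γ (-τ) (η, φ)).1 (γ (-τ) (η, φ)).2 ≤ 0 := by
      rw [hτ]; exact hbd _ hsin
    have h2 : ∫ s in (0 : ℝ)..τ, exp (-s) * (avg g (γ (-s) (η, φ)).1
        + Q (γ (-s) (η, φ)).1 (γ (-s) (η, φ)).2) ≤ ∫ s in (0 : ℝ)..τ, exp (-s) * N := by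
      refine intervalIntegral.integral_mono_on_of_le_Ioo hτ0.le hint
        (Continuous.intervalIntegrable (by fun_prop) _ _) fun s hs => ?_
      have hs' := hlt s hs.1.le hs.2
      have := havg _ hs'
      have := hQ _ hs' (γ (-s) (η, φ)).2
      exact mul_le_mul_of_nonneg_left (by linarith) (exp_pos _).le
    rw [intervalIntegral.integral_mul_const, integral_exp_neg] at h2
    have h3 : g η φ ≤ (1 - exp (-τ)) * N := by
      have := mul_nonpos_of_nonneg_of_nonpos (exp_pos (-τ)).le h1
      simp only at heq
      linarith
    have h4 : exp (-1) ≤ exp (-τ) := exp_le_exp.2 (by linarith)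
    refine h3.trans (le_trans ?_ ((le_max_right _ _).trans (le_max_left _ _)))
    gcongr
  · push Not at hexit
    obtain ⟨hint, heq⟩ := hg.backward hγ (η, φ) zero_le_one fun s hs =>
      h0.trans (hexit s hs).le
    have h1 := hle _ (hexit 1 ⟨zero_le_one, le_rfl⟩) (γ (-1) (η, φ)).2
    have h2 : ∫ s in (0 : ℝ)..1, exp (-s) * (avg g (γ (-s) (η, φ)).1
        + Q (γ (-s) (η, φ)).1 (γ (-s) (η, φ)).2) ≤ ∫ s in (0 : ℝ)..1, exp (-s) * (N - c) := by
      refine intervalIntegral.integral_mono_on zero_le_one hint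
        (Continuous.intervalIntegrable (by fun_prop) _ _) fun s hs => ?_
      have hs' := hexit s hs
      have := havg _ hs'
      -- The speed in `η` is at most one: a path starting below `R` stays below `R + 1` during unit
      -- time, where the strict bound on the source holds.
      have hX := hγ.abs_fst_sub_le (η, φ) (-s)
      rw [abs_neg, abs_of_nonneg hs.1] at hX
      have hX' := (abs_le.1 hX).2
      have := hQc _ hs' (by simp only at hX'; linarith [hs.2]) (γ (-s) (η, φ)).2
      exact mul_le_mul_of_nonneg_left (by linarith) (exp_pos _).le
    rw [intervalIntegral.integral_mul_const, integral_exp_neg] at h2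
    have h3 : g η φ ≤ N - c * (1 - exp (-1)) := by
      have := mul_le_mul_of_nonneg_left h1 (exp_pos (-1)).le
      simp only at heq
      nlinarith
    exact h3.trans ((le_max_left _ _).trans (le_max_left _ _))

/-- The maximum principle for bounded subsolutions in `η > η₀`. -/
lemma comparison {F : ℝ → ℝ} (hF : Admissible F) {γ : ℝ → ℝ × ℝ → ℝ × ℝ} (hγ : IsFlow F γ)
    {Q g : ℝ → ℝ → ℝ} (hg : IsSol F Q g) {η₀ B : ℝ} (h0 : 0 ≤ η₀)
    (hQ : ∀ η, η₀ < η → ∀ φ, Q η φ ≤ 0) (hB : ∀ η, η₀ < η → ∀ φ, g η φ ≤ B)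
    (hbd : ∀ φ, 0 < sin φ → g η₀ φ ≤ 0) : ∀ η, η₀ < η → ∀ φ, g η φ ≤ 0 := by
  -- The constant `14` compensates `sin φ ≤ 1` and `barrier (1 / 2) ≤ 13`, so that `H ≥ η`. The
  -- barrier makes the supersolution strict.
  set H : ℝ → ℝ → ℝ := fun η φ => (η - sin φ) + (14 + -1 * barrier (1 / 2) η φ) with hH
  have hHη : ∀ η, 0 ≤ η → ∀ φ, η ≤ H η φ := by
    intro η hη φ
    have h1 := ang_bounds (k := 1 / 2) (by norm_num) le_rfl φ
    norm_num at h1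
    have h2 : exp (-(1 / 2 * η)) ≤ 1 := by rw [exp_le_one_iff]; linarith
    have h3 := exp_pos (-(1 / 2 * η))
    have h4 : barrier (1 / 2) η φ ≤ 13 := by
      unfold barrier
      nlinarith
    have := Real.sin_le_one φ
    simp only [hH]
    linarith
  have hHsol : IsSol F (fun η φ => -F η * cos φ ^ 2 + (0 + -1 * barrierSource F (1 / 2) η φ)) H :=
    (isSol_linear hF).add ((IsSol.const F 14).add ((isSol_barrier hF (by norm_num)).const_mul (-1)))
  -- Subtracting `δ * H` makes the source strictly negative on bounded ranges and the function
  -- nonpositive from level `B / δ` on. Afterwards `δ` tends to `0`.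
  have main : ∀ δ, 0 < δ → ∀ η, η₀ < η → ∀ φ, g η φ + -δ * H η φ ≤ 0 := by
    intro δ hδ
    have hsol := hg.add (hHsol.const_mul (-δ))
    have hQle : ∀ η, η₀ < η → ∀ φ, Q η φ + -δ * (-F η * cos φ ^ 2 +
        (0 + -1 * barrierSource F (1 / 2) η φ)) ≤ -(δ * (1 / 2 * exp (-(1 / 2 * η)))) := by
      intro η hη φ
      have h1 := hQ η hη φ
      have h2 := barrierSource_le hF (k := 1 / 2) (by norm_num) le_rfl η φ
      have h3 : 0 ≤ -F η * cos φ ^ 2 := mul_nonneg (by linarith [hF.nonpos η]) (sq_nonneg _)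
      nlinarith
    refine strict_comparison hF hγ hsol (R := B / δ) (c := δ * (1 / 2 * exp (-(1 / 2 * (B / δ + 1)))))
      (B := B) h0 (by positivity) (fun η hη φ => (hQle η hη φ).trans ?_)
      (fun η hη hηR φ => (hQle η hη φ).trans ?_) (fun η hη φ => ?_) (fun η hη hRη φ => ?_)
      (fun φ hφ => ?_)
    · have : 0 ≤ δ * (1 / 2 * exp (-(1 / 2 * η))) := by positivity
      linarith
    · rw [neg_le_neg_iff]
      gcongr
    · have := hHη η (h0.trans hη.le) φ
      have := hB η hη φ
      nlinarith
    · have := hHη η (h0.trans hη.le) φ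
      have := hB η hη φ
      rw [div_le_iff₀ hδ] at hRη
      nlinarith
    · have := hHη η₀ h0 φ
      have := hbd φ hφ
      nlinarith
  intro η hη φ
  refine le_of_forall_pos_le_add fun e he => ?_
  have hpos : 0 < H η φ := (h0.trans_lt hη).trans_le (hHη η (h0.trans hη.le) φ)
  have := main (e / H η φ) (by positivity) η hη φ
  have h2 : e / H η φ * H η φ = e := by field_simp
  linarith

/-! ### Measurability, and position as a variable on backward arcs. -/

lemma measurable_avg {f : ℝ → ℝ → ℝ} (hf : Measurable fun p : ℝ × ℝ => f p.1 p.2) :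
    Measurable (avg f) := by
  have hs : StronglyMeasurable (Function.uncurry f) := hf.stronglyMeasurable
  have h : ∀ a b : ℝ, Measurable fun η => ∫ φ in Ioc a b, f η φ := fun a b =>
    hs.integral_prod_right.measurable
  unfold avg intervalIntegral
  exact ((h _ _).sub (h _ _)).const_mul _

lemma measurable_section {f : ℝ → ℝ → ℝ} (hf : Measurable fun p : ℝ × ℝ => f p.1 p.2) (η : ℝ) :
    Measurable (f η) := hf.comp (measurable_const.prodMk measurable_id)

lemma intervalIntegrable_of_bounded {f : ℝ → ℝ} (hf : Measurable f) {a b B : ℝ} (hab : a ≤ b)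
    (h : ∀ x ∈ Icc a b, |f x| ≤ B) : IntervalIntegrable f volume a b := by
  rw [intervalIntegrable_iff_integrableOn_Icc_of_le hab]
  refine Measure.integrableOn_of_bounded (M := B) (by simp) hf.aestronglyMeasurable ?_
  filter_upwards [ae_restrict_mem measurableSet_Icc] with x hx using h x hx

namespace IsFlow

variable {F : ℝ → ℝ} {γ : ℝ → ℝ × ℝ → ℝ × ℝ}

lemma deriv_fst_neg (hγ : IsFlow F γ) (p : ℝ × ℝ) (s : ℝ) :
    HasDerivAt (fun s => (γ (-s) p).1) (-sin (γ (-s) p).2) s := by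
  have := (hγ.deriv_fst p (-s)).scomp s (hasDerivAt_neg s)
  simpa [Function.comp_def] using this

lemma antitoneOn_fst_neg (hF : Admissible F) (hγ : IsFlow F γ) {p : ℝ × ℝ} (hp : 0 ≤ sin p.2)
    (T : ℝ) : AntitoneOn (fun s => (γ (-s) p).1) (Icc 0 T) := by
  refine antitoneOn_of_deriv_nonpos (convex_Icc 0 T)
    (fun s _ => (hγ.deriv_fst_neg p s).continuousAt.continuousWithinAt)
    (fun s _ => (hγ.deriv_fst_neg p s).differentiableAt.differentiableWithinAt) fun s hs => ?_
  rw [(hγ.deriv_fst_neg p s).deriv]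
  rw [interior_Icc] at hs
  have := hγ.antitone_sin hF p (show -s ≤ 0 by linarith [hs.1])
  simp only [hγ.zero] at this
  linarith

lemma image_fst_neg (hF : Admissible F) (hγ : IsFlow F γ) {p : ℝ × ℝ} (hp : 0 ≤ sin p.2)
    {T : ℝ} (hT : 0 ≤ T) :
    (fun s => (γ (-s) p).1) '' Icc 0 T = Icc (γ (-T) p).1 p.1 := by
  have hanti := hγ.antitoneOn_fst_neg hF hp T
  apply Subset.antisymm
  · rintro _ ⟨s, hs, rfl⟩
    refine ⟨hanti hs ⟨hT, le_rfl⟩ hs.2, ?_⟩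
    simpa [hγ.zero] using hanti ⟨le_rfl, hT⟩ hs hs.1
  · have := intermediate_value_Icc' hT (f := fun s => (γ (-s) p).1)
      (fun s _ => (hγ.deriv_fst_neg p s).continuousAt.continuousWithinAt)
    simpa [hγ.zero] using this

/-- Change of variables from time to position on a backward characteristic with `sin φ ≥ 0`. -/
lemma integrableOn_arc_iff (hF : Admissible F) (hγ : IsFlow F γ) {p : ℝ × ℝ} (hp : 0 ≤ sin p.2)
    {T : ℝ} (hT : 0 ≤ T) (w : ℝ → ℝ) :
    IntegrableOn w (Icc (γ (-T) p).1 p.1) ↔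
      IntegrableOn (fun s => sin (γ (-s) p).2 * w (γ (-s) p).1) (Icc 0 T) := by
  rw [← hγ.image_fst_neg hF hp hT, integrableOn_image_iff_integrableOn_deriv_smul_of_antitoneOn
    measurableSet_Icc (fun s _ => (hγ.deriv_fst_neg p s).hasDerivWithinAt)
    (hγ.antitoneOn_fst_neg hF hp T)]
  simp

lemma integral_arc (hF : Admissible F) (hγ : IsFlow F γ) {p : ℝ × ℝ} (hp : 0 ≤ sin p.2)
    {T : ℝ} (hT : 0 ≤ T) (w : ℝ → ℝ) :
    ∫ x in Icc (γ (-T) p).1 p.1, w x = ∫ s in Icc 0 T, sin (γ (-s) p).2 * w (γ (-s) p).1 := by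
  rw [← hγ.image_fst_neg hF hp hT, integral_image_eq_integral_deriv_smul_of_antitoneOn
    measurableSet_Icc (fun s _ => (hγ.deriv_fst_neg p s).hasDerivWithinAt)
    (hγ.antitoneOn_fst_neg hF hp T)]
  simp

end IsFlow

/-! ### Minorization of nonnegative solutions and exponential decay. -/

section Doeblin

variable {F : ℝ → ℝ} {γ : ℝ → ℝ × ℝ → ℝ × ℝ} {S u : ℝ → ℝ → ℝ} {η₀ s₀ B : ℝ}

/-- A steep backward path crosses the layer in time at most `2`, and it spends at least `dx` in each
slab because `sin φ ≤ 1`. It thus collects at least `exp (-2)` times the integral of the average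
over the layer. -/
lemma lower_bound_steep (hF : Admissible F) (hγ : IsFlow F γ) (hu : IsSol F S u)
    (hm : Measurable fun p : ℝ × ℝ => u p.1 p.2) (h0 : 0 ≤ η₀)
    (hu0 : ∀ η, η₀ ≤ η → ∀ φ, 0 ≤ u η φ) (huB : ∀ η, η₀ ≤ η → ∀ φ, u η φ ≤ B)
    (hS : ∀ η, η₀ ≤ η → ∀ φ, |S η φ| ≤ s₀) {y φ : ℝ} (hy : η₀ + 1 / 4 ≤ y) (hy' : y ≤ η₀ + 1)
    (hφ : 1 / 2 ≤ sin φ) :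
    exp (-2) * (∫ x in η₀..(η₀ + 1 / 4), avg u x) - s₀ ≤ u y φ := by
  have hs0 : 0 ≤ s₀ := (abs_nonneg _).trans (hS η₀ le_rfl 0)
  have hcont : Continuous fun s => (γ (-s) (y, φ)).1 :=
    (continuous_fst.comp (hγ.cont_left (y, φ))).comp continuous_neg
  -- The slope stays at least `1/2` backward in time, so level `η₀` is reached before time `2 * (y -
  -- η₀)`.
  have hexit : (γ (-(2 * (y - η₀))) (y, φ)).1 ≤ η₀ := by
    have h1 := (hγ.fst_sub_le hF (y, φ) (s := -(2 * (y - η₀))) (t := 0) (by linarith)).2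
    rw [hγ.zero] at h1
    simp only at h1
    nlinarith
  obtain ⟨τ, hτ0, hτ2, hτ, hlt⟩ := exists_first_le hcont
    (by simp only [neg_zero, hγ.zero]; linarith : η₀ < (γ (-0) (y, φ)).1)
    ⟨2 * (y - η₀), ⟨by linarith, le_rfl⟩, hexit⟩
  have hge : ∀ s ∈ Icc 0 τ, η₀ ≤ (γ (-s) (y, φ)).1 := fun s hs => by
    rcases hs.2.lt_or_eq with h | h
    · exact (hlt s hs.1 h).le
    · rw [h, hτ]
  obtain ⟨hint, heq⟩ := hu.backward hγ (y, φ) hτ0.le fun s hs => h0.trans (hge s hs)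
  have havg0 : ∀ x, η₀ ≤ x → 0 ≤ avg u x := fun x hx => le_avg (hu.int x (h0.trans hx)) (hu0 x hx)
  have havgB : ∀ x, η₀ ≤ x → avg u x ≤ B := fun x hx => avg_le (hu.int x (h0.trans hx)) (huB x hx)
  have hiavg : ∀ b, η₀ ≤ b → IntervalIntegrable (avg u) volume η₀ b := fun b hb =>
    intervalIntegrable_of_bounded (measurable_avg hm) hb fun x hx =>
      abs_le.2 ⟨by linarith [havg0 x hx.1, havgB x hx.1], havgB x hx.1⟩
  have hyη : η₀ ≤ y := by linarith
  have hsp : 0 ≤ sin ((y, φ) : ℝ × ℝ).2 := by simp only; linarith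
  have harc := hγ.integral_arc hF hsp hτ0.le (avg u)
  have harci := (hγ.integrableOn_arc_iff hF hsp hτ0.le (avg u)).1 (by
    rw [hτ]; exact (intervalIntegrable_iff_integrableOn_Icc_of_le hyη).1 (hiavg y hyη))
  rw [hτ, integral_Icc_eq_integral_Ioc, integral_Icc_eq_integral_Ioc,
    ← intervalIntegral.integral_of_le hyη, ← intervalIntegral.integral_of_le hτ0.le] at harc
  have harci' : IntervalIntegrable
      (fun s => sin (γ (-s) (y, φ)).2 * avg u (γ (-s) (y, φ)).1) volume 0 τ :=
    (intervalIntegrable_iff_integrableOn_Icc_of_le hτ0.le).2 harci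
  have hmono : ∫ s in (0 : ℝ)..τ, (exp (-2) * (sin (γ (-s) (y, φ)).2 * avg u (γ (-s) (y, φ)).1)
      - exp (-s) * s₀) ≤ ∫ s in (0 : ℝ)..τ, exp (-s) * (avg u (γ (-s) (y, φ)).1
        + S (γ (-s) (y, φ)).1 (γ (-s) (y, φ)).2) := by
    refine intervalIntegral.integral_mono_on hτ0.le ((harci'.const_mul _).sub
      (Continuous.intervalIntegrable (by fun_prop) _ _)) hint fun s hs => ?_
    have hX := hge s hs
    have h1 := havg0 _ hX
    have h2 := (abs_le.1 (hS _ hX (γ (-s) (y, φ)).2)).1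
    have h3 : exp (-2) ≤ exp (-s) := exp_le_exp.2 (by linarith [hs.2])
    have h4 := Real.sin_le_one (γ (-s) (y, φ)).2
    have h5 : exp (-2) * (sin (γ (-s) (y, φ)).2 * avg u (γ (-s) (y, φ)).1)
        ≤ exp (-s) * avg u (γ (-s) (y, φ)).1 := by
      refine (mul_le_mul_of_nonneg_left (mul_le_of_le_one_left h1 h4) (exp_pos _).le).trans ?_
      exact mul_le_mul_of_nonneg_right h3 h1
    have h6 : exp (-s) * -s₀ ≤ exp (-s) * S (γ (-s) (y, φ)).1 (γ (-s) (y, φ)).2 :=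
      mul_le_mul_of_nonneg_left h2 (exp_pos _).le
    linarith
  rw [intervalIntegral.integral_sub (harci'.const_mul _)
    (Continuous.intervalIntegrable (by fun_prop) _ _), intervalIntegral.integral_const_mul,
    ← harc, intervalIntegral.integral_mul_const, integral_exp_neg] at hmono
  have hℓ : ∫ x in η₀..(η₀ + 1 / 4), avg u x ≤ ∫ x in η₀..y, avg u x := by
    refine intervalIntegral.integral_mono_interval le_rfl (by linarith) hy ?_ (hiavg y hyη)
    filter_upwards [ae_restrict_mem measurableSet_Ioc] with x hx using havg0 x hx.1.le
  have h1 := mul_le_mul_of_nonneg_left hℓ (exp_pos (-2)).le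
  have h2 := mul_nonneg (exp_pos (-τ)).le (hu0 _ (hge τ ⟨hτ0.le, le_rfl⟩) (γ (-τ) (y, φ)).2)
  have h3 := mul_nonneg (exp_pos (-τ)).le hs0
  simp only at heq
  linarith

/-- The steep directions `[π / 6, 5 * π / 6]` make up one third of the circle, and the others
contribute nonnegatively. -/
lemma lower_bound_avg (hF : Admissible F) (hγ : IsFlow F γ) (hu : IsSol F S u)
    (hm : Measurable fun p : ℝ × ℝ => u p.1 p.2) (h0 : 0 ≤ η₀)
    (hu0 : ∀ η, η₀ ≤ η → ∀ φ, 0 ≤ u η φ) (huB : ∀ η, η₀ ≤ η → ∀ φ, u η φ ≤ B)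
    (hS : ∀ η, η₀ ≤ η → ∀ φ, |S η φ| ≤ s₀) {y : ℝ} (hy : η₀ + 1 / 4 ≤ y) (hy' : y ≤ η₀ + 1) :
    1 / 3 * (exp (-2) * (∫ x in η₀..(η₀ + 1 / 4), avg u x) - s₀) ≤ avg u y := by
  set A := exp (-2) * (∫ x in η₀..(η₀ + 1 / 4), avg u x) - s₀ with hA
  have hpi := pi_pos
  have hint := hu.int y (by linarith)
  have h1 : ∫ φ in (π / 6)..(5 * π / 6), A ≤ ∫ φ in (π / 6)..(5 * π / 6), u y φ := by
    refine intervalIntegral.integral_mono_on (by linarith) intervalIntegrable_const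
      (hint.mono_set ?_) fun φ hφ => ?_
    · rw [uIcc_of_le (by linarith), uIcc_of_le (by linarith)]
      exact Icc_subset_Icc (by linarith) (by linarith)
    · refine lower_bound_steep hF hγ hu hm h0 hu0 huB hS hy hy' ?_
      rw [← Real.cos_pi_div_three, ← Real.cos_sub_pi_div_two]
      rw [← Real.cos_abs (φ - π / 2)]
      refine Real.cos_le_cos_of_nonneg_of_le_pi (abs_nonneg _) (by linarith) ?_
      rw [abs_le]
      constructor <;> linarith [hφ.1, hφ.2]
  have h2 : ∫ φ in (π / 6)..(5 * π / 6), u y φ ≤ ∫ φ in (-π)..π, u y φ := by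
    refine intervalIntegral.integral_mono_interval (by linarith) (by linarith) (by linarith) ?_ hint
    exact Eventually.of_forall fun φ => hu0 y (by linarith) φ
  have h3 := h1.trans h2
  simp only [intervalIntegral.integral_const, smul_eq_mul] at h3
  simp only [avg]
  have h4 : 1 / 3 * A = 1 / (2 * π) * ((5 * π / 6 - π / 6) * A) := by field_simp; ring
  rw [h4]
  exact mul_le_mul_of_nonneg_left h3 (by positivity)

/-- The constant of the minorization of nonnegative solutions. -/
def minor : ℝ := (1 - exp (-(1 / 4))) * exp (-2) / 3

/-- An upper bound for the angular profile of the barrier. -/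
def angBound (k : ℝ) : ℝ := 2 / k ^ 2 + 2 / k + 1

/-- Scattering spreads the bound from the averages to all directions at level `η₀ + 1/2`; the
maximum principle then carries it to all deeper levels, the barrier absorbing the source. -/
lemma lower_bound (hF : Admissible F) (hγ : IsFlow F γ) (hu : IsSol F S u)
    (hm : Measurable fun p : ℝ × ℝ => u p.1 p.2) (h0 : 0 ≤ η₀)
    (hu0 : ∀ η, η₀ ≤ η → ∀ φ, 0 ≤ u η φ) (huB : ∀ η, η₀ ≤ η → ∀ φ, u η φ ≤ B)
    {k : ℝ} (hk : 0 < k) (hk' : k ≤ 1 / 2)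
    (hS : ∀ η, η₀ ≤ η → ∀ φ, |S η φ| ≤ s₀ * exp (-(k * (η - η₀)))) :
    ∀ η, η₀ + 1 ≤ η → ∀ φ,
      minor * (∫ x in η₀..(η₀ + 1 / 4), avg u x) - s₀ * (2 + 2 * angBound k) ≤ u η φ := by
  have hs0 : 0 ≤ s₀ := by simpa using (abs_nonneg _).trans (hS η₀ le_rfl 0)
  have hS' : ∀ η, η₀ ≤ η → ∀ φ, |S η φ| ≤ s₀ := fun η hη φ => by
    refine (hS η hη φ).trans (mul_le_of_le_one_right hs0 ?_)
    rw [exp_le_one_iff]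
    nlinarith
  set ℓ := ∫ x in η₀..(η₀ + 1 / 4), avg u x with hℓ
  -- Over backward time `1/4` the path stays at least `1/4` above `η₀`, where averages are bounded
  -- below. This produces the factor `1 - exp (-(1/4))` of `minor`; the source costs at most `4/3 *
  -- s₀`.
  have hstart : ∀ φ, minor * ℓ - 2 * s₀ ≤ u (η₀ + 1 / 2) φ := by
    intro φ
    have hX : ∀ s ∈ Icc (0 : ℝ) (1 / 4), η₀ + 1 / 4 ≤ (γ (-s) (η₀ + 1 / 2, φ)).1 ∧
        (γ (-s) (η₀ + 1 / 2, φ)).1 ≤ η₀ + 1 := fun s hs => by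
      have := hγ.abs_fst_sub_le (η₀ + 1 / 2, φ) (-s)
      rw [abs_neg, abs_of_nonneg hs.1, abs_le] at this
      simp only at this
      constructor <;> linarith [hs.2]
    obtain ⟨hint, heq⟩ := hu.backward hγ (η₀ + 1 / 2, φ) (T := 1 / 4) (by norm_num) fun s hs => by
      linarith [(hX s hs).1]
    have hmono : ∫ s in (0 : ℝ)..(1 / 4), exp (-s) * (1 / 3 * (exp (-2) * ℓ - s₀) - s₀) ≤
        ∫ s in (0 : ℝ)..(1 / 4), exp (-s) * (avg u (γ (-s) (η₀ + 1 / 2, φ)).1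
        + S (γ (-s) (η₀ + 1 / 2, φ)).1 (γ (-s) (η₀ + 1 / 2, φ)).2) := by
      refine intervalIntegral.integral_mono_on (by norm_num)
        (Continuous.intervalIntegrable (by fun_prop) _ _) hint fun s hs => ?_
      obtain ⟨h1, h2⟩ := hX s hs
      have h3 := lower_bound_avg hF hγ hu hm h0 hu0 huB hS' h1 h2
      have hx : η₀ ≤ (γ (-s) (η₀ + 1 / 2, φ)).1 := by linarith
      have h4 := (abs_le.1 (hS' _ hx (γ (-s) (η₀ + 1 / 2, φ)).2)).1
      exact mul_le_mul_of_nonneg_left (by linarith) (exp_pos _).le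
    rw [intervalIntegral.integral_mul_const, integral_exp_neg] at hmono
    have hx : η₀ ≤ (γ (-(1 / 4)) (η₀ + 1 / 2, φ)).1 := by
      linarith [(hX (1 / 4) ⟨by norm_num, le_rfl⟩).1]
    have h1 := mul_nonneg (exp_pos (-(1 / 4))).le (hu0 _ hx (γ (-(1 / 4)) (η₀ + 1 / 2, φ)).2)
    have h2 : 0 ≤ exp (-(1 / 4)) * s₀ := by positivity
    simp only at heq
    unfold minor
    nlinarith
  intro η hη φ
  -- The barrier coefficient `2 * s₀ * exp (k * η₀)` turns the `1/2` in the barrier's source into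
  -- exactly the assumed bound on `S`.
  have hsol := (IsSol.const F (minor * ℓ - 2 * s₀ - 2 * s₀ * angBound k)).add
    ((hu.const_mul (-1)).add ((isSol_barrier hF hk).const_mul (2 * s₀ * exp (k * η₀))))
  have hbar : ∀ x, η₀ ≤ x → ∀ φ, 0 ≤ 2 * s₀ * exp (k * η₀) * barrier k x φ ∧
      2 * s₀ * exp (k * η₀) * barrier k x φ ≤ 2 * s₀ * angBound k := fun x hx φ => by
    obtain ⟨h1, h2⟩ := ang_bounds hk hk' φ
    unfold barrier angBound
    refine ⟨by positivity, ?_⟩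
    have h3 : exp (k * η₀) * exp (-(k * x)) ≤ 1 := by
      rw [← exp_add, exp_le_one_iff]; nlinarith
    calc 2 * s₀ * exp (k * η₀) * (exp (-(k * x)) * ang k φ)
        = 2 * s₀ * ((exp (k * η₀) * exp (-(k * x))) * ang k φ) := by ring
      _ ≤ 2 * s₀ * (1 * ang k φ) := by gcongr
      _ ≤ _ := by rw [one_mul]; gcongr
  have := comparison hF hγ hsol (η₀ := η₀ + 1 / 2) (B := minor * ℓ - 2 * s₀) (by linarith)
    (fun x hx φ => ?_) (fun x hx φ => ?_) (fun φ _ => ?_) η (by linarith) φ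
  · have hb := (hbar η (by linarith) φ).1
    linarith
  · have h1 := (abs_le.1 (hS x (by linarith) φ)).1
    have h2 := barrierSource_le hF hk hk' x φ
    have h3 : exp (-(k * (x - η₀))) = exp (k * η₀) * exp (-(k * x)) := by
      rw [← exp_add]; congr 1; ring
    rw [h3] at h1
    have h4 := mul_le_mul_of_nonneg_left h2 (show 0 ≤ 2 * s₀ * exp (k * η₀) by positivity)
    linarith
  · have h1 := hu0 x (by linarith) φ
    have h2 := (hbar x (by linarith) φ).2
    linarith
  · have h1 := hstart φ
    have h2 := (hbar (η₀ + 1 / 2) (by linarith) φ).2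
    linarith

end Doeblin

lemma minor_pos : 0 < minor := by
  unfold minor
  have h1 : exp (-(1 / 4)) < 1 := by rw [exp_lt_one_iff]; norm_num
  have h2 := exp_pos (-2)
  have : 0 < 1 - exp (-(1 / 4)) := by linarith
  positivity

lemma minor_lt_one : minor < 1 := by
  unfold minor
  have h1 := exp_pos (-(1 / 4))
  have h2 := exp_pos (-2)
  have h3 : exp (-2) < 1 := by rw [exp_lt_one_iff]; norm_num
  nlinarith

/-- The minorization applied to `f - m` and to `m' - f`: the layer integrals of the two averages sum
to `(m' - m) / 4`, so together the bounds improve by `minor / 4` of the oscillation, whichever of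
the two carries the mass. -/
lemma oscillation_step {F : ℝ → ℝ} {γ : ℝ → ℝ × ℝ → ℝ × ℝ} (hF : Admissible F) (hγ : IsFlow F γ)
    {S f : ℝ → ℝ → ℝ} (hf : IsSol F S f) (hm : Measurable fun p : ℝ × ℝ => f p.1 p.2)
    {η₀ s₀ k m m' : ℝ} (h0 : 0 ≤ η₀) (hfm : ∀ η, η₀ ≤ η → ∀ φ, m ≤ f η φ ∧ f η φ ≤ m')
    (hk : 0 < k) (hk' : k ≤ 1 / 2)
    (hS : ∀ η, η₀ ≤ η → ∀ φ, |S η φ| ≤ s₀ * exp (-(k * (η - η₀)))) :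
    ∃ n n', (∀ η, η₀ + 1 ≤ η → ∀ φ, n ≤ f η φ ∧ f η φ ≤ n') ∧
      n' - n ≤ (1 - minor / 4) * (m' - m) + s₀ * (4 + 4 * angBound k) := by
  have hu := (IsSol.const F (-m)).add hf
  have hv := (IsSol.const F m').add (hf.const_mul (-1))
  have h1 := lower_bound hF hγ hu (B := m' - m) (by fun_prop) h0
    (fun η hη φ => by linarith [(hfm η hη φ).1]) (fun η hη φ => by linarith [(hfm η hη φ).2]) hk hk'
    (fun η hη φ => by simpa using hS η hη φ)
  have h2 := lower_bound hF hγ hv (B := m' - m) (by fun_prop) h0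
    (fun η hη φ => by linarith [(hfm η hη φ).2]) (fun η hη φ => by linarith [(hfm η hη φ).1]) hk hk'
    (fun η hη φ => by simpa using hS η hη φ)
  have hiavg : IntervalIntegrable (avg f) volume η₀ (η₀ + 1 / 4) := by
    refine intervalIntegrable_of_bounded (B := max |m| |m'|) (measurable_avg hm) (by linarith) fun x hx => ?_
    exact abs_le_max_abs_abs (le_avg (hf.int x (h0.trans hx.1)) fun φ => (hfm x hx.1 φ).1)
      (avg_le (hf.int x (h0.trans hx.1)) fun φ => (hfm x hx.1 φ).2)
  have e1 : ∫ x in η₀..(η₀ + 1 / 4), avg (fun η φ => -m + f η φ) x =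
      (∫ x in η₀..(η₀ + 1 / 4), avg f x) - m / 4 := by
    have : ∫ x in η₀..(η₀ + 1 / 4), avg (fun η φ => -m + f η φ) x =
        ∫ x in η₀..(η₀ + 1 / 4), (avg f x - m) := by
      refine intervalIntegral.integral_congr fun x hx => ?_
      rw [uIcc_of_le (by linarith)] at hx
      rw [avg_add intervalIntegrable_const (hf.int x (h0.trans hx.1)), avg_const]
      ring
    rw [this, intervalIntegral.integral_sub hiavg intervalIntegrable_const]
    simp only [intervalIntegral.integral_const, smul_eq_mul]
    ring
  have e2 : ∫ x in η₀..(η₀ + 1 / 4), avg (fun η φ => m' + -1 * f η φ) x =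
      m' / 4 - ∫ x in η₀..(η₀ + 1 / 4), avg f x := by
    have : ∫ x in η₀..(η₀ + 1 / 4), avg (fun η φ => m' + -1 * f η φ) x =
        ∫ x in η₀..(η₀ + 1 / 4), (m' - avg f x) := by
      refine intervalIntegral.integral_congr fun x hx => ?_
      rw [uIcc_of_le (by linarith)] at hx
      rw [avg_add intervalIntegrable_const ((hf.int x (h0.trans hx.1)).const_mul (-1)), avg_const,
        avg_const_mul]
      ring
    rw [this, intervalIntegral.integral_sub intervalIntegrable_const hiavg]
    simp only [intervalIntegral.integral_const, smul_eq_mul]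
    ring
  rw [e1] at h1
  rw [e2] at h2
  refine ⟨m + (minor * ((∫ x in η₀..(η₀ + 1 / 4), avg f x) - m / 4) - s₀ * (2 + 2 * angBound k)),
    m' - (minor * (m' / 4 - ∫ x in η₀..(η₀ + 1 / 4), avg f x) - s₀ * (2 + 2 * angBound k)),
    fun η hη φ => ⟨?_, ?_⟩, ?_⟩
  · linarith [h1 η hη φ]
  · linarith [h2 η hη φ]
  · linarith

/-- Exponential decay to a constant, uniformly in the force. -/
theorem exists_decay {k : ℝ} (hk : 0 < k) (hk' : k ≤ 1 / 2) :
    ∃ D > 0, ∃ κ > 0, ∀ (F : ℝ → ℝ) (γ : ℝ → ℝ × ℝ → ℝ × ℝ), Admissible F → IsFlow F γ →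
      ∀ (S f : ℝ → ℝ → ℝ) (M B : ℝ), IsSol F S f → (Measurable fun p : ℝ × ℝ => f p.1 p.2) →
      (∀ η, 0 ≤ η → ∀ φ, |S η φ| ≤ M * exp (-(k * η))) → (∀ η, 0 ≤ η → ∀ φ, |f η φ| ≤ B) →
      ∃ fInf, ∀ η, 0 ≤ η → ∀ φ, |f η φ - fInf| ≤ D * (M + B) * exp (-(κ * η)) := by
  set θ := 1 - minor / 4 with hθ
  have hmp := minor_pos
  have hm1 := minor_lt_one
  set C₁ := 4 + 4 * angBound k with hC₁
  have hC₁0 : 0 < C₁ := by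
    have : 0 < angBound k := by unfold angBound; positivity
    positivity
  -- The decay per unit step may not be faster than the source, nor than a rate strictly between the
  -- contraction factor `θ` and `1`, so that the induction has room for the source.
  set κ := min k (-log ((1 + θ) / 2)) with hκ
  have hlog : log ((1 + θ) / 2) < 0 := Real.log_neg (by linarith) (by linarith)
  have hκ0 : 0 < κ := lt_min hk (by linarith)
  have heκ : (1 + θ) / 2 ≤ exp (-κ) := by
    rw [← Real.log_le_iff_le_exp (by linarith)]
    linarith [min_le_right k (-log ((1 + θ) / 2))]
  -- The `2` starts the induction from the oscillation `2 * B`; the second term gives `θ * D + C₁ ≤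
  -- (1 + θ) / 2 * D`.
  set D := 2 + 2 * C₁ / (1 - θ) with hD
  have h1θ : 0 < 1 - θ := by linarith
  have hD0 : 0 < D := by positivity
  refine ⟨D * exp κ, by positivity, κ, hκ0, fun F γ hF hγ S f M B hf hm hS hB => ?_⟩
  have hM0 : 0 ≤ M := by simpa using (abs_nonneg _).trans (hS 0 le_rfl 0)
  have hB0 : 0 ≤ B := (abs_nonneg _).trans (hB 0 le_rfl 0)
  have main : ∀ n : ℕ, ∃ m m', (∀ η, (n : ℝ) ≤ η → ∀ φ, m ≤ f η φ ∧ f η φ ≤ m') ∧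
      m' - m ≤ D * (M + B) * exp (-(κ * n)) := by
    intro n
    induction n with
    | zero =>
      refine ⟨-B, B, fun η hη φ => abs_le.1 (hB η (by simpa using hη) φ), ?_⟩
      have h2 : 2 ≤ D := by
        have : 0 ≤ 2 * C₁ / (1 - θ) := by positivity
        linarith
      have : 2 * (M + B) ≤ D * (M + B) := by gcongr
      simp only [Nat.cast_zero, mul_zero, neg_zero, exp_zero, mul_one]
      linarith
    | succ n ih =>
      obtain ⟨m, m', hmm, hle⟩ := ih
      have hn : (0 : ℝ) ≤ n := n.cast_nonneg
      obtain ⟨a, a', haa, hle'⟩ := oscillation_step hF hγ hf hm (s₀ := M * exp (-(k * n))) hn hmm hk hk'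
        (fun η hη φ => by
          refine (hS η (hn.trans hη) φ).trans (le_of_eq ?_)
          rw [mul_assoc, ← exp_add]; congr 2; ring)
      refine ⟨a, a', fun η hη φ => haa η (by push_cast at hη; exact hη) φ, hle'.trans ?_⟩
      have e1 : exp (-(k * n)) ≤ exp (-(κ * n)) := by
        rw [exp_le_exp]
        have : κ * n ≤ k * n := by gcongr; exact min_le_left _ _
        linarith
      have e2 : exp (-(κ * ((n + 1 : ℕ) : ℝ))) = exp (-κ) * exp (-(κ * n)) := by
        rw [← exp_add]; congr 1; push_cast; ring
      rw [e2]
      set X := exp (-(κ * n)) with hX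
      have hX0 : 0 < X := exp_pos _
      have hDθ : θ * D + C₁ ≤ D * exp (-κ) := by
        have h3 : D * (1 - θ) = 2 * (1 - θ) + 2 * C₁ := by rw [hD]; field_simp
        have h4 : D * ((1 + θ) / 2) ≤ D * exp (-κ) := by gcongr
        linarith
      calc θ * (m' - m) + M * exp (-(k * n)) * C₁
          ≤ θ * (D * (M + B) * X) + (M + B) * X * C₁ := by
            have hθ0 : 0 ≤ θ := by linarith
            gcongr
            linarith
        _ = (θ * D + C₁) * ((M + B) * X) := by ring
        _ ≤ (D * exp (-κ)) * ((M + B) * X) := by gcongr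
        _ = _ := by ring
  choose m m' hmm hle using main
  have hcauchy : CauchySeq fun n : ℕ => f n 0 := by
    refine cauchySeq_of_le_tendsto_0 (fun n : ℕ => D * (M + B) * exp (-(κ * n))) (fun i j N hi hj => ?_) ?_
    · have h1 := hmm N i (by exact_mod_cast hi) 0
      have h2 := hmm N j (by exact_mod_cast hj) 0
      have h3 := hle N
      rw [Real.dist_eq, abs_le]
      constructor <;> linarith
    · have : Tendsto (fun n : ℕ => exp (-(κ * n))) atTop (𝓝 0) :=
        Real.tendsto_exp_neg_atTop_nhds_zero.comp
          (tendsto_natCast_atTop_atTop.const_mul_atTop hκ0)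
      simpa using this.const_mul (D * (M + B))
  obtain ⟨fInf, hlim⟩ := cauchySeq_tendsto_of_complete hcauchy
  refine ⟨fInf, fun η hη φ => ?_⟩
  -- Passing from integer levels to `η` costs the factor `exp κ` in the constant.
  set N := ⌊η⌋₊ with hN
  have h1 := hmm N η (Nat.floor_le hη) φ
  have h2 : m N ≤ fInf := ge_of_tendsto hlim (by
    filter_upwards [eventually_ge_atTop N] with n hn using (hmm N n (by exact_mod_cast hn) 0).1)
  have h3 : fInf ≤ m' N := le_of_tendsto hlim (by
    filter_upwards [eventually_ge_atTop N] with n hn using (hmm N n (by exact_mod_cast hn) 0).2)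
  have h4 : |f η φ - fInf| ≤ D * (M + B) * exp (-(κ * N)) := by
    have := hle N
    rw [abs_le]
    constructor <;> linarith
  refine h4.trans ?_
  have h5 : exp (-(κ * N)) ≤ exp κ * exp (-(κ * η)) := by
    rw [← exp_add, exp_le_exp]
    have := Nat.lt_floor_add_one η
    have : κ * η ≤ κ * (N + 1) := by gcongr
    linarith
  calc D * (M + B) * exp (-(κ * N)) ≤ D * (M + B) * (exp κ * exp (-(κ * η))) := by gcongr
    _ = _ := by ring

/-! ### Existence: resolvent of the extended problem and monotone iteration. -/

/-- The boundary data as a function of the energy. -/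
def bdry (h : ℝ → ℝ) (E : ℝ) : ℝ := if |E| < 1 then h (arccos E) else h (π / 2)

lemma inflow_eq : inflow = Ioo 0 π := by
  ext φ
  simp only [inflow, mem_ofPred_eq, mem_Ico, mem_Ioo]
  constructor
  · rintro ⟨⟨h1, h2⟩, h3⟩
    refine ⟨?_, h2⟩
    by_contra hneg
    exact absurd h3 (not_lt.2 (Real.sin_nonpos_of_nonpos_of_neg_pi_le (not_lt.1 hneg) h1))
  · rintro ⟨h1, h2⟩
    exact ⟨⟨by linarith [pi_pos], h2⟩, Real.sin_pos_of_pos_of_lt_pi h1 h2⟩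

lemma outflow_eq : outflow = Ioo (-π) 0 := by
  ext φ
  simp only [outflow, mem_ofPred_eq, mem_Ico, mem_Ioo]
  constructor
  · rintro ⟨⟨h1, h2⟩, h3⟩
    refine ⟨lt_of_le_of_ne h1 fun h => ?_, ?_⟩
    · rw [← h] at h3; simp at h3
    · by_contra hneg
      exact absurd h3 (not_lt.2 (Real.sin_nonneg_of_nonneg_of_le_pi (not_lt.1 hneg) h2.le))
  · rintro ⟨h1, h2⟩
    exact ⟨⟨h1.le, by linarith [pi_pos]⟩, Real.sin_neg_of_neg_of_neg_pi_lt h2 h1⟩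

/-- The default `h (π / 2)` is itself an in-flow value, so every bound on `h` passes to `bdry h`,
including at energies with `|E| ≥ 1`. -/
lemma bdry_mem (h : ℝ → ℝ) (E : ℝ) : bdry h E ∈ h '' inflow := by
  rw [inflow_eq]
  unfold bdry
  split_ifs with hE
  · have := abs_lt.1 hE
    exact ⟨_, ⟨Real.arccos_pos.2 this.2, Real.arccos_lt_pi.2 this.1⟩, rfl⟩
  · exact ⟨π / 2, ⟨by linarith [pi_pos], by linarith [pi_pos]⟩, rfl⟩

lemma abs_bdry_le {h : ℝ → ℝ} {M : ℝ} (hM : ∀ φ ∈ inflow, |h φ| ≤ M) (E : ℝ) : |bdry h E| ≤ M := by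
  obtain ⟨φ, hφ, he⟩ := bdry_mem h E
  rw [← he]
  exact hM φ hφ

lemma measurable_bdry {h : ℝ → ℝ} (hh : Measurable h) : Measurable (bdry h) :=
  Measurable.ite (measurableSet_lt measurable_abs measurable_const)
    (hh.comp Real.measurable_arccos) measurable_const

lemma bdry_cos (h : ℝ → ℝ) {φ : ℝ} (hφ : φ ∈ inflow) : bdry h (cos φ) = h φ := by
  rw [inflow_eq] at hφ
  have h1 : |cos φ| < 1 := by
    rw [abs_lt, ← Real.cos_pi, ← Real.cos_zero]
    exact ⟨Real.cos_lt_cos_of_nonneg_of_le_pi hφ.1.le le_rfl hφ.2,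
      Real.cos_lt_cos_of_nonneg_of_le_pi le_rfl hφ.2.le hφ.1⟩
  rw [bdry, if_pos h1, Real.arccos_cos hφ.1.le hφ.2.le]

/-- The resolvent of the flow. -/
def resolv (γ : ℝ → ℝ × ℝ → ℝ × ℝ) (q : ℝ × ℝ → ℝ) (p : ℝ × ℝ) : ℝ :=
  ∫ r in Iic (0 : ℝ), exp r * q (γ r p)

section Resolvent

variable {F : ℝ → ℝ} {γ : ℝ → ℝ × ℝ → ℝ × ℝ} {q q' : ℝ × ℝ → ℝ} {B : ℝ}

lemma measurable_path (hγ : IsFlow F γ) (hq : Measurable q) (p : ℝ × ℝ) :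
    Measurable fun r => exp r * q (γ r p) :=
  Real.measurable_exp.mul (hq.comp (hγ.cont_left p).measurable)

lemma integrableOn_path (hγ : IsFlow F γ) (hq : Measurable q) (hB : ∀ p, |q p| ≤ B) (p : ℝ × ℝ)
    (b : ℝ) : IntegrableOn (fun r => exp r * q (γ r p)) (Iic b) := by
  refine Integrable.mono' ((integrableOn_exp_Iic b).mul_const B)
    (measurable_path hγ hq p).aestronglyMeasurable (Eventually.of_forall fun r => ?_)
  rw [Real.norm_eq_abs, abs_mul, abs_of_pos (exp_pos r)]
  exact mul_le_mul_of_nonneg_left (hB _) (exp_pos r).le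

lemma resolv_const (c : ℝ) (p : ℝ × ℝ) : resolv γ (fun _ => c) p = c := by
  simp [resolv, integral_mul_const, integral_exp_Iic_zero]

lemma resolv_mono (hγ : IsFlow F γ) (hq : Measurable q) (hq' : Measurable q')
    (hB : ∀ p, |q p| ≤ B) (hB' : ∀ p, |q' p| ≤ B) (h : ∀ p, q p ≤ q' p) (p : ℝ × ℝ) :
    resolv γ q p ≤ resolv γ q' p :=
  setIntegral_mono (integrableOn_path hγ hq hB p 0) (integrableOn_path hγ hq' hB' p 0)
    fun r => mul_le_mul_of_nonneg_left (h _) (exp_pos r).le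

lemma abs_resolv_le (hγ : IsFlow F γ) (hq : Measurable q) (hB : ∀ p, |q p| ≤ B) (p : ℝ × ℝ) :
    |resolv γ q p| ≤ B := by
  have hB0 : 0 ≤ B := (abs_nonneg _).trans (hB 0)
  have hc : ∀ c : ℝ, |c| ≤ B → ∀ _p : ℝ × ℝ, |c| ≤ B := fun c hc _ => hc
  rw [abs_le]
  constructor
  · have := resolv_mono hγ (measurable_const (a := -B)) hq (hc (-B) (by rw [abs_neg, abs_of_nonneg hB0])) hB
      (fun p => (abs_le.1 (hB p)).1) p
    rwa [resolv_const] at this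
  · have := resolv_mono hγ hq (measurable_const (a := B)) hB (hc B (by rw [abs_of_nonneg hB0]))
      (fun p => (abs_le.1 (hB p)).2) p
    rwa [resolv_const] at this

lemma measurable_resolv (hγ : IsFlow F γ) (hq : Measurable q) : Measurable (resolv γ q) := by
  have h : Measurable fun x : (ℝ × ℝ) × ℝ => exp x.2 * q (γ x.2 x.1) :=
    (Real.measurable_exp.comp measurable_snd).mul
      (hq.comp (hγ.cont.measurable.comp (measurable_snd.prodMk measurable_fst)))
  exact (h.stronglyMeasurable.integral_prod_right' (ν := volume.restrict (Iic 0))).measurable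

/-- The group property of the flow turns the resolvent along an orbit into one primitive with a
moving endpoint, which shows its absolute continuity. -/
lemma exp_mul_resolv (hγ : IsFlow F γ) (q : ℝ × ℝ → ℝ) (p : ℝ × ℝ) (t : ℝ) :
    exp t * resolv γ q (γ t p) = ∫ r in Iic t, exp r * q (γ r p) := by
  unfold resolv
  rw [← integral_const_mul, ← integral_indicator measurableSet_Iic,
    ← integral_indicator measurableSet_Iic,
    ← integral_add_right_eq_self (fun r => (Iic t).indicator (fun r => exp r * q (γ r p)) r) t]
  congr 1
  ext r
  simp only [indicator, mem_Iic, add_le_iff_nonpos_left]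
  split_ifs
  · rw [hγ.add, ← mul_assoc, ← exp_add, add_comm t r]
  · rfl

lemma isPrim_resolv (hγ : IsFlow F γ) (hq : Measurable q) (hB : ∀ p, |q p| ≤ B) (p : ℝ × ℝ)
    {T : ℝ} (hT : 0 ≤ T) :
    IsPrim 0 T (fun s => resolv γ q (γ s p)) (fun s => q (γ s p) - resolv γ q (γ s p)) := by
  refine IsPrim.of_exp_mul hT ⟨?_, fun t ht => ?_⟩
  · rw [intervalIntegrable_iff_integrableOn_Ioc_of_le hT]
    exact (integrableOn_path hγ hq hB p T).mono_set Ioc_subset_Iic_self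
  · beta_reduce
    rw [exp_mul_resolv hγ, exp_mul_resolv hγ, ← intervalIntegral.integral_Iic_sub_Iic
      (integrableOn_path hγ hq hB p 0) (integrableOn_path hγ hq hB p t)]
    ring

/-- The resolvent inverts `1 + d/dt`. -/
lemma resolv_eq_of_hasDerivAt (hγ : IsFlow F γ) {U : ℝ × ℝ → ℝ} (hq : Measurable q)
    (hB : ∀ p, |q p| ≤ B) (hU : ∀ p, |U p| ≤ B)
    (hd : ∀ p t, HasDerivAt (fun t => U (γ t p)) (q (γ t p) - U (γ t p)) t) (p : ℝ × ℝ) :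
    resolv γ q p = U p := by
  have h1 : ∀ t ∈ Iic (0 : ℝ), HasDerivAt (fun t => exp t * U (γ t p)) (exp t * q (γ t p)) t :=
    fun t _ => ((Real.hasDerivAt_exp t).mul (hd p t)).congr_deriv (by ring)
  have h2 : Tendsto (fun t => exp t * U (γ t p)) atBot (𝓝 0) := by
    refine squeeze_zero_norm (a := fun t => exp t * B) (fun t => ?_) ?_
    · rw [Real.norm_eq_abs, abs_mul, abs_of_pos (exp_pos t)]
      exact mul_le_mul_of_nonneg_left (hU _) (exp_pos t).le
    · simpa using Real.tendsto_exp_atBot.mul_const B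
  have := integral_Iic_of_hasDerivAt_of_tendsto' h1 (integrableOn_path hγ hq hB p 0) h2
  simpa [hγ.zero, resolv] using this

end Resolvent

/-- The gain term of the extended problem: scattering and source for `η ≥ 0`, boundary data
transported along the characteristics for `η < 0`. -/
def gain (F h : ℝ → ℝ) (S : ℝ → ℝ → ℝ) (a : ℝ → ℝ) (p : ℝ × ℝ) : ℝ :=
  if 0 ≤ p.1 then a p.1 + S p.1 p.2 else bdry h (energy F p)

/-- The solution operator of the problem with prescribed angular average. -/
def solveAvg (γ : ℝ → ℝ × ℝ → ℝ × ℝ) (F h : ℝ → ℝ) (S : ℝ → ℝ → ℝ) (a : ℝ → ℝ) (η φ : ℝ) : ℝ :=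
  resolv γ (gain F h S a) (η, φ)

section Iteration

variable {F h : ℝ → ℝ} {γ : ℝ → ℝ × ℝ → ℝ × ℝ} {S : ℝ → ℝ → ℝ} {a a' : ℝ → ℝ} {M B : ℝ}

lemma measurable_gain (hF : Admissible F) (hh : Measurable h)
    (hS : Measurable fun p : ℝ × ℝ => S p.1 p.2) (ha : Measurable a) :
    Measurable (gain F h S a) :=
  Measurable.ite (measurableSet_le measurable_const measurable_fst)
    ((ha.comp measurable_fst).add hS) ((measurable_bdry hh).comp hF.continuous_energy.measurable)

lemma abs_gain_le (hh : ∀ φ ∈ inflow, |h φ| ≤ M) (hS : ∀ η, 0 ≤ η → ∀ φ, |S η φ| ≤ M)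
    (ha : ∀ η, 0 ≤ η → |a η| ≤ B) (p : ℝ × ℝ) : |gain F h S a p| ≤ B + M := by
  have hB : 0 ≤ B := (abs_nonneg _).trans (ha 0 le_rfl)
  unfold gain
  split_ifs with hp
  · exact (abs_add_le _ _).trans (add_le_add (ha _ hp) (hS _ hp _))
  · linarith [abs_bdry_le hh (energy F p)]

lemma gain_mono (haa : ∀ η, 0 ≤ η → a η ≤ a' η) (p : ℝ × ℝ) :
    gain F h S a p ≤ gain F h S a' p := by
  unfold gain
  split_ifs with hp
  · linarith [haa _ hp]
  · exact le_rfl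

lemma solveAvg_periodic (hγ : IsFlow F γ) (hS : ∀ η φ, S η (φ + 2 * π) = S η φ) (η φ : ℝ) :
    solveAvg γ F h S a η (φ + 2 * π) = solveAvg γ F h S a η φ := by
  unfold solveAvg resolv
  refine integral_congr_ae (Eventually.of_forall fun r => ?_)
  have : γ r (η, φ + 2 * π) = ((γ r (η, φ)).1, (γ r (η, φ)).2 + 2 * π) := hγ.shift r (η, φ)
  simp [this, gain, hS, energy, Real.cos_add_two_pi]

/-- The whole past of an incoming boundary point lies in `η < 0`, where the gain depends on the
conserved energy alone; the weight `exp r` has mass one on the past. -/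
lemma solveAvg_boundary (hF : Admissible F) (hγ : IsFlow F γ) {φ : ℝ} (hφ : 0 < sin φ) :
    solveAvg γ F h S a 0 φ = bdry h (cos φ) := by
  have : ∀ r ∈ Iio (0 : ℝ), exp r * gain F h S a (γ r (0, φ)) = exp r * bdry h (cos φ) := by
    intro r hr
    have hr' : r < 0 := hr
    have hX : (γ r (0, φ)).1 < 0 := by
      have := (hγ.fst_sub_le hF (0, φ) (s := r) (t := 0) hr'.le).2
      rw [hγ.zero] at this
      simp only at this
      nlinarith
    rw [gain, if_neg (not_le.2 hX), hγ.energy_eq hF]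
    simp [energy]
  unfold solveAvg resolv
  rw [integral_Iic_eq_integral_Iio, setIntegral_congr_fun measurableSet_Iio this,
    integral_mul_const, ← integral_Iic_eq_integral_Iio]
  simp [integral_exp_Iic_zero]

end Iteration

section Iteration

variable {F h : ℝ → ℝ} {γ : ℝ → ℝ × ℝ → ℝ × ℝ} {S : ℝ → ℝ → ℝ} {a a' : ℝ → ℝ} {M B : ℝ}

lemma measurable_solveAvg (hF : Admissible F) (hγ : IsFlow F γ) (hh : Measurable h)
    (hS : Measurable fun p : ℝ × ℝ => S p.1 p.2) (ha : Measurable a) :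
    Measurable fun p : ℝ × ℝ => solveAvg γ F h S a p.1 p.2 :=
  measurable_resolv hγ (measurable_gain hF hh hS ha)

lemma abs_solveAvg_le (hF : Admissible F) (hγ : IsFlow F γ) (hh : Measurable h)
    (hS : Measurable fun p : ℝ × ℝ => S p.1 p.2) (ha : Measurable a)
    (hhM : ∀ φ ∈ inflow, |h φ| ≤ M) (hSM : ∀ η, 0 ≤ η → ∀ φ, |S η φ| ≤ M)
    (haB : ∀ η, 0 ≤ η → |a η| ≤ B) (η φ : ℝ) : |solveAvg γ F h S a η φ| ≤ B + M :=
  abs_resolv_le hγ (measurable_gain hF hh hS ha) (abs_gain_le hhM hSM haB) _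

lemma intervalIntegrable_solveAvg (hF : Admissible F) (hγ : IsFlow F γ) (hh : Measurable h)
    (hS : Measurable fun p : ℝ × ℝ => S p.1 p.2) (ha : Measurable a)
    (hhM : ∀ φ ∈ inflow, |h φ| ≤ M) (hSM : ∀ η, 0 ≤ η → ∀ φ, |S η φ| ≤ M)
    (haB : ∀ η, 0 ≤ η → |a η| ≤ B) (η : ℝ) :
    IntervalIntegrable (solveAvg γ F h S a η) volume (-π) π :=
  intervalIntegrable_of_bounded (measurable_section (measurable_solveAvg hF hγ hh hS ha) η)
    (by linarith [pi_pos]) fun φ _ => abs_solveAvg_le hF hγ hh hS ha hhM hSM haB η φ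

lemma solveAvg_mono (hF : Admissible F) (hγ : IsFlow F γ) (hh : Measurable h)
    (hS : Measurable fun p : ℝ × ℝ => S p.1 p.2) (ha : Measurable a) (ha' : Measurable a')
    (hhM : ∀ φ ∈ inflow, |h φ| ≤ M) (hSM : ∀ η, 0 ≤ η → ∀ φ, |S η φ| ≤ M)
    (haB : ∀ η, 0 ≤ η → |a η| ≤ B) (haB' : ∀ η, 0 ≤ η → |a' η| ≤ B)
    (haa : ∀ η, 0 ≤ η → a η ≤ a' η) (η φ : ℝ) :
    solveAvg γ F h S a η φ ≤ solveAvg γ F h S a' η φ :=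
  resolv_mono hγ (measurable_gain hF hh hS ha) (measurable_gain hF hh hS ha')
    (abs_gain_le hhM hSM haB) (abs_gain_le hhM hSM haB') (gain_mono haa) _

/-- Where `η ≥ 0` the gain is `a + S`, and the fixed point identity turns the prescribed `a` into
the average of the solution itself. -/
lemma isSol_solveAvg (hF : Admissible F) (hγ : IsFlow F γ) (hh : Measurable h)
    (hS : Measurable fun p : ℝ × ℝ => S p.1 p.2) (ha : Measurable a)
    (hhM : ∀ φ ∈ inflow, |h φ| ≤ M) (hSM : ∀ η, 0 ≤ η → ∀ φ, |S η φ| ≤ M)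
    (haB : ∀ η, 0 ≤ η → |a η| ≤ B)
    (hfix : ∀ η, 0 ≤ η → avg (solveAvg γ F h S a) η = a η) :
    IsSol F S (solveAvg γ F h S a) := by
  refine ⟨HasTransport.of_flow hγ fun p T hT hp => ?_, fun η _ =>
    intervalIntegrable_solveAvg hF hγ hh hS ha hhM hSM haB η⟩
  refine (isPrim_resolv hγ (measurable_gain hF hh hS ha) (abs_gain_le hhM hSM haB) p hT).congr_right
    hT fun t ht => ?_
  rw [hfix _ (hp t ht), gain, if_pos (hp t ht)]
  simp only [solveAvg]
  ring

/-- Monotone iteration between a sub- and a supersolution. -/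
lemma exists_fixed_avg (hF : Admissible F) (hγ : IsFlow F γ) (hh : Measurable h)
    (hS : Measurable fun p : ℝ × ℝ => S p.1 p.2)
    (hhM : ∀ φ ∈ inflow, |h φ| ≤ M) (hSM : ∀ η, 0 ≤ η → ∀ φ, |S η φ| ≤ M)
    {L U : ℝ → ℝ → ℝ} (hLm : Measurable fun p : ℝ × ℝ => L p.1 p.2)
    (hUm : Measurable fun p : ℝ × ℝ => U p.1 p.2)
    (hLB : ∀ η, 0 ≤ η → ∀ φ, |L η φ| ≤ B) (hUB : ∀ η, 0 ≤ η → ∀ φ, |U η φ| ≤ B)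
    (hLU : ∀ η, 0 ≤ η → ∀ φ, L η φ ≤ U η φ)
    (hL : ∀ η, 0 ≤ η → ∀ φ, L η φ ≤ solveAvg γ F h S (avg L) η φ)
    (hU : ∀ η, 0 ≤ η → ∀ φ, solveAvg γ F h S (avg U) η φ ≤ U η φ) :
    ∃ a, Measurable a ∧ (∀ η, 0 ≤ η → |a η| ≤ B) ∧
      (∀ η, 0 ≤ η → avg (solveAvg γ F h S a) η = a η) ∧
      ∀ η, 0 ≤ η → ∀ φ, L η φ ≤ solveAvg γ F h S a η φ ∧ solveAvg γ F h S a η φ ≤ U η φ := by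
  have hLi : ∀ η, 0 ≤ η → IntervalIntegrable (L η) volume (-π) π := fun η hη =>
    intervalIntegrable_of_bounded (measurable_section hLm η) (by linarith [pi_pos])
      fun φ _ => hLB η hη φ
  have hUi : ∀ η, 0 ≤ η → IntervalIntegrable (U η) volume (-π) π := fun η hη =>
    intervalIntegrable_of_bounded (measurable_section hUm η) (by linarith [pi_pos])
      fun φ _ => hUB η hη φ
  have haLB : ∀ η, 0 ≤ η → |avg L η| ≤ B := fun η hη => abs_le.2
    ⟨le_avg (hLi η hη) fun φ => (abs_le.1 (hLB η hη φ)).1,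
      avg_le (hLi η hη) fun φ => (abs_le.1 (hLB η hη φ)).2⟩
  have haUB : ∀ η, 0 ≤ η → |avg U η| ≤ B := fun η hη => abs_le.2
    ⟨le_avg (hUi η hη) fun φ => (abs_le.1 (hUB η hη φ)).1,
      avg_le (hUi η hη) fun φ => (abs_le.1 (hUB η hη φ)).2⟩
  have haLm := measurable_avg hLm
  have haUm := measurable_avg hUm
  set A : ℕ → ℝ → ℝ := fun n => Nat.rec (avg L) (fun _ a => avg (solveAvg γ F h S a)) n with hA
  have hA0 : A 0 = avg L := rfl
  have hAs : ∀ n, A (n + 1) = avg (solveAvg γ F h S (A n)) := fun n => rfl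
  have hAm : ∀ n, Measurable (A n) := by
    intro n
    induction n with
    | zero => exact haLm
    | succ n ih => rw [hAs]; exact measurable_avg (measurable_solveAvg hF hγ hh hS ih)
  have hbnd : ∀ n, (∀ η, 0 ≤ η → avg L η ≤ A n η ∧ A n η ≤ avg U η) := by
    intro n
    induction n with
    | zero => exact fun η hη => ⟨le_rfl, avg_mono (hLi η hη) (hUi η hη) (hLU η hη)⟩
    | succ n ih =>
      have hB : ∀ η, 0 ≤ η → |A n η| ≤ B := fun η hη => abs_le.2
        ⟨(abs_le.1 (haLB η hη)).1.trans (ih η hη).1, (ih η hη).2.trans (abs_le.1 (haUB η hη)).2⟩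
      intro η hη
      rw [hAs]
      have hi := intervalIntegrable_solveAvg hF hγ hh hS (hAm n) hhM hSM hB η
      exact ⟨avg_mono (hLi η hη) hi fun φ => (hL η hη φ).trans
          (solveAvg_mono hF hγ hh hS haLm (hAm n) hhM hSM haLB hB (fun x hx => (ih x hx).1) η φ),
        avg_mono hi (hUi η hη) fun φ => (solveAvg_mono hF hγ hh hS (hAm n) haUm hhM hSM hB haUB
          (fun x hx => (ih x hx).2) η φ).trans (hU η hη φ)⟩
  have hAB : ∀ n η, 0 ≤ η → |A n η| ≤ B := fun n η hη => abs_le.2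
    ⟨(abs_le.1 (haLB η hη)).1.trans (hbnd n η hη).1, (hbnd n η hη).2.trans (abs_le.1 (haUB η hη)).2⟩
  have hmono : ∀ n η, 0 ≤ η → A n η ≤ A (n + 1) η := by
    intro n
    induction n with
    | zero => exact fun η hη => (hbnd 1 η hη).1
    | succ n ih =>
      intro η hη
      rw [hAs n, hAs (n + 1)]
      exact avg_mono (intervalIntegrable_solveAvg hF hγ hh hS (hAm n) hhM hSM (hAB n) η)
        (intervalIntegrable_solveAvg hF hγ hh hS (hAm (n + 1)) hhM hSM (hAB (n + 1)) η)
        fun φ => solveAvg_mono hF hγ hh hS (hAm n) (hAm (n + 1)) hhM hSM (hAB n) (hAB (n + 1)) ih η φ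
  -- The iterates are controlled only for `η ≥ 0`; evaluating at `max η 0` gives a bounded monotone
  -- sequence, hence a measurable limit, on the whole line.
  set a : ℝ → ℝ := fun η => ⨆ n, A n (max η 0) with ha
  have hbddA : ∀ η, BddAbove (range fun n => A n (max η 0)) := fun η =>
    ⟨B, by rintro _ ⟨n, rfl⟩; exact (abs_le.1 (hAB n _ (le_max_right _ _))).2⟩
  have hlim' : ∀ η, Tendsto (fun n => A n (max η 0)) atTop (𝓝 (a η)) := fun η =>
    tendsto_atTop_ciSup (monotone_nat_of_le_succ fun n => hmono n _ (le_max_right _ _)) (hbddA η)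
  have hlim : ∀ η, 0 ≤ η → Tendsto (fun n => A n η) atTop (𝓝 (a η)) := fun η hη => by
    simpa [max_eq_left hη] using hlim' η
  have ham : Measurable a := measurable_of_tendsto_metrizable
    (fun n => (hAm n).comp (measurable_id.max measurable_const)) (tendsto_pi_nhds.2 hlim')
  have haB : ∀ η, 0 ≤ η → |a η| ≤ B := fun η hη =>
    le_of_tendsto (hlim η hη).abs (Eventually.of_forall fun n => hAB n η hη)
  have hAa : ∀ n η, 0 ≤ η → A n η ≤ a η := fun n η hη => by
    have := le_ciSup (hbddA η) n
    simp only [ha]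
    simpa only [max_eq_left hη] using this
  have hR : ∀ η φ, Tendsto (fun n => solveAvg γ F h S (A n) η φ) atTop
      (𝓝 (solveAvg γ F h S a η φ)) := by
    intro η φ
    refine tendsto_integral_of_dominated_convergence (fun r => exp r * (B + M))
      (fun n => (measurable_path hγ (measurable_gain hF hh hS (hAm n)) _).aestronglyMeasurable)
      ((integrableOn_exp_Iic 0).mul_const _) (fun n => Eventually.of_forall fun r => ?_)
      (Eventually.of_forall fun r => ?_)
    · rw [Real.norm_eq_abs, abs_mul, abs_of_pos (exp_pos r)]
      exact mul_le_mul_of_nonneg_left (abs_gain_le hhM hSM (hAB n) _) (exp_pos r).le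
    · refine Tendsto.const_mul _ ?_
      unfold gain
      split_ifs with hp
      · exact (hlim _ hp).add_const _
      · exact tendsto_const_nhds
  refine ⟨a, ham, haB, fun η hη => ?_, fun η hη φ => ⟨?_, ?_⟩⟩
  · have h1 : Tendsto (fun n => A (n + 1) η) atTop (𝓝 (avg (solveAvg γ F h S a) η)) := by
      simp only [hAs, avg]
      refine Tendsto.const_mul _ ?_
      refine intervalIntegral.tendsto_integral_filter_of_dominated_convergence (fun _ => B + M)
        (Eventually.of_forall fun n => (measurable_section
          (measurable_solveAvg hF hγ hh hS (hAm n)) η).aestronglyMeasurable)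
        (Eventually.of_forall fun n => Eventually.of_forall fun φ _ => ?_) (by simp)
        (Eventually.of_forall fun φ _ => hR η φ)
      exact abs_solveAvg_le hF hγ hh hS (hAm n) hhM hSM (hAB n) η φ
    exact tendsto_nhds_unique h1 ((tendsto_add_atTop_iff_nat 1).2 (hlim η hη))
  · exact (hL η hη φ).trans (solveAvg_mono hF hγ hh hS haLm ham hhM hSM haLB haB (hAa 0) η φ)
  · refine le_of_tendsto (hR η φ) (Eventually.of_forall fun n => ?_)
    exact (solveAvg_mono hF hγ hh hS (hAm n) haUm hhM hSM (hAB n) haUB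
      (fun x hx => (hbnd n x hx).2) η φ).trans (hU η hη φ)

end Iteration

/-- A bounded `C¹` extension of `exp (-k η)`, `η ≥ 0`, to the whole line. -/
lemma exists_profile {k : ℝ} (hk : 0 < k) : ∃ e : ℝ → ℝ,
    (∀ x, HasDerivAt e (-(k * exp (-(k * |x|)))) x) ∧ (∀ x, 0 ≤ x → e x = exp (-(k * x))) ∧
    ∀ x, 0 ≤ e x ∧ e x ≤ 2 := by
  have hc : Continuous fun x : ℝ => -(k * exp (-(k * |x|))) := by fun_prop
  -- The even continuation of the derivative; for `x ≤ 0` it gives `2 - exp (k * x)`, which stays in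
  -- `[1, 2]`.
  set e : ℝ → ℝ := fun x => 1 + ∫ t in (0 : ℝ)..x, -(k * exp (-(k * |t|))) with he
  have hd : ∀ x, HasDerivAt e (-(k * exp (-(k * |x|)))) x := fun x =>
    (intervalIntegral.integral_hasDerivAt_right (hc.intervalIntegrable _ _)
      (hc.stronglyMeasurableAtFilter _ _) hc.continuousAt).const_add 1
  have hpos : ∀ x, 0 ≤ x → e x = exp (-(k * x)) := by
    intro x hx
    have : ∫ t in (0 : ℝ)..x, -(k * exp (-(k * |t|))) = exp (-(k * x)) - exp (-(k * 0)) := by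
      refine intervalIntegral.integral_eq_sub_of_hasDerivAt (f := fun t => exp (-(k * t)))
        (fun t ht => ?_) (hc.intervalIntegrable _ _)
      rw [uIcc_of_le hx] at ht
      rw [abs_of_nonneg ht.1]
      have := (((hasDerivAt_id t).const_mul k).neg).exp
      exact this.congr_deriv (by simp [mul_comm])
    change 1 + ∫ t in (0 : ℝ)..x, -(k * exp (-(k * |t|))) = _
    rw [this]
    simp
  have hneg : ∀ x, x ≤ 0 → e x = 2 - exp (k * x) := by
    intro x hx
    have : ∫ t in (0 : ℝ)..x, -(k * exp (-(k * |t|))) = -exp (k * x) - -exp (k * 0) := by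
      refine intervalIntegral.integral_eq_sub_of_hasDerivAt (f := fun t => -exp (k * t))
        (fun t ht => ?_) (hc.intervalIntegrable _ _)
      rw [uIcc_of_ge hx] at ht
      rw [abs_of_nonpos ht.2]
      have := ((hasDerivAt_id t).const_mul k).exp.neg
      exact this.congr_deriv (by simp [mul_comm])
    change 1 + ∫ t in (0 : ℝ)..x, -(k * exp (-(k * |t|))) = _
    rw [this]
    simp
    ring
  refine ⟨e, hd, hpos, fun x => ?_⟩
  rcases le_total 0 x with hx | hx
  · rw [hpos x hx]
    have : exp (-(k * x)) ≤ 1 := by rw [exp_le_one_iff]; nlinarith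
    exact ⟨(exp_pos _).le, by linarith⟩
  · rw [hneg x hx]
    have : exp (k * x) ≤ 1 := by rw [exp_le_one_iff]; nlinarith
    have := exp_pos (k * x)
    constructor <;> linarith

/-- The bound of the solution of the in-flow problem, relative to that of the data. -/
def solBound (k : ℝ) : ℝ :=
  2 * (1 / 2 + 2 * angBound k + (k * angBound k + 8 * (2 / k + 2)))

/-- A global supersolution dominating the data. -/
lemma exists_supersolution {k : ℝ} (hk : 0 < k) (hk' : k ≤ 1 / 2) {F : ℝ → ℝ}
    {γ : ℝ → ℝ × ℝ → ℝ × ℝ} (hF : Admissible F) (hγ : IsFlow F γ) :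
    ∃ U : ℝ → ℝ → ℝ, (Measurable fun p : ℝ × ℝ => U p.1 p.2) ∧
      (∀ η φ, 0 ≤ U η φ ∧ U η φ ≤ solBound k) ∧
      ∃ q : ℝ × ℝ → ℝ, Measurable q ∧ (∃ B, ∀ p, |q p| ≤ B) ∧
        (∀ η φ, resolv γ q (η, φ) = U η φ) ∧
        (∀ η, 0 ≤ η → ∀ φ, avg U η + exp (-(k * η)) ≤ q (η, φ)) ∧ ∀ p, 1 ≤ q p := by
  obtain ⟨e, hd, hpos, hbd⟩ := exists_profile hk
  have hab : 0 ≤ angBound k := by unfold angBound; positivity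
  have hang := ang_bounds hk hk'
  have hcd : Continuous fun x : ℝ => -(k * exp (-(k * |x|))) := by fun_prop
  have hce : Continuous e := continuous_iff_continuousAt.2 fun x => (hd x).continuousAt
  have hca := continuous_ang k
  have hcF := hF.continuous
  -- Chosen so that `2 * (C - e * ang - T) ≥ 1` everywhere: the last two summands bound `e * ang`
  -- and its transport derivative `T`.
  set C := 1 / 2 + 2 * angBound k + (k * angBound k + 8 * (2 / k + 2)) with hC
  set T : ℝ × ℝ → ℝ := fun p => -(k * exp (-(k * |p.1|))) * sin p.2 * ang k p.2 +
    e p.1 * ((2 / k * cos p.2 + 2 * sin (2 * p.2)) * (F p.1 * cos p.2)) with hT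
  have hTb : ∀ p, |T p| ≤ k * angBound k + 8 * (2 / k + 2) := by
    intro p
    refine (abs_add_le _ _).trans (add_le_add ?_ ?_)
    · rw [abs_mul, abs_mul, abs_neg, abs_of_nonneg (hang p.2).1,
        abs_of_nonneg (by positivity : 0 ≤ k * exp (-(k * |p.1|)))]
      have h1 : exp (-(k * |p.1|)) ≤ 1 := by
        rw [exp_le_one_iff]; have := abs_nonneg p.1; nlinarith
      calc k * exp (-(k * |p.1|)) * |sin p.2| * ang k p.2
          ≤ k * 1 * 1 * angBound k := by
            gcongr
            · exact (hang p.2).1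
            · exact Real.abs_sin_le_one _
            · exact (hang p.2).2
        _ = _ := by ring
    · rw [abs_mul, abs_mul, abs_mul, abs_of_nonneg (hbd p.1).1]
      have h1 : |2 / k * cos p.2 + 2 * sin (2 * p.2)| ≤ 2 / k + 2 := by
        refine (abs_add_le _ _).trans (add_le_add ?_ ?_)
        · rw [abs_mul, abs_of_pos (by positivity : 0 < 2 / k)]
          exact mul_le_of_le_one_right (by positivity) (Real.abs_cos_le_one _)
        · rw [abs_mul, abs_two]
          linarith [Real.abs_sin_le_one (2 * p.2)]
      calc e p.1 * (|2 / k * cos p.2 + 2 * sin (2 * p.2)| * (|F p.1| * |cos p.2|))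
          ≤ 2 * ((2 / k + 2) * (4 * 1)) := by
            gcongr
            · exact (hbd p.1).2
            · exact hF.abs_apply_le _
            · exact Real.abs_cos_le_one _
        _ = _ := by ring
  have hea : ∀ η φ, 0 ≤ e η * ang k φ ∧ e η * ang k φ ≤ 2 * angBound k := fun η φ =>
    ⟨mul_nonneg (hbd η).1 (hang φ).1, mul_le_mul (hbd η).2 (hang φ).2 (hang φ).1 (by norm_num)⟩
  have hTc : Continuous T := by
    simp only [hT]
    fun_prop
  set U : ℝ → ℝ → ℝ := fun η φ => 2 * (C - e η * ang k φ) with hU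
  have hUc : Continuous fun p : ℝ × ℝ => U p.1 p.2 := by
    simp only [hU]
    fun_prop
  have hT8 : 0 ≤ k * angBound k + 8 * (2 / k + 2) := by positivity
  have hUb : ∀ η φ, 0 ≤ U η φ ∧ U η φ ≤ solBound k := fun η φ => by
    have := hea η φ
    simp only [hU, solBound]
    constructor <;> linarith
  -- This is `U` plus its derivative along the flow, so the resolvent of `q` is `U`. The factor `2`
  -- in `U` raises the barrier's gain from `1/2` to `1`.
  set q : ℝ × ℝ → ℝ := fun p => U p.1 p.2 - 2 * T p with hq
  have hqc : Continuous q := hUc.sub (hTc.const_mul 2)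
  have hqb : ∀ p, |q p| ≤ solBound k + 2 * (k * angBound k + 8 * (2 / k + 2)) := fun p => by
    refine (abs_sub _ _).trans (add_le_add ?_ ?_)
    · rw [abs_of_nonneg (hUb _ _).1]; exact (hUb _ _).2
    · rw [abs_mul, abs_two]; linarith [hTb p]
  refine ⟨U, hUc.measurable, hUb, q, hqc.measurable, ⟨_, hqb⟩, fun η φ => ?_, fun η hη φ => ?_,
    fun p => ?_⟩
  · refine resolv_eq_of_hasDerivAt hγ (U := fun p => U p.1 p.2) hqc.measurable hqb (fun p => ?_)
      (fun p t => ?_) (η, φ)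
    · rw [abs_of_nonneg (hUb _ _).1]; linarith [(hUb p.1 p.2).2]
    · have h1 := (hd (γ t p).1).comp t (hγ.deriv_fst p t)
      have h2 := (hasDerivAt_ang k (γ t p).2).comp t (hγ.deriv_snd p t)
      have h3 := ((h1.mul h2).const_sub C).const_mul 2
      refine h3.congr_deriv ?_
      simp only [hq, hT, Function.comp]
      ring
  · have h1 : avg U η = 2 * (C - e η * (2 / k ^ 2)) := by
      have hi : IntervalIntegrable (fun φ => -1 * (e η * ang k φ)) volume (-π) π :=
        Continuous.intervalIntegrable (by fun_prop) _ _
      have e1 : U = fun η φ => 2 * ((fun η φ => C + -1 * (e η * ang k φ)) η φ) := by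
        ext η φ; simp only [hU]; ring
      rw [e1, avg_const_mul, avg_add (f := fun _ _ => C) intervalIntegrable_const hi, avg_const,
        avg_const_mul, avg_mul_ang]
      ring
    have h2 := barrierSource_le hF hk hk' η φ
    have h3 : q (η, φ) - avg U η = -2 * barrierSource F k η φ := by
      rw [h1]
      simp only [hq, hT, hU, barrierSource, ang, hpos η hη, abs_of_nonneg hη]
      rw [sin_two_mul, cos_two_mul]
      have hs : sin φ ^ 2 = 1 - cos φ ^ 2 := by rw [← sin_sq_add_cos_sq φ]; ring
      field_simp
      linear_combination (2 * k ^ 2 * rexp (-(k * η))) * hs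
    linarith
  · have h1 := (abs_le.1 (hTb p)).2
    have h2 := (hea p.1 p.2).2
    simp only [hq, hU]
    linarith

lemma resolv_const_mul {γ : ℝ → ℝ × ℝ → ℝ × ℝ} (c : ℝ) (q : ℝ × ℝ → ℝ) (p : ℝ × ℝ) :
    resolv γ (fun p => c * q p) p = c * resolv γ q p := by
  unfold resolv
  rw [← integral_const_mul]
  congr 1
  ext r
  ring

lemma one_le_solBound {k : ℝ} (hk : 0 < k) : 1 ≤ solBound k := by
  have : 0 ≤ angBound k := by unfold angBound; positivity
  have : 0 ≤ 2 * angBound k + (k * angBound k + 8 * (2 / k + 2)) := by positivity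
  unfold solBound
  linarith

/-- The bounded solution of the in-flow problem. -/
theorem exists_bounded_solution {k : ℝ} (hk : 0 < k) (hk' : k ≤ 1 / 2) {F : ℝ → ℝ}
    {γ : ℝ → ℝ × ℝ → ℝ × ℝ} (hF : Admissible F) (hγ : IsFlow F γ) {h : ℝ → ℝ} {S : ℝ → ℝ → ℝ}
    {M : ℝ} (hh : Measurable h) (hS : Measurable fun p : ℝ × ℝ => S p.1 p.2)
    (hSp : ∀ η φ, S η (φ + 2 * π) = S η φ) (hhM : ∀ φ ∈ inflow, |h φ| ≤ M)
    (hSM : ∀ η, 0 ≤ η → ∀ φ, |S η φ| ≤ M * exp (-(k * η))) :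
    ∃ f : ℝ → ℝ → ℝ, (Measurable fun p : ℝ × ℝ => f p.1 p.2) ∧
      (∀ η φ, f η (φ + 2 * π) = f η φ) ∧ IsSol F S f ∧
      (∀ η, 0 ≤ η → ∀ φ, |f η φ| ≤ solBound k * M) ∧
      (∀ φ, 0 < sin φ → f 0 φ = bdry h (cos φ)) ∧
      ((∀ η, 0 ≤ η → ∀ φ, S η φ = 0) → ∀ η, 0 ≤ η → ∀ φ,
        sInf (h '' inflow) ≤ f η φ ∧ f η φ ≤ sSup (h '' inflow)) := by
  have hM0 : 0 ≤ M := by simpa using (abs_nonneg _).trans (hSM 0 le_rfl 0)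
  have hSM' : ∀ η, 0 ≤ η → ∀ φ, |S η φ| ≤ M := fun η hη φ => by
    refine (hSM η hη φ).trans (mul_le_of_le_one_right hM0 ?_)
    rw [exp_le_one_iff]
    nlinarith
  have hsb := one_le_solBound hk
  -- Without source the constants `inf h` and `sup h` enclose the iteration, which gives the maximum
  -- principle at once. Otherwise `-M * U` and `M * U` do.
  by_cases hS0 : ∀ η, 0 ≤ η → ∀ φ, S η φ = 0
  · have hbelow : BddBelow (h '' inflow) :=
      ⟨-M, by rintro _ ⟨φ, hφ, rfl⟩; exact (abs_le.1 (hhM φ hφ)).1⟩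
    have habove : BddAbove (h '' inflow) :=
      ⟨M, by rintro _ ⟨φ, hφ, rfl⟩; exact (abs_le.1 (hhM φ hφ)).2⟩
    have hlo : ∀ E, sInf (h '' inflow) ≤ bdry h E := fun E => csInf_le hbelow (bdry_mem h E)
    have hhi : ∀ E, bdry h E ≤ sSup (h '' inflow) := fun E => le_csSup habove (bdry_mem h E)
    have hne : (h '' inflow).Nonempty := ⟨_, bdry_mem h 0⟩
    have hlM : |sInf (h '' inflow)| ≤ M := abs_le.2
      ⟨le_csInf hne (by rintro _ ⟨φ, hφ, rfl⟩; exact (abs_le.1 (hhM φ hφ)).1),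
        (hlo 0).trans ((abs_le.1 (abs_bdry_le hhM 0)).2)⟩
    have huM : |sSup (h '' inflow)| ≤ M := abs_le.2
      ⟨((abs_le.1 (abs_bdry_le hhM 0)).1).trans (hhi 0),
        csSup_le hne (by rintro _ ⟨φ, hφ, rfl⟩; exact (abs_le.1 (hhM φ hφ)).2)⟩
    set l := sInf (h '' inflow) with hl
    set u := sSup (h '' inflow) with hu
    obtain ⟨a, ham, haB, hfix, hbd⟩ := exists_fixed_avg hF hγ hh hS hhM hSM'
      (L := fun _ _ => l) (U := fun _ _ => u) (B := M) measurable_const measurable_const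
      (fun _ _ _ => hlM) (fun _ _ _ => huM) (fun _ _ _ => (hlo 0).trans (hhi 0))
      (fun η _ φ => by
        have hc : avg (fun _ _ => l) = fun _ => l := funext fun η => avg_const l η
        rw [hc]
        have := resolv_mono hγ (measurable_const (a := l))
          (measurable_gain hF hh hS (measurable_const (a := l))) (B := M + M)
          (fun _ => by linarith) (abs_gain_le hhM hSM' fun _ _ => hlM) (fun p => by
            unfold gain
            split_ifs with hp
            · rw [hS0 _ hp, add_zero]
            · exact hlo _) (η, φ)
        rwa [resolv_const] at this)
      (fun η _ φ => by
        have hc : avg (fun _ _ => u) = fun _ => u := funext fun η => avg_const u η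
        rw [hc]
        have := resolv_mono hγ (measurable_gain hF hh hS (measurable_const (a := u)))
          (measurable_const (a := u)) (B := M + M) (abs_gain_le hhM hSM' fun _ _ => huM)
          (fun _ => by linarith) (fun p => by
            unfold gain
            split_ifs with hp
            · rw [hS0 _ hp, add_zero]
            · exact hhi _) (η, φ)
        rwa [resolv_const] at this)
    refine ⟨solveAvg γ F h S a, measurable_solveAvg hF hγ hh hS ham, solveAvg_periodic hγ hSp,
      isSol_solveAvg hF hγ hh hS ham hhM hSM' haB hfix, fun η hη φ => ?_,
      fun φ hφ => solveAvg_boundary hF hγ hφ, fun _ => hbd⟩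
    have h1 := hbd η hη φ
    have h2 : |solveAvg γ F h S a η φ| ≤ M := abs_le.2
      ⟨(abs_le.1 hlM).1.trans h1.1, h1.2.trans (abs_le.1 huM).2⟩
    nlinarith
  -- For `η ≥ 0` the function `M * q` dominates average plus source, and for `η < 0` it dominates
  -- the data because `q ≥ 1`. Monotonicity of the resolvent makes `M * U` a supersolution and `-M *
  -- U` a subsolution.
  · obtain ⟨U, hUm, hUb, q, hqm, ⟨B, hqB⟩, hres, hq1, hq2⟩ := exists_supersolution hk hk' hF hγ
    have hUi : ∀ η, IntervalIntegrable (U η) volume (-π) π := fun η =>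
      intervalIntegrable_of_bounded (measurable_section hUm η) (B := solBound k)
        (by linarith [pi_pos]) fun φ _ => by rw [abs_of_nonneg (hUb η φ).1]; exact (hUb η φ).2
    have havg : ∀ (c : ℝ), |c| = M → ∀ η, |avg (fun η φ => c * U η φ) η| ≤ solBound k * M := by
      intro c hc η
      rw [avg_const_mul, abs_mul, hc, abs_of_nonneg (le_avg (hUi η) fun φ => (hUb η φ).1), mul_comm]
      exact mul_le_mul_of_nonneg_right (avg_le (hUi η) fun φ => (hUb η φ).2) hM0
    have hcU : ∀ (c : ℝ), |c| = M → ∀ η φ, |c * U η φ| ≤ solBound k * M := fun c hc η φ => by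
      rw [abs_mul, hc, abs_of_nonneg (hUb η φ).1, mul_comm]
      exact mul_le_mul_of_nonneg_right (hUb η φ).2 hM0
    have hMabs : |M| = M := abs_of_nonneg hM0
    have hMabs' : |-M| = M := by rw [abs_neg, hMabs]
    have hqc : ∀ (c : ℝ), |c| = M → ∀ p, |c * q p| ≤ max (solBound k * M + M) (M * B) :=
      fun c hc p => by
        rw [abs_mul, hc]
        exact (mul_le_mul_of_nonneg_left (hqB p) hM0).trans (le_max_right _ _)
    have hgainB : ∀ (c : ℝ), |c| = M → ∀ p, |gain F h S (avg fun η φ => c * U η φ) p| ≤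
        max (solBound k * M + M) (M * B) := fun c hc p =>
      (abs_gain_le hhM hSM' (fun η _ => havg c hc η) p).trans (le_max_left _ _)
    have hgm : ∀ c : ℝ, Measurable (gain F h S (avg fun η φ => c * U η φ)) := fun c =>
      measurable_gain hF hh hS (measurable_avg (hUm.const_mul c))
    obtain ⟨a, ham, haB, hfix, hbd⟩ := exists_fixed_avg hF hγ hh hS hhM hSM'
      (L := fun η φ => -M * U η φ) (U := fun η φ => M * U η φ) (B := solBound k * M)
      (hUm.const_mul _) (hUm.const_mul _) (fun η _ => hcU _ hMabs' η) (fun η _ => hcU _ hMabs η)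
      (fun η _ φ => by have := mul_nonneg hM0 (hUb η φ).1; linarith)
      (fun η _ φ => by
        have := resolv_mono hγ (hqm.const_mul (-M)) (hgm (-M)) (hqc _ hMabs') (hgainB _ hMabs')
          (fun p => by
            unfold gain
            split_ifs with hp
            · rw [avg_const_mul]
              have h1 := mul_le_mul_of_nonneg_left (hq1 p.1 hp p.2) hM0
              have h2 := (abs_le.1 (hSM p.1 hp p.2)).1
              linarith
            · have h1 := mul_le_mul_of_nonneg_left (hq2 p) hM0
              have h2 := (abs_le.1 (abs_bdry_le hhM (energy F p))).1
              linarith) (η, φ)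
        rwa [resolv_const_mul, hres] at this)
      (fun η _ φ => by
        have := resolv_mono hγ (hgm M) (hqm.const_mul M) (hgainB _ hMabs) (hqc _ hMabs)
          (fun p => by
            unfold gain
            split_ifs with hp
            · rw [avg_const_mul]
              have h1 := mul_le_mul_of_nonneg_left (hq1 p.1 hp p.2) hM0
              have h2 := (abs_le.1 (hSM p.1 hp p.2)).2
              linarith
            · have h1 := mul_le_mul_of_nonneg_left (hq2 p) hM0
              have h2 := (abs_le.1 (abs_bdry_le hhM (energy F p))).2
              linarith) (η, φ)
        rwa [resolv_const_mul, hres] at this)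
    refine ⟨solveAvg γ F h S a, measurable_solveAvg hF hγ hh hS ham, solveAvg_periodic hγ hSp,
      isSol_solveAvg hF hγ hh hS ham hhM hSM' haB hfix, fun η hη φ => ?_,
      fun φ hφ => solveAvg_boundary hF hγ hφ, fun hcon => absurd hcon hS0⟩
    have h1 := hbd η hη φ
    exact abs_le.2 ⟨(abs_le.1 (hcU (-M) hMabs' η φ)).1.trans h1.1,
      h1.2.trans (abs_le.1 (hcU M hMabs η φ)).2⟩

/-! ### Time reversal, rising arcs and energy lines. -/

lemma IsCharacteristic.reflect {F : ℝ → ℝ} {a b : ℝ} {X Φ : ℝ → ℝ}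
    (h : IsCharacteristic F a b X Φ) :
    IsCharacteristic F (-b) (-a) (fun t => X (-t)) (fun t => -Φ (-t)) := by
  intro t ht
  have ht' : -t ∈ Icc a b := ⟨by linarith [ht.2], by linarith [ht.1]⟩
  obtain ⟨h0, h1, h2⟩ := h (-t) ht'
  have hmaps : MapsTo (fun t : ℝ => -t) (Icc (-b) (-a)) (Icc a b) := fun s hs =>
    ⟨by linarith [hs.2], by linarith [hs.1]⟩
  have hn : HasDerivWithinAt (fun t : ℝ => -t) (-1) (Icc (-b) (-a)) t :=
    (hasDerivAt_neg t).hasDerivWithinAt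
  refine ⟨h0, ?_, ?_⟩
  · have := h1.scomp t hn hmaps
    refine this.congr_deriv ?_
    simp
  · have := (h2.scomp t hn hmaps).neg
    refine this.congr_deriv ?_
    simp

/-- The map `φ ↦ -φ` reverses time on characteristics, hence the sign of the derivative. -/
lemma HasTransport.reflect {F : ℝ → ℝ} {g Q : ℝ → ℝ → ℝ} (h : HasTransport F g Q) :
    HasTransport F (fun η φ => g η (-φ)) (fun η φ => -Q η (-φ)) := by
  intro a b X Φ hab hX
  obtain ⟨h1, h2⟩ := h (-b) (-a) _ _ (by linarith) hX.reflect
  simp only [neg_neg] at h2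
  have h3 : IntervalIntegrable (fun t => Q (X t) (-Φ t)) volume b a := by
    have := (IntervalIntegrable.iff_comp_neg (by finiteness)).1 h1
    simpa using this
  refine ⟨h3.symm.neg, ?_⟩
  have h4 := intervalIntegral.integral_comp_neg (a := a) (b := b)
    (fun t => Q (X (-t)) (-Φ (-t)))
  simp only [neg_neg] at h4
  rw [intervalIntegral.integral_neg, h4, ← h2]
  ring

section Arcs

variable {F : ℝ → ℝ} {γ : ℝ → ℝ × ℝ → ℝ × ℝ}

/-- Once positive, `sin φ` does not decrease backward in time, so the wall is reached in finite
time. Positivity is asked only for `s > 0`, which admits turning points as starting points. -/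
lemma exists_arc_time (hF : Admissible F) (hγ : IsFlow F γ) {p : ℝ × ℝ} (hp : 0 < p.1)
    (hsin : ∀ s, 0 < s → 0 < sin (γ (-s) p).2) :
    ∃ T, 0 < T ∧ (γ (-T) p).1 = 0 ∧ ∀ s ∈ Icc 0 T, 0 ≤ (γ (-s) p).1 := by
  have hcont : Continuous fun s => (γ (-s) p).1 :=
    (continuous_fst.comp (hγ.cont_left p)).comp continuous_neg
  have hσ := hsin 1 one_pos
  set σ := sin (γ (-1) p).2
  set T₀ := 1 + |(γ (-1) p).1| / σ with hT₀
  have hT₀' : 0 ≤ |(γ (-1) p).1| / σ := by positivity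
  have hexit : (γ (-T₀) p).1 ≤ 0 := by
    have h1 := (hγ.fst_sub_le hF p (s := -T₀) (t := -1) (by linarith)).2
    have h2 : σ * (-1 - -T₀) = |(γ (-1) p).1| := by
      have : -1 - -T₀ = |(γ (-1) p).1| / σ := by rw [hT₀]; ring
      rw [this]; field_simp
    rw [h2] at h1
    linarith [le_abs_self (γ (-1) p).1]
  obtain ⟨T, hT0, _, hT, hlt⟩ := exists_first_le hcont
    (by simpa [hγ.zero] using hp : 0 < (γ (-0) p).1) ⟨T₀, ⟨by linarith, le_rfl⟩, hexit⟩
  refine ⟨T, hT0, hT, fun s hs => ?_⟩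
  rcases hs.2.lt_or_eq with h | h
  · exact (hlt s hs.1 h).le
  · rw [h, hT]

lemma sin_pos_of_sin_pos (hF : Admissible F) (hγ : IsFlow F γ) {p : ℝ × ℝ} (hp : 0 < sin p.2)
    {s : ℝ} (hs : 0 < s) : 0 < sin (γ (-s) p).2 := by
  have := hγ.antitone_sin hF p (show -s ≤ 0 by linarith)
  simp only [hγ.zero] at this
  linarith

/-- At a point with `sin φ = 0` the derivative of `sin φ` is `F < 0`, so the path was rising just
before, and by monotonicity at all earlier times. -/
lemma sin_pos_of_turning (hF : Admissible F) (hγ : IsFlow F γ) {p : ℝ × ℝ} (hp : sin p.2 = 0)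
    (hFp : F p.1 < 0) {s : ℝ} (hs : 0 < s) : 0 < sin (γ (-s) p).2 := by
  have hcos : cos p.2 ^ 2 = 1 := by have := sin_sq_add_cos_sq p.2; rw [hp] at this; linarith
  have hd : HasDerivAt (fun t => sin (γ t p).2) (F p.1) 0 := by
    have := (hγ.deriv_snd p 0).sin
    rw [hγ.zero] at this
    refine this.congr_deriv ?_
    linear_combination F p.1 * hcos
  have hev : ∀ᶠ t in 𝓝[<] (0 : ℝ), 0 < sin (γ t p).2 := by
    have := (hasDerivAt_iff_tendsto_slope.1 hd).mono_left
      (nhdsWithin_mono 0 (fun t (ht : t < 0) => ht.ne))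
    filter_upwards [this.eventually (gt_mem_nhds hFp), self_mem_nhdsWithin] with t ht ht0
    have ht0' : t < 0 := ht0
    rw [slope_def_field] at ht
    simp only [hγ.zero, hp, sub_zero] at ht
    rcases div_neg_iff.1 ht with h | h
    · exact h.1
    · linarith [h.2]
  obtain ⟨t, ht, hts⟩ := (hev.and (Ioo_mem_nhdsLT (show -s < 0 by linarith))).exists
  exact ht.trans_le (hγ.antitone_sin hF p hts.1.le)

/-- The largest energy of a characteristic through level `η`. -/
def maxEnergy (F : ℝ → ℝ) (η : ℝ) : ℝ := exp (-pot F η)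

/-- The angle in `[0, π]` at level `η` of the characteristic with energy `E`. -/
def angle (F : ℝ → ℝ) (E η : ℝ) : ℝ := arccos (E / maxEnergy F η)

lemma maxEnergy_pos (F : ℝ → ℝ) (η : ℝ) : 0 < maxEnergy F η := exp_pos _

lemma angle_eq {p : ℝ × ℝ} (h0 : 0 ≤ p.2) (hπ : p.2 ≤ π) : angle F (energy F p) p.1 = p.2 := by
  unfold angle energy maxEnergy
  rw [mul_div_assoc, div_self (exp_pos _).ne', mul_one, Real.arccos_cos h0 hπ]

/-- On a rising backward arc the angle is a function of the position. -/
lemma angle_flow (hF : Admissible F) (hγ : IsFlow F γ) {p : ℝ × ℝ} (h0 : 0 ≤ p.2) (hπ : p.2 ≤ π)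
    (hsin : ∀ s, 0 < s → 0 < sin (γ (-s) p).2) {s : ℝ} (hs : 0 ≤ s) :
    angle F (energy F p) (γ (-s) p).1 = (γ (-s) p).2 := by
  rw [← hγ.energy_eq hF p (-s)]
  have hcont : Continuous fun s => (γ (-s) p).2 :=
    (continuous_snd.comp (hγ.cont_left p)).comp continuous_neg
  have hz : (γ (-0) p).2 = p.2 := by simp [hγ.zero]
  refine angle_eq ?_ ?_
  · by_contra hneg
    rw [not_le] at hneg
    obtain ⟨r, hr, hr0⟩ := intermediate_value_Icc' hs hcont.continuousOn
      (show (0 : ℝ) ∈ Icc _ _ from ⟨hneg.le, by rw [hz]; exact h0⟩)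
    -- If the angle is `0` only at the start, some angle in `[-π / 2, 0)` is attained at a positive
    -- time, contradicting `0 < sin`.
    rcases hr.1.eq_or_lt with h | h
    · beta_reduce at hr0
      rw [← h, hz] at hr0
      have hpi := pi_pos
      obtain ⟨r', hr', hr0'⟩ := intermediate_value_Icc' hs hcont.continuousOn
        (show max (γ (-s) p).2 (-(π / 2)) ∈ Icc _ _ from
          ⟨le_max_left _ _, by rw [hz, hr0]; exact max_le hneg.le (by linarith)⟩)
      have hlt : max (γ (-s) p).2 (-(π / 2)) < 0 := max_lt hneg (by linarith)
      have hr'0 : 0 < r' := by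
        rcases hr'.1.eq_or_lt with h' | h'
        · beta_reduce at hr0'
          rw [← h', hz, hr0] at hr0'; linarith
        · exact h'
      have := hsin r' hr'0
      simp only at hr0'
      rw [hr0'] at this
      have h3 := Real.sin_neg_of_neg_of_neg_pi_lt hlt (by
        have := le_max_right (γ (-s) p).2 (-(π / 2)); linarith)
      linarith
    · have := hsin r h
      simp only at hr0
      rw [hr0] at this
      simp at this
  · by_contra hneg
    rw [not_le] at hneg
    obtain ⟨r, hr, hr0⟩ := intermediate_value_Icc hs hcont.continuousOn
      (show π ∈ Icc _ _ from ⟨by rw [hz]; exact hπ, hneg.le⟩)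
    rcases hr.1.eq_or_lt with h | h
    · beta_reduce at hr0
      rw [← h, hz] at hr0
      have hpi := pi_pos
      obtain ⟨r', hr', hr0'⟩ := intermediate_value_Icc hs hcont.continuousOn
        (show min (γ (-s) p).2 (π + π / 2) ∈ Icc _ _ from
          ⟨by rw [hz, hr0]; exact le_min hneg.le (by linarith), min_le_left _ _⟩)
      have hlt : π < min (γ (-s) p).2 (π + π / 2) := lt_min hneg (by linarith)
      have hr'0 : 0 < r' := by
        rcases hr'.1.eq_or_lt with h' | h'
        · beta_reduce at hr0'
          rw [← h', hz, hr0] at hr0'; linarith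
        · exact h'
      have := hsin r' hr'0
      simp only at hr0'
      rw [hr0'] at this
      have h3 : 0 < sin (min (γ (-s) p).2 (π + π / 2) - π) := Real.sin_pos_of_pos_of_lt_pi
        (by linarith) (by have := min_le_right (γ (-s) p).2 (π + π / 2); linarith)
      rw [Real.sin_sub_pi] at h3
      linarith
    · have := hsin r h
      simp only at hr0
      rw [hr0] at this
      simp at this

/-- The transport equation integrated along a rising arc, in the variable `η`. -/
lemma integral_rising_arc (hF : Admissible F) (hγ : IsFlow F γ) {u G : ℝ → ℝ → ℝ}
    (hu : HasTransport F u G) {p : ℝ × ℝ} (hp : 0 < p.1) (h0 : 0 ≤ p.2) (hπ : p.2 ≤ π)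
    (hsin : ∀ s, 0 < s → 0 < sin (γ (-s) p).2) :
    IntegrableOn (fun η => G η (angle F (energy F p) η) / sin (angle F (energy F p) η))
      (Icc 0 p.1) ∧
    u p.1 p.2 - u 0 (angle F (energy F p) 0) =
      ∫ η in Icc 0 p.1, G η (angle F (energy F p) η) / sin (angle F (energy F p) η) := by
  obtain ⟨T, hT0, hT, hge⟩ := exists_arc_time hF hγ hp hsin
  have hsp : 0 ≤ sin p.2 := Real.sin_nonneg_of_nonneg_of_le_pi h0 hπ
  have hT' : -T ≤ 0 := by linarith
  have hch := hγ.isCharacteristic p 0 (a := -T) (b := 0) fun t ht => by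
    have := hge (-t) ⟨by linarith [ht.2], by linarith [ht.1]⟩
    simpa using this
  obtain ⟨h1, h2⟩ := hu _ _ _ _ hT' hch
  simp only [add_zero, hγ.zero] at h1 h2
  have hang0 : angle F (energy F p) 0 = (γ (-T) p).2 := by
    rw [← angle_flow hF hγ h0 hπ hsin hT0.le, hT]
  rw [hT] at h2
  have hi : IntervalIntegrable (fun s => G (γ (-s) p).1 (γ (-s) p).2) volume 0 T := by
    have := (IntervalIntegrable.iff_comp_neg (by finiteness)).1 h1.symm
    simpa using this
  have hv : ∫ s in (0 : ℝ)..T, G (γ (-s) p).1 (γ (-s) p).2 = ∫ t in -T..0, G (γ t p).1 (γ t p).2 := by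
    have := intervalIntegral.integral_comp_neg (a := 0) (b := T)
      (fun t => G (γ t p).1 (γ t p).2)
    rw [this, neg_zero]
  set w : ℝ → ℝ := fun η => G η (angle F (energy F p) η) / sin (angle F (energy F p) η) with hw
  -- The half-open interval matters: at `s = 0`, possibly a turning point, the quotient by the sine
  -- is not controlled.
  have hcongr : ∀ s ∈ Ioc 0 T, G (γ (-s) p).1 (γ (-s) p).2 =
      sin (γ (-s) p).2 * w (γ (-s) p).1 := fun s hs => by
    have := hsin s hs.1
    simp only [hw]
    rw [angle_flow hF hγ h0 hπ hsin hs.1.le]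
    field_simp
  constructor
  · have := (hγ.integrableOn_arc_iff hF hsp hT0.le w).2
    rw [hT] at this
    refine this ?_
    rw [integrableOn_Icc_iff_integrableOn_Ioc]
    exact ((intervalIntegrable_iff_integrableOn_Ioc_of_le hT0.le).1 hi).congr_fun hcongr
      measurableSet_Ioc
  · have := hγ.integral_arc hF hsp hT0.le w
    rw [hT] at this
    rw [this, integral_Icc_eq_integral_Ioc, ← setIntegral_congr_fun measurableSet_Ioc hcongr,
      ← intervalIntegral.integral_of_le hT0.le, hv, ← h2, hang0]

end Arcs

/-- Twice the odd part in the angle. -/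
def oddPart (u : ℝ → ℝ → ℝ) (η φ : ℝ) : ℝ := u η φ - u η (-φ)

/-- Twice the even part in the angle. -/
def evenPart (u : ℝ → ℝ → ℝ) (η φ : ℝ) : ℝ := u η φ + u η (-φ)

section MaxEnergy

variable {F : ℝ → ℝ}

lemma Admissible.hasDerivAt_maxEnergy (hF : Admissible F) (η : ℝ) :
    HasDerivAt (maxEnergy F) (F η * maxEnergy F η) η := by
  have := (hasDerivAt_pot hF η).neg.exp
  refine this.congr_deriv ?_
  simp only [maxEnergy, Pi.neg_apply]; ring

lemma Admissible.continuous_maxEnergy (hF : Admissible F) : Continuous (maxEnergy F) :=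
  continuous_iff_continuousAt.2 fun η => (hF.hasDerivAt_maxEnergy η).continuousAt

lemma Admissible.antitone_maxEnergy (hF : Admissible F) : Antitone (maxEnergy F) := fun _ _ h =>
  Real.exp_le_exp.2 (neg_le_neg (monotone_pot hF h))

lemma maxEnergy_zero : maxEnergy F 0 = 1 := by simp [maxEnergy, pot_zero]

/-- The energies at which a characteristic can be asymptotic to a level. -/
lemma Admissible.ae_not_critical (hF : Admissible F) :
    ∀ᵐ E : ℝ, ∀ η, |E| = maxEnergy F η → F η ≠ 0 := by
  -- A one-dimensional Sard argument: the derivative of `maxEnergy F` is `F * maxEnergy F`, so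
  -- levels with `F = 0` have null image.
  have hN : volume (maxEnergy F '' {η | F η = 0}) = 0 := by
    refine addHaar_image_eq_zero_of_det_fderivWithin_eq_zero volume
      (f' := fun _ => (0 : ℝ →L[ℝ] ℝ)) (fun η hη => ?_) fun η _ => ?_
    · have := (hF.hasDerivAt_maxEnergy η).hasFDerivAt.hasFDerivWithinAt (s := {η | F η = 0})
      refine this.congr_fderiv ?_
      have h0 : F η = 0 := hη
      ext; simp [h0]
    · simp [ContinuousLinearMap.det]
  have h1 : ∀ᵐ E : ℝ, E ∉ maxEnergy F '' {η | F η = 0} := measure_eq_zero_iff_ae_notMem.1 hN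
  have h2 : ∀ᵐ E : ℝ, -E ∉ maxEnergy F '' {η | F η = 0} :=
    (Measure.measurePreserving_neg (volume : Measure ℝ)).quasiMeasurePreserving.ae h1
  filter_upwards [h1, h2] with E h1 h2 η hη h0
  rcases abs_choice E with h | h
  · exact h1 ⟨η, h0, by rw [← hη, h]⟩
  · exact h2 ⟨η, h0, by rw [← hη, h]⟩

/-- The integrand, in energy variables, of the sum of the two sheets over level `η`. -/
def sheetSum (F : ℝ → ℝ) (G : ℝ → ℝ → ℝ) (E η : ℝ) : ℝ :=
  if |E| < maxEnergy F η then evenPart G η (angle F E η) / sin (angle F E η) else 0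

/-- The jump between the two sheets at level `R`. -/
def sheetJump (F : ℝ → ℝ) (u : ℝ → ℝ → ℝ) (E R : ℝ) : ℝ :=
  if |E| < maxEnergy F R then oddPart u R (angle F E R) else 0

variable {γ : ℝ → ℝ × ℝ → ℝ × ℝ}

/-- The two sheets over a level are `φ` and `-φ` at equal energy. The arc identity for `u` and for
its reflection is subtracted; the sign change of the reflected derivative makes the even part of `G`
appear. -/
lemma integral_both_sheets (hF : Admissible F) (hγ : IsFlow F γ) {u G : ℝ → ℝ → ℝ}
    (hu : HasTransport F u G) {p : ℝ × ℝ} (hp : 0 < p.1) (h0 : 0 ≤ p.2) (hπ : p.2 ≤ π)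
    (hsin : ∀ s, 0 < s → 0 < sin (γ (-s) p).2) {E : ℝ} (hE : energy F p = E) :
    IntegrableOn (fun η => evenPart G η (angle F E η) / sin (angle F E η)) (Icc 0 p.1) ∧
    ∫ η in Icc 0 p.1, evenPart G η (angle F E η) / sin (angle F E η) =
      oddPart u p.1 p.2 - oddPart u 0 (angle F E 0) := by
  obtain ⟨i1, e1⟩ := integral_rising_arc hF hγ hu hp h0 hπ hsin
  obtain ⟨i2, e2⟩ := integral_rising_arc hF hγ hu.reflect hp h0 hπ hsin
  rw [hE] at i1 e1 i2 e2
  have heq : (fun η => evenPart G η (angle F E η) / sin (angle F E η)) = fun η =>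
      G η (angle F E η) / sin (angle F E η) - -G η (-angle F E η) / sin (angle F E η) := by
    funext η; simp only [evenPart]; ring
  rw [heq]
  refine ⟨i1.sub i2, ?_⟩
  rw [integral_sub i1 i2, ← e1, ← e2]
  simp only [oddPart]; ring

/-- Either the energy line crosses level `R` and ends in two points there, or it turns back at some
`ρ ≤ R`, where the sheets meet and leave no boundary term. The noncritical condition makes the
turning point one that is reached in finite time. -/
lemma integral_sheetSum (hF : Admissible F) (hγ : IsFlow F γ) {u G : ℝ → ℝ → ℝ}
    (hu : HasTransport F u G) (hper : ∀ η φ, u η (φ + 2 * π) = u η φ) {R : ℝ} (hR : 0 < R)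
    {E : ℝ} (hE : |E| < 1) (hER : |E| ≠ maxEnergy F R)
    (hcrit : ∀ η, |E| = maxEnergy F η → F η ≠ 0) :
    IntegrableOn (sheetSum F G E) (Icc 0 R) ∧
    ∫ η in Icc 0 R, sheetSum F G E η = sheetJump F u E R - sheetJump F u E 0 := by
  have hpi := pi_pos
  have hJ0 : sheetJump F u E 0 = oddPart u 0 (angle F E 0) := by
    rw [sheetJump, maxEnergy_zero, if_pos hE]
  rw [hJ0]
  rcases hER.lt_or_gt with hlt | hgt
  · have hc := maxEnergy_pos F R
    have hab : -1 < E / maxEnergy F R ∧ E / maxEnergy F R < 1 := by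
      rw [← abs_lt, abs_div, abs_of_pos hc, div_lt_one hc]; exact hlt
    have hen : energy F (R, angle F E R) = E := by
      simp only [energy, angle]
      rw [Real.cos_arccos hab.1.le hab.2.le]
      exact div_mul_cancel₀ _ hc.ne'
    have hsin : 0 < sin (angle F E R) := by
      rw [angle, Real.sin_arccos]
      refine Real.sqrt_pos.2 ?_
      nlinarith [hab.1, hab.2]
    obtain ⟨i, e⟩ := integral_both_sheets hF hγ hu (p := (R, angle F E R)) hR
      (Real.arccos_nonneg _) (Real.arccos_le_pi _)
      (fun s hs => sin_pos_of_sin_pos hF hγ (p := (R, angle F E R)) hsin hs) hen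
    have hcongr : EqOn (fun η => evenPart G η (angle F E η) / sin (angle F E η))
        (sheetSum F G E) (Icc 0 R) := fun η hη => by
      have := hlt.trans_le (hF.antitone_maxEnergy hη.2)
      simp only [sheetSum, if_pos this]
    refine ⟨i.congr_fun hcongr measurableSet_Icc, ?_⟩
    rw [← setIntegral_congr_fun measurableSet_Icc hcongr, e, sheetJump, if_pos hlt]
  · obtain ⟨ρ, hρ0, hρR, hρ, hbefore⟩ := exists_first_le hF.continuous_maxEnergy
      (c := |E|) (by rw [maxEnergy_zero]; exact hE) ⟨R, ⟨hR.le, le_rfl⟩, hgt.le⟩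
    have hρ' : |E| = maxEnergy F ρ := hρ.symm
    have hE0 : 0 < |E| := hρ' ▸ maxEnergy_pos F ρ
    have hFρ : F ρ < 0 := lt_of_le_of_ne (hF.nonpos ρ) (hcrit ρ hρ')
    have hang : (angle F E ρ = 0 ∨ angle F E ρ = π) := by
      rw [angle, ← hρ']
      rcases abs_choice E with h | h
      · left; rw [h, div_self (fun h0 => by rw [h0, abs_zero] at hE0; exact hE0.false),
          Real.arccos_one]
      · right; rw [h, div_neg, div_self (fun h0 => by rw [h0, abs_zero] at hE0; exact hE0.false),
          Real.arccos_neg_one]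
    have hsin : sin (angle F E ρ) = 0 := by rcases hang with h | h <;> simp [h]
    have hc := maxEnergy_pos F ρ
    have hab : -1 ≤ E / maxEnergy F ρ ∧ E / maxEnergy F ρ ≤ 1 := by
      rw [← abs_le, abs_div, abs_of_pos hc, div_le_one hc]; exact hρ'.le
    have hen : energy F (ρ, angle F E ρ) = E := by
      simp only [energy, angle]
      rw [Real.cos_arccos hab.1 hab.2]
      exact div_mul_cancel₀ _ hc.ne'
    obtain ⟨i, e⟩ := integral_both_sheets hF hγ hu (p := (ρ, angle F E ρ)) hρ0
      (Real.arccos_nonneg _) (Real.arccos_le_pi _)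
      (fun s hs => sin_pos_of_turning hF hγ (p := (ρ, angle F E ρ)) hsin hFρ hs) hen
    -- At the turning angle `0` or `π`, the points `φ` and `-φ` coincide on the circle.
    have hodd : oddPart u ρ (angle F E ρ) = 0 := by
      rw [oddPart]
      rcases hang with h | h
      · simp [h]
      · rw [h, ← hper ρ (-π)]; ring_nf
    have hcongr : EqOn (fun η => evenPart G η (angle F E η) / sin (angle F E η))
        (sheetSum F G E) (Ico 0 ρ) := fun η hη => by
      have := hbefore η hη.1 hη.2
      simp only [sheetSum, if_pos this]
    have hzero : ∀ η ∈ Icc ρ R, sheetSum F G E η = 0 := fun η hη => by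
      rw [sheetSum, if_neg (not_lt.2 (hρ' ▸ hF.antitone_maxEnergy hη.1))]
    have hρR' : ρ ≤ R := hρR
    have hsplit : Ico 0 ρ ∪ Icc ρ R = Icc 0 R := Ico_union_Icc_eq_Icc hρ0.le hρR'
    have i1 : IntegrableOn (sheetSum F G E) (Ico 0 ρ) :=
      (i.mono_set Ico_subset_Icc_self).congr_fun hcongr measurableSet_Ico
    have i2 : IntegrableOn (sheetSum F G E) (Icc ρ R) :=
      (integrableOn_zero (μ := volume)).congr_fun (fun η hη => (hzero η hη).symm)
        measurableSet_Icc
    rw [← hsplit]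
    refine ⟨i1.union i2, ?_⟩
    rw [setIntegral_union (by
        rw [Set.disjoint_left]; intro x hx hx'; exact absurd hx'.1 (not_le.2 hx.2))
      measurableSet_Icc i1 i2, setIntegral_eq_zero_of_forall_eq_zero hzero,
      ← setIntegral_congr_fun measurableSet_Ico hcongr, ← integral_Icc_eq_integral_Ico, e, hodd,
      sheetJump, if_neg (not_lt.2 hgt.le), add_zero]

end MaxEnergy

/-! ### The substitution `E = c * cos φ` and the divergence theorem. -/

section Substitution

variable {c : ℝ} (w : ℝ → ℝ)

lemma image_mul_cos (hc : 0 < c) : (fun φ => c * cos φ) '' Ioo 0 π = Ioo (-c) c := by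
  ext E
  constructor
  · rintro ⟨φ, hφ, rfl⟩
    have hs := Real.sin_pos_of_pos_of_lt_pi hφ.1 hφ.2
    have h := sin_sq_add_cos_sq φ
    have h1 : cos φ < 1 := by nlinarith [Real.cos_le_one φ, Real.neg_one_le_cos φ]
    have h2 : -1 < cos φ := by nlinarith [Real.cos_le_one φ, Real.neg_one_le_cos φ]
    constructor <;> nlinarith
  · intro hE
    have h1 : -1 < E / c := by rw [lt_div_iff₀ hc]; linarith [hE.1]
    have h2 : E / c < 1 := by rw [div_lt_iff₀ hc]; linarith [hE.2]
    refine ⟨arccos (E / c), ⟨Real.arccos_pos.2 h2, Real.arccos_lt_pi.2 h1⟩, ?_⟩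
    simp only
    rw [Real.cos_arccos h1.le h2.le]; field_simp

lemma injOn_mul_cos (hc : 0 < c) : InjOn (fun φ => c * cos φ) (Ioo 0 π) := fun _ hx _ hy h =>
  Real.injOn_cos (Ioo_subset_Icc_self hx) (Ioo_subset_Icc_self hy)
    (mul_left_cancel₀ hc.ne' h)

lemma hasDerivWithinAt_mul_cos (x : ℝ) :
    HasDerivWithinAt (fun φ => c * cos φ) (-(c * sin x)) (Ioo 0 π) x := by
  have := ((Real.hasDerivAt_cos x).const_mul c).hasDerivWithinAt (s := Ioo 0 π)
  refine this.congr_deriv ?_; ring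

lemma substitution_integrand (hc : 0 < c) :
    EqOn (fun φ => |-(c * sin φ)| • w (arccos (c * cos φ / c))) (fun φ => c * (w φ * sin φ))
      (Ioo 0 π) := fun φ hφ => by
  have hs := Real.sin_pos_of_pos_of_lt_pi hφ.1 hφ.2
  simp only [abs_neg, abs_of_pos (mul_pos hc hs), smul_eq_mul]
  rw [mul_div_cancel_left₀ _ hc.ne', Real.arccos_cos hφ.1.le hφ.2.le]; ring

lemma integrableOn_arccos_iff (hc : 0 < c) :
    IntegrableOn (fun E => w (arccos (E / c))) (Ioo (-c) c) ↔
      IntegrableOn (fun φ => w φ * sin φ) (Ioo 0 π) := by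
  rw [← image_mul_cos hc, integrableOn_image_iff_integrableOn_abs_deriv_smul measurableSet_Ioo
    (fun x _ => hasDerivWithinAt_mul_cos x) (injOn_mul_cos hc),
    integrableOn_congr_fun (substitution_integrand w hc) measurableSet_Ioo]
  exact integrable_const_mul_iff (IsUnit.mk0 c hc.ne') _

lemma integral_arccos (hc : 0 < c) :
    ∫ E in Ioo (-c) c, w (arccos (E / c)) = c * ∫ φ in Ioo 0 π, w φ * sin φ := by
  rw [← image_mul_cos hc, integral_image_eq_integral_abs_deriv_smul measurableSet_Ioo
    (fun x _ => hasDerivWithinAt_mul_cos x) (injOn_mul_cos hc),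
    setIntegral_congr_fun measurableSet_Ioo (substitution_integrand w hc), integral_const_mul]

end Substitution

section Slice

variable {c : ℝ}

lemma abs_lt_slice_eq_indicator (c : ℝ) (w : ℝ → ℝ) :
    (fun E => if |E| < c then w (arccos (E / c)) else 0) =
      indicator (Ioo (-c) c) fun E => w (arccos (E / c)) := by
  funext E
  simp only [indicator_apply, mem_Ioo, ← abs_lt]

lemma Ioo_inter_unit (h1 : c ≤ 1) : Ioo (-c) c ∩ Ioo (-1) 1 = Ioo (-c) c :=
  inter_eq_left.2 (Ioo_subset_Ioo (by linarith) h1)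

lemma integrableOn_slice_iff (h0 : 0 < c) (h1 : c ≤ 1) (w : ℝ → ℝ) :
    IntegrableOn (fun E => if |E| < c then w (arccos (E / c)) else 0) (Ioo (-1) 1) ↔
      IntegrableOn (fun φ => w φ * sin φ) (Ioo 0 π) := by
  rw [abs_lt_slice_eq_indicator, IntegrableOn, integrable_indicator_iff measurableSet_Ioo,
    IntegrableOn, Measure.restrict_restrict measurableSet_Ioo, Ioo_inter_unit h1,
    ← integrableOn_arccos_iff w h0, IntegrableOn]

lemma integral_slice (h0 : 0 < c) (h1 : c ≤ 1) (w : ℝ → ℝ) :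
    ∫ E in Ioo (-1) 1, (if |E| < c then w (arccos (E / c)) else 0) =
      c * ∫ φ in Ioo 0 π, w φ * sin φ := by
  rw [abs_lt_slice_eq_indicator, integral_indicator measurableSet_Ioo,
    Measure.restrict_restrict measurableSet_Ioo, Ioo_inter_unit h1, integral_arccos w h0]

end Slice

section Green

variable {F : ℝ → ℝ} {γ : ℝ → ℝ × ℝ → ℝ × ℝ}

lemma Admissible.maxEnergy_le_one (hF : Admissible F) {η : ℝ} (hη : 0 ≤ η) :
    maxEnergy F η ≤ 1 := maxEnergy_zero (F := F) ▸ hF.antitone_maxEnergy hη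

lemma div_sin_mul_sin (v : ℝ → ℝ) : EqOn (fun φ => v φ / sin φ * sin φ) v (Ioo 0 π) :=
  fun _ hφ => div_mul_cancel₀ _ (Real.sin_pos_of_pos_of_lt_pi hφ.1 hφ.2).ne'

lemma norm_sheetSum (G : ℝ → ℝ → ℝ) (E η : ℝ) : ‖sheetSum F G E η‖ =
    if |E| < maxEnergy F η then
      (fun φ => |evenPart G η φ| / sin φ) (arccos (E / maxEnergy F η)) else 0 := by
  have hs : 0 ≤ sin (angle F E η) :=
    Real.sin_nonneg_of_nonneg_of_le_pi (Real.arccos_nonneg _) (Real.arccos_le_pi _)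
  unfold sheetSum
  split_ifs
  · rw [Real.norm_eq_abs, abs_div, abs_of_nonneg hs]; rfl
  · simp

lemma measurable_sheetSum (hF : Admissible F) {G : ℝ → ℝ → ℝ}
    (hG : Measurable fun p : ℝ × ℝ => G p.1 p.2) :
    Measurable fun q : ℝ × ℝ => sheetSum F G q.1 q.2 := by
  have hc : Measurable fun q : ℝ × ℝ => maxEnergy F q.2 :=
    hF.continuous_maxEnergy.measurable.comp measurable_snd
  have ha : Measurable fun q : ℝ × ℝ => angle F q.1 q.2 :=
    Real.continuous_arccos.measurable.comp (measurable_fst.div hc)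
  have he : Measurable fun q : ℝ × ℝ => evenPart G q.2 (angle F q.1 q.2) :=
    (hG.comp (measurable_snd.prodMk ha)).add (hG.comp (measurable_snd.prodMk ha.neg))
  unfold sheetSum
  refine Measurable.ite ?_ (he.div ha.sin) measurable_const
  exact measurableSet_lt measurable_fst.abs hc

/-- On each level, the Jacobian `maxEnergy F η * sin φ` of `E = maxEnergy F η * cos φ` cancels the
singular factor `1 / sin`, so integrability reduces to that of the even part of `G`. -/
lemma integrable_sheetSum (hF : Admissible F) {G : ℝ → ℝ → ℝ}
    (hG : Measurable fun p : ℝ × ℝ => G p.1 p.2) {R : ℝ}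
    (hGi : IntegrableOn (fun p : ℝ × ℝ => evenPart G p.1 p.2) (Icc 0 R ×ˢ Ioo 0 π)) :
    Integrable (fun q : ℝ × ℝ => sheetSum F G q.1 q.2)
      ((volume.restrict (Ioo (-1) 1)).prod (volume.restrict (Icc 0 R))) := by
  rw [integrable_prod_iff' (measurable_sheetSum hF hG).aestronglyMeasurable]
  rw [IntegrableOn, Measure.volume_eq_prod, ← Measure.prod_restrict] at hGi
  constructor
  · filter_upwards [hGi.prod_right_ae, ae_restrict_mem measurableSet_Icc] with η h hη
    refine (integrableOn_slice_iff (maxEnergy_pos F η) (hF.maxEnergy_le_one hη.1)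
      fun φ => evenPart G η φ / sin φ).2 ?_
    exact (integrableOn_congr_fun (div_sin_mul_sin _) measurableSet_Ioo).2 h
  · have hint : IntegrableOn (fun η => maxEnergy F η * ∫ φ in Ioo 0 π, ‖evenPart G η φ‖)
        (Icc 0 R) := by
      refine Integrable.bdd_mul (c := 1) hGi.integral_norm_prod_left
        hF.continuous_maxEnergy.aestronglyMeasurable ?_
      filter_upwards [ae_restrict_mem measurableSet_Icc] with η hη
      rw [Real.norm_eq_abs, abs_of_pos (maxEnergy_pos F η)]
      exact hF.maxEnergy_le_one hη.1
    refine IntegrableOn.congr_fun hint (fun η hη => ?_) measurableSet_Icc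
    simp only [norm_sheetSum]
    rw [integral_slice (maxEnergy_pos F η) (hF.maxEnergy_le_one hη.1)
      fun φ => |evenPart G η φ| / sin φ, setIntegral_congr_fun measurableSet_Ioo
        (div_sin_mul_sin fun φ => |evenPart G η φ|)]
    rfl

/-- The divergence theorem on the strip `[0, R]`, for the transport operator and the weight
`exp (-V)`. -/
theorem green (hF : Admissible F) (hγ : IsFlow F γ) {u G : ℝ → ℝ → ℝ}
    (hu : HasTransport F u G) (hper : ∀ η φ, u η (φ + 2 * π) = u η φ)
    (hG : Measurable fun p : ℝ × ℝ => G p.1 p.2) {R : ℝ} (hR : 0 < R)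
    (hGi : IntegrableOn (fun p : ℝ × ℝ => evenPart G p.1 p.2) (Icc 0 R ×ˢ Ioo 0 π))
    (huR : IntegrableOn (fun φ => oddPart u R φ * sin φ) (Ioo 0 π)) :
    IntegrableOn (fun φ => oddPart u 0 φ * sin φ) (Ioo 0 π) ∧
    maxEnergy F R * (∫ φ in Ioo 0 π, oddPart u R φ * sin φ) -
      ∫ φ in Ioo 0 π, oddPart u 0 φ * sin φ =
      ∫ η in Icc 0 R, maxEnergy F η * ∫ φ in Ioo 0 π, evenPart G η φ := by
  have hprod := integrable_sheetSum hF hG hGi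
  have hR1 := hF.maxEnergy_le_one hR.le
  have hcR := maxEnergy_pos F R
  have hne : ∀ x : ℝ, ∀ᵐ E : ℝ, E ≠ x := fun x => by
    simp [ae_iff, measure_singleton]
  have hae : ∀ᵐ E ∂(volume.restrict (Ioo (-1 : ℝ) 1)),
      ∫ η in Icc 0 R, sheetSum F G E η = sheetJump F u E R - sheetJump F u E 0 := by
    filter_upwards [ae_restrict_mem measurableSet_Ioo, ae_restrict_of_ae hF.ae_not_critical,
      ae_restrict_of_ae (hne (maxEnergy F R)), ae_restrict_of_ae (hne (-maxEnergy F R))]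
      with E hE hcrit h1 h2
    refine (integral_sheetSum hF hγ hu hper hR (abs_lt.2 hE) (fun h => ?_) hcrit).2
    rcases abs_choice E with h' | h'
    · exact h1 (by rw [← h', h])
    · exact h2 (by rw [← h, h', neg_neg])
  have hJR : IntegrableOn (fun E => sheetJump F u E R) (Ioo (-1) 1) :=
    (integrableOn_slice_iff hcR hR1 (oddPart u R)).2 huR
  have hH : IntegrableOn (fun E => ∫ η in Icc 0 R, sheetSum F G E η) (Ioo (-1) 1) :=
    hprod.integral_prod_left
  -- No integrability of the trace at the wall is assumed; it follows from that at level `R` and of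
  -- the source.
  have hJ0 : IntegrableOn (fun E => sheetJump F u E 0) (Ioo (-1) 1) := by
    refine (hJR.sub hH).congr ?_
    filter_upwards [hae] with E hE
    simp only [Pi.sub_apply]
    rw [hE]; ring
  have h0pos : 0 < maxEnergy F 0 := maxEnergy_pos F 0
  have h0le : maxEnergy F 0 ≤ 1 := maxEnergy_zero.le
  refine ⟨(integrableOn_slice_iff h0pos h0le (oddPart u 0)).1 hJ0, ?_⟩
  have e1 : ∫ E in Ioo (-1) 1, sheetJump F u E R =
      maxEnergy F R * ∫ φ in Ioo 0 π, oddPart u R φ * sin φ :=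
    integral_slice hcR hR1 (oddPart u R)
  have e2 : ∫ E in Ioo (-1) 1, sheetJump F u E 0 = ∫ φ in Ioo 0 π, oddPart u 0 φ * sin φ := by
    have := integral_slice h0pos h0le (oddPart u 0)
    rw [maxEnergy_zero, one_mul] at this
    rw [← this]
    simp only [sheetJump, angle, maxEnergy_zero]
  rw [← e1, ← e2, ← integral_sub hJR hJ0, ← integral_congr_ae hae, integral_integral_swap hprod]
  refine setIntegral_congr_fun measurableSet_Icc fun η hη => ?_
  have := integral_slice (maxEnergy_pos F η) (hF.maxEnergy_le_one hη.1)
    fun φ => evenPart G η φ / sin φ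
  rw [setIntegral_congr_fun measurableSet_Ioo (div_sin_mul_sin fun φ => evenPart G η φ)] at this
  exact this

end Green

/-! ### Halves of the circle and the flux balance. -/

lemma measurePreserving_neg_half : MeasurePreserving (fun φ : ℝ => -φ)
    (volume.restrict (Ioo 0 π)) (volume.restrict (Ioo (-π) 0)) := by
  have := (Measure.measurePreserving_neg (volume : Measure ℝ)).restrict_preimage
    (s := Ioo (-π) 0) measurableSet_Ioo
  convert this using 2
  ext x
  simp only [mem_Ioo, mem_preimage]
  constructor <;> rintro ⟨h1, h2⟩ <;> constructor <;> linarith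

lemma integral_neg_half (g : ℝ → ℝ) : ∫ φ in Ioo 0 π, g (-φ) = ∫ φ in Ioo (-π) 0, g φ :=
  measurePreserving_neg_half.integral_comp (Homeomorph.neg ℝ).measurableEmbedding g

lemma integrableOn_neg_half {g : ℝ → ℝ} (hg : IntegrableOn g (Ioo (-π) 0)) :
    IntegrableOn (fun φ => g (-φ)) (Ioo 0 π) :=
  measurePreserving_neg_half.integrable_comp_of_integrable hg

lemma integral_halves {g : ℝ → ℝ} (hg : IntegrableOn g (Ioc (-π) π)) :
    IntegrableOn g (Ioo 0 π) ∧ IntegrableOn g (Ioo (-π) 0) ∧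
    ∫ φ in (-π)..π, g φ = (∫ φ in Ioo 0 π, g φ) + ∫ φ in Ioo (-π) 0, g φ := by
  have hpi := pi_pos
  have h1 : IntegrableOn g (Ioc 0 π) := hg.mono_set (Ioc_subset_Ioc_left (by linarith))
  have h2 : IntegrableOn g (Ioc (-π) 0) := hg.mono_set (Ioc_subset_Ioc_right hpi.le)
  refine ⟨h1.mono_set Ioo_subset_Ioc_self, h2.mono_set Ioo_subset_Ioc_self, ?_⟩
  rw [← intervalIntegral.integral_add_adjacent_intervals
    ((intervalIntegrable_iff_integrableOn_Ioc_of_le (by linarith)).2 h2)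
    ((intervalIntegrable_iff_integrableOn_Ioc_of_le hpi.le).2 h1),
    intervalIntegral.integral_of_le (by linarith), intervalIntegral.integral_of_le hpi.le,
    integral_Ioc_eq_integral_Ioo, integral_Ioc_eq_integral_Ioo, add_comm]

lemma integral_oddPart_mul_sin {u : ℝ → ℝ → ℝ} {η : ℝ}
    (hu : IntegrableOn (fun φ => u η φ * sin φ) (Ioc (-π) π)) :
    IntegrableOn (fun φ => oddPart u η φ * sin φ) (Ioo 0 π) ∧
    ∫ φ in Ioo 0 π, oddPart u η φ * sin φ = ∫ φ in (-π)..π, u η φ * sin φ := by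
  obtain ⟨h1, h2, h3⟩ := integral_halves hu
  have he : (fun φ => oddPart u η φ * sin φ) = fun φ =>
      u η φ * sin φ + u η (-φ) * sin (-φ) := by
    funext φ; simp only [oddPart, Real.sin_neg]; ring
  have h2' := integrableOn_neg_half h2
  rw [he]
  exact ⟨h1.add h2', by rw [integral_add h1 h2', h3, integral_neg_half fun φ => u η φ * sin φ]⟩

lemma integral_evenPart {u : ℝ → ℝ → ℝ} {η : ℝ} (hu : IntegrableOn (u η) (Ioc (-π) π)) :
    ∫ φ in Ioo 0 π, evenPart u η φ = ∫ φ in (-π)..π, u η φ := by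
  obtain ⟨h1, h2, h3⟩ := integral_halves hu
  unfold evenPart
  rw [integral_add h1 (integrableOn_neg_half h2), h3, integral_neg_half]

/-- The measure of the strip `[0, R] × (-π, π]`. -/
def strip (R : ℝ) : Measure (ℝ × ℝ) :=
  (volume.restrict (Icc 0 R)).prod (volume.restrict (Ioc (-π) π))

lemma integrableOn_evenPart {G : ℝ → ℝ → ℝ} {R : ℝ}
    (hG : Integrable (fun p : ℝ × ℝ => G p.1 p.2) (strip R)) :
    IntegrableOn (fun p : ℝ × ℝ => evenPart G p.1 p.2) (Icc 0 R ×ˢ Ioo 0 π) := by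
  have hpi := pi_pos
  rw [strip, Measure.prod_restrict] at hG
  have h1 : IntegrableOn (fun p : ℝ × ℝ => G p.1 p.2) (Icc 0 R ×ˢ Ioo 0 π) :=
    IntegrableOn.mono_set hG (prod_mono_right fun x hx => ⟨by linarith [hx.1], hx.2.le⟩)
  have h2 : IntegrableOn (fun p : ℝ × ℝ => G p.1 p.2) (Icc 0 R ×ˢ Ioo (-π) 0) :=
    IntegrableOn.mono_set hG (prod_mono_right fun x hx => ⟨hx.1, by linarith [hx.2]⟩)
  refine h1.add ?_
  rw [IntegrableOn, Measure.volume_eq_prod, ← Measure.prod_restrict] at h2 ⊢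
  exact ((MeasurePreserving.id (volume.restrict (Icc 0 R))).prod
    measurePreserving_neg_half).integrable_comp_of_integrable h2

section Flux

variable {F : ℝ → ℝ} {γ : ℝ → ℝ × ℝ → ℝ × ℝ}

lemma green_strip (hF : Admissible F) (hγ : IsFlow F γ) {u G : ℝ → ℝ → ℝ}
    (hu : HasTransport F u G) (hper : ∀ η φ, u η (φ + 2 * π) = u η φ)
    (hG : Measurable fun p : ℝ × ℝ => G p.1 p.2) {R : ℝ} (hR : 0 < R)
    (hGi : Integrable (fun p : ℝ × ℝ => G p.1 p.2) (strip R))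
    (huR : IntegrableOn (fun φ => u R φ * sin φ) (Ioc (-π) π)) :
    IntegrableOn (fun φ => oddPart u 0 φ * sin φ) (Ioo 0 π) ∧
    maxEnergy F R * (∫ φ in (-π)..π, u R φ * sin φ) -
      ∫ φ in Ioo 0 π, oddPart u 0 φ * sin φ =
      ∫ η in Icc 0 R, maxEnergy F η * ∫ φ in (-π)..π, G η φ := by
  obtain ⟨iR, eR⟩ := integral_oddPart_mul_sin huR
  obtain ⟨i0, e0⟩ := green hF hγ hu hper hG hR (integrableOn_evenPart hGi) iR
  refine ⟨i0, ?_⟩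
  rw [← eR, e0]
  refine integral_congr_ae ?_
  filter_upwards [hGi.prod_right_ae] with η h
  rw [integral_evenPart h]

lemma integrable_strip_of_bounded {f : ℝ → ℝ → ℝ} (hf : Measurable fun p : ℝ × ℝ => f p.1 p.2)
    {R B : ℝ} (h : ∀ η, 0 ≤ η → ∀ φ, |f η φ| ≤ B) :
    Integrable (fun p : ℝ × ℝ => f p.1 p.2) (strip R) := by
  have hfin : IsFiniteMeasure (strip R) := by unfold strip; infer_instance
  refine Integrable.of_bound hf.aestronglyMeasurable B ?_
  rw [strip, Measure.prod_restrict]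
  filter_upwards [ae_restrict_mem (measurableSet_Icc.prod measurableSet_Ioc)] with p hp
  exact h _ hp.1.1 _

/-- The total flux through the boundary balances the source. -/
theorem flux_eq (hF : Admissible F) (hγ : IsFlow F γ) {S f : ℝ → ℝ → ℝ} {M k B D κ fInf : ℝ}
    (hf : IsSol F S f) (hfm : Measurable fun p : ℝ × ℝ => f p.1 p.2)
    (hper : ∀ η φ, f η (φ + 2 * π) = f η φ) (hSm : Measurable fun p : ℝ × ℝ => S p.1 p.2)
    (hk : 0 < k) (hS : ∀ η, 0 ≤ η → ∀ φ, |S η φ| ≤ M * exp (-(k * η)))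
    (hB : ∀ η, 0 ≤ η → ∀ φ, |f η φ| ≤ B) (hκ : 0 < κ)
    (hD : ∀ η, 0 ≤ η → ∀ φ, |f η φ - fInf| ≤ D * exp (-(κ * η))) :
    ∫ φ in (-π)..π, f 0 φ * sin φ =
      -∫ η in Ici (0 : ℝ), ∫ φ in (-π)..π, maxEnergy F η * S η φ := by
  have hpi := pi_pos
  have hM : 0 ≤ M := by simpa using (abs_nonneg _).trans (hS 0 le_rfl 0)
  have hSM : ∀ η, 0 ≤ η → ∀ φ, |S η φ| ≤ M := fun η hη φ =>
    (hS η hη φ).trans (mul_le_of_le_one_right hM (Real.exp_le_one_iff.2 (by nlinarith)))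
  have havg : ∀ η, 0 ≤ η → |avg f η| ≤ B := fun η hη => abs_le.2
    ⟨le_avg (hf.int η hη) fun φ => (abs_le.1 (hB η hη φ)).1,
      avg_le (hf.int η hη) fun φ => (abs_le.1 (hB η hη φ)).2⟩
  have hGm : Measurable fun p : ℝ × ℝ => avg f p.1 - f p.1 p.2 + S p.1 p.2 :=
    (((measurable_avg hfm).comp measurable_fst).sub hfm).add hSm
  have hSi : ∀ η, 0 ≤ η → IntervalIntegrable (S η) volume (-π) π := fun η hη =>
    intervalIntegrable_of_bounded (measurable_section hSm η) (by linarith)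
      fun φ _ => hSM η hη φ
  have hfs : ∀ η, 0 ≤ η → IntervalIntegrable (fun φ => f η φ * sin φ) volume (-π) π :=
    fun η hη => (hf.int η hη).mul_continuousOn Real.continuous_sin.continuousOn
  have hle : -π ≤ π := by linarith
  -- The collision term has zero angular mean, so only the source contributes to the balance.
  have hmass : ∀ η, 0 ≤ η → ∫ φ in (-π)..π, (avg f η - f η φ + S η φ) = ∫ φ in (-π)..π, S η φ :=
    fun η hη => by
      rw [intervalIntegral.integral_add (intervalIntegrable_const.sub (hf.int η hη)) (hSi η hη),
        intervalIntegral.integral_sub intervalIntegrable_const (hf.int η hη),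
        intervalIntegral.integral_const, smul_eq_mul, avg]
      field_simp
      ring
  have hid : ∀ R, 0 < R → maxEnergy F R * (∫ φ in (-π)..π, f R φ * sin φ) -
      ∫ φ in (-π)..π, f 0 φ * sin φ =
      ∫ η in (0 : ℝ)..R, ∫ φ in (-π)..π, maxEnergy F η * S η φ := fun R hR => by
    have h := (green_strip hF hγ hf.transport hper hGm hR
      (integrable_strip_of_bounded (f := fun η φ => avg f η - f η φ + S η φ) hGm (B := B + B + M) fun η hη φ => by
        have := abs_add_le (avg f η - f η φ) (S η φ)
        have := abs_sub (avg f η) (f η φ)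
        linarith [hSM η hη φ, hB η hη φ, havg η hη])
      ((intervalIntegrable_iff_integrableOn_Ioc_of_le hle).1 (hfs R hR.le))).2
    rw [(integral_oddPart_mul_sin
      ((intervalIntegrable_iff_integrableOn_Ioc_of_le hle).1 (hfs 0 le_rfl))).2] at h
    rw [h, intervalIntegral.integral_of_le hR.le, ← integral_Icc_eq_integral_Ioc]
    refine setIntegral_congr_fun measurableSet_Icc fun η hη => ?_
    rw [hmass η hη.1, intervalIntegral.integral_const_mul]
  have hexp : ∀ a : ℝ, 0 < a → Tendsto (fun R : ℝ => exp (-(a * R))) atTop (𝓝 0) := fun a ha =>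
    Real.tendsto_exp_neg_atTop_nhds_zero.comp (tendsto_id.const_mul_atTop ha)
  have hlim1 : Tendsto (fun R => maxEnergy F R * (∫ φ in (-π)..π, f R φ * sin φ)) atTop (𝓝 0) := by
    have hb : ∀ᶠ R in atTop, ‖maxEnergy F R * (∫ φ in (-π)..π, f R φ * sin φ)‖ ≤
        (D * |π - -π|) * exp (-(κ * R)) := by
      filter_upwards [eventually_ge_atTop (0 : ℝ)] with R hR
      -- A constant carries no flux, hence the flux at level `R` is controlled by `f - fInf`.
      have h1 : ∫ φ in (-π)..π, f R φ * sin φ = ∫ φ in (-π)..π, (f R φ - fInf) * sin φ := by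
        have : ∀ φ, (f R φ - fInf) * sin φ = f R φ * sin φ - fInf * sin φ := fun φ => by ring
        simp only [this]
        rw [intervalIntegral.integral_sub (hfs R hR)
          (Continuous.intervalIntegrable (by fun_prop) _ _)]
        simp
      have h2 : ‖∫ φ in (-π)..π, (f R φ - fInf) * sin φ‖ ≤ D * exp (-(κ * R)) * |π - -π| := by
        refine intervalIntegral.norm_integral_le_of_norm_le_const fun φ _ => ?_
        rw [norm_mul]
        exact (mul_le_of_le_one_right (norm_nonneg _) (Real.abs_sin_le_one φ)).trans (hD R hR φ)
      rw [h1, norm_mul, Real.norm_eq_abs (maxEnergy F R), abs_of_pos (maxEnergy_pos F R)]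
      calc _ ≤ 1 * ‖∫ φ in (-π)..π, (f R φ - fInf) * sin φ‖ :=
            mul_le_mul_of_nonneg_right (hF.maxEnergy_le_one hR) (norm_nonneg _)
        _ ≤ _ := by rw [one_mul]; linarith
    refine squeeze_zero_norm' hb ?_
    simpa using (hexp κ hκ).const_mul (D * |π - -π|)
  have hmeas : Measurable fun η => ∫ φ in (-π)..π, maxEnergy F η * S η φ := by
    have : Measurable fun p : ℝ × ℝ => maxEnergy F p.1 * S p.1 p.2 :=
      (hF.continuous_maxEnergy.measurable.comp measurable_fst).mul hSm
    have h2 := (measurable_avg (f := fun η φ => maxEnergy F η * S η φ) this).const_mul (2 * π)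
    convert h2 using 2 with η
    simp only [avg]
    field_simp
  have hint : IntegrableOn (fun η => ∫ φ in (-π)..π, maxEnergy F η * S η φ) (Ioi 0) := by
    have hdom : IntegrableOn (fun η => (M * |π - -π|) * exp (-k * η)) (Ioi 0) :=
      (integrableOn_exp_mul_Ioi (by linarith : -k < 0) 0).const_mul _
    refine hdom.mono' hmeas.aestronglyMeasurable ?_
    filter_upwards [ae_restrict_mem measurableSet_Ioi] with η hη
    have h2 : ‖∫ φ in (-π)..π, maxEnergy F η * S η φ‖ ≤ M * exp (-(k * η)) * |π - -π| := by
      refine intervalIntegral.norm_integral_le_of_norm_le_const fun φ _ => ?_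
      rw [norm_mul, Real.norm_eq_abs, abs_of_pos (maxEnergy_pos F η)]
      calc _ ≤ 1 * ‖S η φ‖ :=
            mul_le_mul_of_nonneg_right (hF.maxEnergy_le_one (le_of_lt hη)) (norm_nonneg _)
        _ ≤ _ := by rw [one_mul]; exact hS η (le_of_lt hη) φ
    rw [neg_mul]
    linarith
  have hlim2 := intervalIntegral_tendsto_integral_Ioi 0 hint tendsto_id
  have hlim3 := (hlim1.sub_const (∫ φ in (-π)..π, f 0 φ * sin φ)).congr'
    ((eventually_gt_atTop (0 : ℝ)).mono hid)
  rw [integral_Ici_eq_integral_Ioi, ← tendsto_nhds_unique hlim3 hlim2]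
  ring

end Flux

/-! ### Weighted energy and uniqueness in `L²`. -/

/-- A positive weight that is a strict supersolution of the adjoint equation. -/
def weight (η φ : ℝ) : ℝ := 14 - barrier (1 / 2) η (-φ)

/-- The transport derivative of `weight`. -/
def weightDeriv (F : ℝ → ℝ) (η φ : ℝ) : ℝ :=
  avg (barrier (1 / 2)) η - barrier (1 / 2) η (-φ) + barrierSource F (1 / 2) η (-φ)

/-- `13` is `angBound (1 / 2)`, and it makes `weight ≥ 1` in the half space. -/
lemma barrier_half_bounds (η φ : ℝ) :
    0 ≤ barrier (1 / 2) η φ ∧ barrier (1 / 2) η φ ≤ 13 * exp (-(1 / 2 * η)) := by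
  obtain ⟨h1, h2⟩ := ang_bounds (k := 1 / 2) (by norm_num) le_rfl φ
  have he := exp_pos (-(1 / 2 * η))
  refine ⟨mul_nonneg he.le h1, ?_⟩
  rw [barrier, mul_comm]
  refine mul_le_mul_of_nonneg_right (h2.trans (by norm_num)) he.le

lemma exp_neg_half_le {η : ℝ} (hη : 0 ≤ η) : exp (-(1 / 2 * η)) ≤ 1 :=
  Real.exp_le_one_iff.2 (by linarith)

lemma weight_bounds {η : ℝ} (hη : 0 ≤ η) (φ : ℝ) : 1 ≤ weight η φ ∧ weight η φ ≤ 14 := by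
  obtain ⟨h1, h2⟩ := barrier_half_bounds η (-φ)
  have := exp_neg_half_le hη
  unfold weight
  constructor <;> linarith

lemma avg_barrier_half (η : ℝ) : avg (barrier (1 / 2)) η = 8 * exp (-(1 / 2 * η)) := by
  have := avg_mul_ang (fun η => exp (-(1 / 2 * η))) (1 / 2) η
  rw [show avg (barrier (1 / 2)) η = avg (fun η φ => exp (-(1 / 2 * η)) * ang (1 / 2) φ) η
    from rfl, this]
  ring

lemma continuous_weight (η : ℝ) : Continuous (weight η) := by
  have := continuous_ang (1 / 2)
  unfold weight barrier
  fun_prop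

lemma integral_weight (η : ℝ) :
    ∫ φ in (-π)..π, weight η φ = 2 * π * (14 - 8 * exp (-(1 / 2 * η))) := by
  have hpi := pi_pos
  have h1 := avg_barrier_half η
  rw [avg] at h1
  have hc : Continuous (barrier (1 / 2) η) := by
    have := continuous_ang (1 / 2)
    unfold barrier; fun_prop
  have h2 : ∫ φ in (-π)..π, barrier (1 / 2) η (-φ) = ∫ φ in (-π)..π, barrier (1 / 2) η φ := by
    rw [intervalIntegral.integral_comp_neg (fun φ => barrier (1 / 2) η φ), neg_neg]
  have h3 : ∫ φ in (-π)..π, barrier (1 / 2) η φ = 2 * π * (8 * exp (-(1 / 2 * η))) := by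
    rw [← h1]; field_simp
  have hi : IntervalIntegrable (fun φ => barrier (1 / 2) η (-φ)) volume (-π) π :=
    (hc.comp continuous_neg).intervalIntegrable _ _
  unfold weight
  rw [intervalIntegral.integral_sub intervalIntegrable_const hi, h2, h3, intervalIntegral.integral_const,
    smul_eq_mul]
  ring

variable {F : ℝ → ℝ} {γ : ℝ → ℝ × ℝ → ℝ × ℝ}

lemma hasTransport_weight (hF : Admissible F) : HasTransport F weight (weightDeriv F) := by
  have h := (isSol_barrier hF (k := 1 / 2) (by norm_num)).transport.reflect
  have h2 := (HasTransport.const F 14).add (h.const_mul (-1))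
  have e1 : (fun η φ => 14 + -1 * barrier (1 / 2) η (-φ)) = weight := by
    funext η φ; simp only [weight]; ring
  rw [e1] at h2
  refine h2.congr_right fun η _ φ => ?_
  simp only [weightDeriv]; ring

/-- `61 = 8 + 13 + 40`, from the average, the barrier and its source. Its role is to ensure
integrability of `energyRate`. -/
lemma abs_weightDeriv_le (hF : Admissible F) {η : ℝ} (hη : 0 ≤ η) (φ : ℝ) :
    |weightDeriv F η φ| ≤ 61 := by
  obtain ⟨h1, h2⟩ := barrier_half_bounds η (-φ)
  have he := exp_neg_half_le hη
  have he0 := exp_pos (-(1 / 2 * η))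
  have hb : |barrierSource F (1 / 2) η (-φ)| ≤ 40 := by
    unfold barrierSource
    have hs := Real.abs_sin_le_one (-φ)
    have hc2 := Real.abs_cos_le_one (2 * -φ)
    have hc : cos (-φ) ^ 2 ≤ 1 := Real.cos_sq_le_one _
    have hF4 := hF.abs_apply_le η
    rw [abs_neg, abs_mul, abs_of_pos he0]
    have p1 : |1 / 2 * sin (-φ) * cos (2 * -φ)| ≤ 1 := by
      rw [abs_mul, abs_mul]
      have : |sin (-φ)| * |cos (2 * -φ)| ≤ 1 := mul_le_one₀ hs (abs_nonneg _) hc2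
      rw [abs_of_pos (by norm_num : (0 : ℝ) < 1 / 2)]
      linarith
    have p2 : |F η * cos (-φ) ^ 2 * (2 / (1 / 2) + 4 * sin (-φ))| ≤ 32 := by
      rw [abs_mul, abs_mul, abs_of_nonneg (sq_nonneg (cos (-φ)))]
      have q1 : |F η| * cos (-φ) ^ 2 ≤ 4 * 1 := mul_le_mul hF4 hc (sq_nonneg _) (by norm_num)
      have q2 : |2 / (1 / 2) + 4 * sin (-φ)| ≤ 8 := by
        rw [abs_le] at hs ⊢; constructor <;> linarith [hs.1, hs.2]
      calc _ ≤ 4 * 1 * 8 := mul_le_mul q1 q2 (abs_nonneg _) (by norm_num)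
        _ = _ := by norm_num
    have p3 : |1 - 1 / 2 * sin (-φ) * cos (2 * -φ) -
        F η * cos (-φ) ^ 2 * (2 / (1 / 2) + 4 * sin (-φ))| ≤ 40 := by
      rw [abs_le] at p1 p2 ⊢; constructor <;> linarith [p1.1, p1.2, p2.1, p2.2]
    calc _ ≤ 1 * 40 := mul_le_mul he p3 (abs_nonneg _) zero_le_one
      _ = _ := one_mul _
  rw [weightDeriv, avg_barrier_half]
  rw [abs_le] at hb ⊢
  constructor <;> linarith [hb.1, hb.2]

lemma measurable_weightDeriv (hF : Admissible F) :
    Measurable fun p : ℝ × ℝ => weightDeriv F p.1 p.2 := by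
  have h1 := hF.continuous
  have h2 := continuous_ang (1 / 2)
  simp only [weightDeriv, avg_barrier_half]
  unfold barrier barrierSource
  exact Continuous.measurable (by fun_prop)

lemma integrable_of_sub_sq {α : Type*} [MeasurableSpace α] {μ : Measure α} [IsFiniteMeasure μ]
    {g : α → ℝ} (hg : Measurable g) {c : ℝ} (h : Integrable (fun x => (g x - c) ^ 2) μ) :
    Integrable g μ ∧ Integrable (fun x => g x ^ 2) μ := by
  have h2 : Integrable (fun x => g x ^ 2) μ := by
    refine ((h.const_mul 2).add (integrable_const (2 * c ^ 2))).mono'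
      (hg.pow_const 2).aestronglyMeasurable (ae_of_all _ fun x => ?_)
    simp only [Pi.add_apply]
    rw [Real.norm_eq_abs, abs_of_nonneg (sq_nonneg _)]
    nlinarith [sq_nonneg (g x - 2 * c)]
  refine ⟨(h2.add (integrable_const 1)).mono' hg.aestronglyMeasurable (ae_of_all _ fun x => ?_), h2⟩
  simp only [Pi.add_apply]
  rw [Real.norm_eq_abs, abs_le]
  constructor <;> nlinarith [sq_nonneg (g x - 1), sq_nonneg (g x + 1)]

/-- Nonnegativity of the angular variance. -/
lemma sq_avg_le {d : ℝ → ℝ → ℝ} {η : ℝ} (h1 : IntegrableOn (d η) (Ioc (-π) π))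
    (h2 : IntegrableOn (fun φ => d η φ ^ 2) (Ioc (-π) π)) :
    2 * π * avg d η ^ 2 ≤ ∫ φ in (-π)..π, d η φ ^ 2 := by
  have hpi := pi_pos
  have hle : -π ≤ π := by linarith
  rw [← intervalIntegrable_iff_integrableOn_Ioc_of_le hle] at h1 h2
  have hm : ∫ φ in (-π)..π, d η φ = 2 * π * avg d η := by rw [avg]; field_simp
  have h0 : 0 ≤ ∫ φ in (-π)..π, (d η φ - avg d η) ^ 2 :=
    intervalIntegral.integral_nonneg hle fun φ _ => sq_nonneg _
  have he : ∀ φ, (d η φ - avg d η) ^ 2 = d η φ ^ 2 - 2 * avg d η * d η φ + avg d η ^ 2 :=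
    fun φ => by ring
  simp only [he] at h0
  rw [intervalIntegral.integral_add (h2.sub (h1.const_mul _)) intervalIntegrable_const,
    intervalIntegral.integral_sub h2 (h1.const_mul _), intervalIntegral.integral_const_mul, hm,
    intervalIntegral.integral_const, smul_eq_mul] at h0
  linarith

/-- The transport derivative of `d² * weight`, for a solution `d` with average `D`. -/
def energyRate (F : ℝ → ℝ) (D : ℝ → ℝ) (d : ℝ → ℝ → ℝ) (η φ : ℝ) : ℝ :=
  2 * d η φ * (D η - d η φ) * weight η φ + d η φ ^ 2 * weightDeriv F η φ

lemma hasTransport_energyRate (hF : Admissible F) {D : ℝ → ℝ} {d : ℝ → ℝ → ℝ}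
    (hd : HasTransport F d fun η φ => D η - d η φ) :
    HasTransport F (fun η φ => d η φ ^ 2 * weight η φ) (energyRate F D d) := by
  have h := (hd.mul hd).mul (hasTransport_weight hF)
  have e : (fun η φ => d η φ * d η φ * weight η φ) = fun η φ => d η φ ^ 2 * weight η φ := by
    funext η φ; ring
  rw [e] at h
  exact h.congr_right fun η _ φ => by simp only [energyRate]; ring

lemma abs_energyRate_le (hF : Admissible F) (D : ℝ → ℝ) (d : ℝ → ℝ → ℝ) {η : ℝ} (hη : 0 ≤ η)
    (φ : ℝ) : |energyRate F D d η φ| ≤ 14 * D η ^ 2 + 103 * d η φ ^ 2 := by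
  obtain ⟨h1, h2⟩ := weight_bounds hη φ
  have h3 := abs_weightDeriv_le hF hη φ
  have p1 : |2 * d η φ * (D η - d η φ) * weight η φ| ≤ (D η ^ 2 + 3 * d η φ ^ 2) * 14 := by
    rw [abs_mul, abs_of_pos (by linarith : 0 < weight η φ)]
    refine mul_le_mul ?_ h2 (by linarith) (by positivity)
    rw [abs_le]
    constructor <;> nlinarith [sq_nonneg (D η - d η φ), sq_nonneg (D η + d η φ)]
  have p2 : |d η φ ^ 2 * weightDeriv F η φ| ≤ d η φ ^ 2 * 61 := by
    rw [abs_mul, abs_of_nonneg (sq_nonneg (d η φ))]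
    exact mul_le_mul_of_nonneg_left h3 (sq_nonneg _)
  have := abs_add_le (2 * d η φ * (D η - d η φ) * weight η φ) (d η φ ^ 2 * weightDeriv F η φ)
  unfold energyRate
  linarith

/-- The weighted energy is dissipated at every level. -/
lemma integral_energyRate_le (hF : Admissible F) {D : ℝ → ℝ} {d : ℝ → ℝ → ℝ}
    (hdm : Measurable fun p : ℝ × ℝ => d p.1 p.2) {η : ℝ}
    (hη : 0 ≤ η) (hD : D η = avg d η) (h1 : IntegrableOn (d η) (Ioc (-π) π))
    (h2 : IntegrableOn (fun φ => d η φ ^ 2) (Ioc (-π) π)) :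
    IntegrableOn (energyRate F D d η) (Ioc (-π) π) ∧
    ∫ φ in (-π)..π, energyRate F D d η φ ≤
      -(1 / 2 * exp (-(1 / 2 * η))) * ∫ φ in (-π)..π, d η φ ^ 2 := by
  have hpi := pi_pos
  have hle : -π ≤ π := by linarith
  have hw := continuous_weight η
  have hdη := measurable_section hdm η
  have hj := sq_avg_le h1 h2
  have hmeas : Measurable (energyRate F D d η) := by
    unfold energyRate
    exact (((measurable_const.mul hdη).mul (measurable_const.sub hdη)).mul hw.measurable).add
      ((hdη.pow_const 2).mul ((measurable_weightDeriv hF).comp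
        (measurable_const.prodMk measurable_id)))
  have hint : IntegrableOn (energyRate F D d η) (Ioc (-π) π) := by
    refine ((integrable_const (14 * D η ^ 2)).add (h2.const_mul 103)).mono'
      hmeas.aestronglyMeasurable (ae_of_all _ fun φ => ?_)
    exact abs_energyRate_le hF D d hη φ
  refine ⟨hint, ?_⟩
  set e := exp (-(1 / 2 * η)) with he
  have hi2 := (intervalIntegrable_iff_integrableOn_Ioc_of_le hle).2 h2
  -- From `2 * d * (D - d) ≤ D ^ 2 - d ^ 2` the terms `d ^ 2 * weight` cancel. The coefficient `14 -
  -- 8 * e` is the angular mean of `weight`, so the Jensen-type bound `sq_avg_le` cancels it against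
  -- `D ^ 2` after integration and leaves the dissipation `1/2 * e`.
  have hpt : ∀ φ, energyRate F D d η φ ≤
      D η ^ 2 * weight η φ - (14 - 8 * e + 1 / 2 * e) * d η φ ^ 2 := fun φ => by
    have hb := barrierSource_le hF (k := 1 / 2) (by norm_num) le_rfl η (-φ)
    have hw1 := (weight_bounds hη φ).1
    have hT : weightDeriv F η φ ≤ weight η φ - (14 - 8 * e) - 1 / 2 * e := by
      rw [weightDeriv, avg_barrier_half, weight]; linarith
    have := mul_le_mul_of_nonneg_left hT (sq_nonneg (d η φ))
    unfold energyRate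
    nlinarith [mul_nonneg (sq_nonneg (D η - d η φ)) (by linarith : 0 ≤ weight η φ)]
  have hI := intervalIntegral.integral_mono hle
    ((intervalIntegrable_iff_integrableOn_Ioc_of_le hle).2 hint)
    (((hw.intervalIntegrable _ _).const_mul (D η ^ 2)).sub (hi2.const_mul _)) hpt
  rw [intervalIntegral.integral_sub ((hw.intervalIntegrable _ _).const_mul (D η ^ 2))
    (hi2.const_mul _), intervalIntegral.integral_const_mul, intervalIntegral.integral_const_mul,
    integral_weight] at hI
  have he1 := exp_neg_half_le hη
  rw [← hD] at hj
  nlinarith [mul_le_mul_of_nonneg_left hj (by linarith : 0 ≤ 14 - 8 * e)]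

/-- An integrable nonnegative function on a half line has arbitrarily small values arbitrarily far
away, at points with any property that holds almost everywhere. -/
lemma exists_small_far {g : ℝ → ℝ} (hg : IntegrableOn g (Ici 0)) {P : ℝ → Prop}
    (hP : ∀ᵐ η ∂(volume.restrict (Ici (0 : ℝ))), P η) {δ : ℝ} (hδ : 0 < δ) (R₀ : ℝ) :
    ∃ R, 0 < R ∧ R₀ ≤ R ∧ P R ∧ g R ≤ δ := by
  by_contra! hcon
  set R₁ := max R₀ 1
  have hsub : Ici R₁ ⊆ Ici (0 : ℝ) := Ici_subset_Ici.2 (zero_le_one.trans (le_max_right _ _))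
  have hc : IntegrableOn (fun _ : ℝ => δ) (Ici R₁) := by
    refine (hg.mono_set hsub).mono' aestronglyMeasurable_const ?_
    filter_upwards [ae_restrict_of_ae_restrict_of_subset hsub hP,
      ae_restrict_mem measurableSet_Ici] with R hPR hR
    have h1 : R₀ ≤ R := (le_max_left _ _).trans hR
    have h2 : 0 < R := zero_lt_one.trans_le ((le_max_right _ _).trans hR)
    rw [Real.norm_eq_abs, abs_of_pos hδ]
    exact (hcon R h2 h1 hPR).le
  rw [integrableOn_const_iff] at hc
  rcases hc with h | h
  · exact hδ.ne' (enorm_eq_zero.1 h)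
  · simp at h

/-- The flux of `d² * weight` is small where `d` is close to a constant. -/
lemma abs_flux_le {d : ℝ → ℝ → ℝ} (hdm : Measurable fun p : ℝ × ℝ => d p.1 p.2) {c R δ : ℝ}
    (hR : 0 ≤ R) (hδ : 0 < δ) (hi : IntegrableOn (fun φ => (d R φ - c) ^ 2) (Ioc (-π) π))
    (hsmall : ∫ φ in Ioc (-π) π, (d R φ - c) ^ 2 ≤ δ ^ 2) (hexp : exp (-(1 / 2 * R)) ≤ δ) :
    IntegrableOn (fun φ => d R φ ^ 2 * weight R φ * sin φ) (Ioc (-π) π) ∧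
    |∫ φ in (-π)..π, d R φ ^ 2 * weight R φ * sin φ| ≤
      14 * δ ^ 2 + (14 + 2 * π * (27 * c ^ 2)) * δ := by
  have hpi := pi_pos
  have hle : -π ≤ π := by linarith
  have hdR := measurable_section hdm R
  have hw := continuous_weight R
  have hd2 := (integrable_of_sub_sq hdR hi).2
  have hint : IntegrableOn (fun φ => d R φ ^ 2 * weight R φ * sin φ) (Ioc (-π) π) := by
    refine (hd2.const_mul 14).mono' (((hdR.pow_const 2).mul hw.measurable).mul
      Real.measurable_sin).aestronglyMeasurable (ae_of_all _ fun φ => ?_)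
    obtain ⟨h1, h2⟩ := weight_bounds hR φ
    rw [norm_mul, norm_mul, Real.norm_eq_abs, Real.norm_eq_abs, Real.norm_eq_abs,
      abs_of_nonneg (sq_nonneg (d R φ)), abs_of_pos (by linarith : 0 < weight R φ)]
    calc _ ≤ d R φ ^ 2 * 14 * 1 := mul_le_mul
          (mul_le_mul_of_nonneg_left h2 (sq_nonneg _)) (Real.abs_sin_le_one φ) (abs_nonneg _)
          (by positivity)
      _ = _ := by ring
  refine ⟨hint, ?_⟩
  have hint' := (intervalIntegrable_iff_integrableOn_Ioc_of_le hle).2 hint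
  have hi' := (intervalIntegrable_iff_integrableOn_Ioc_of_le hle).2 hi
  have hs : IntervalIntegrable (fun φ => 14 * c ^ 2 * sin φ) volume (-π) π :=
    Continuous.intervalIntegrable (by fun_prop) _ _
  have hz : ∫ φ in (-π)..π, 14 * c ^ 2 * sin φ = 0 := by simp
  -- The limiting flux density `14 * c ^ 2 * sin φ` integrates to zero, so it may be subtracted.
  have he : ∫ φ in (-π)..π, d R φ ^ 2 * weight R φ * sin φ =
      ∫ φ in (-π)..π, (d R φ ^ 2 * weight R φ * sin φ - 14 * c ^ 2 * sin φ) := by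
    rw [intervalIntegral.integral_sub hint' hs, hz, sub_zero]
  rw [he]
  have hpt : ∀ φ, |d R φ ^ 2 * weight R φ * sin φ - 14 * c ^ 2 * sin φ| ≤
      14 * (1 + 1 / δ) * (d R φ - c) ^ 2 + 27 * c ^ 2 * δ := fun φ => by
    obtain ⟨h1, h2⟩ := weight_bounds hR φ
    obtain ⟨h3, h4⟩ := barrier_half_bounds R (-φ)
    have e1 : d R φ ^ 2 * weight R φ * sin φ - 14 * c ^ 2 * sin φ =
        ((d R φ ^ 2 - c ^ 2) * weight R φ - c ^ 2 * barrier (1 / 2) R (-φ)) * sin φ := by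
      rw [weight]; ring
    -- Young's inequality with parameter `δ`; since the integral of `(d - c) ^ 2` is at most `δ ^
    -- 2`, the factor `1 / δ` still leaves a term of order `δ`.
    have e2 : |d R φ ^ 2 - c ^ 2| ≤ (1 + 1 / δ) * (d R φ - c) ^ 2 + δ * c ^ 2 := by
      have e3 : (1 + 1 / δ) * (d R φ - c) ^ 2 + δ * c ^ 2 =
          (d R φ - c) ^ 2 + ((d R φ - c) ^ 2 + (δ * c) ^ 2) / δ := by
        field_simp; ring
      have e4 : 2 * |d R φ - c| * |c| ≤ ((d R φ - c) ^ 2 + (δ * c) ^ 2) / δ := by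
        rw [le_div_iff₀ hδ]
        have := sq_nonneg (|d R φ - c| - δ * |c|)
        rw [← sq_abs (d R φ - c), mul_pow, ← sq_abs c]
        nlinarith
      have e5 : d R φ ^ 2 - c ^ 2 = (d R φ - c) ^ 2 + 2 * (d R φ - c) * c := by ring
      rw [e3, e5]
      refine (abs_add_le _ _).trans ?_
      rw [abs_of_nonneg (sq_nonneg _), abs_mul, abs_mul, abs_two]
      linarith
    rw [e1, abs_mul]
    refine (mul_le_of_le_one_right (abs_nonneg _) (Real.abs_sin_le_one φ)).trans ?_
    refine (abs_sub _ _).trans ?_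
    rw [abs_mul, abs_mul, abs_of_nonneg (sq_nonneg c), abs_of_nonneg h3,
      abs_of_pos (by linarith : 0 < weight R φ)]
    have p1 : |d R φ ^ 2 - c ^ 2| * weight R φ ≤
        ((1 + 1 / δ) * (d R φ - c) ^ 2 + δ * c ^ 2) * 14 :=
      mul_le_mul e2 h2 (by linarith) (by positivity)
    have p2 : c ^ 2 * barrier (1 / 2) R (-φ) ≤ c ^ 2 * (13 * δ) :=
      mul_le_mul_of_nonneg_left (h4.trans (by linarith)) (sq_nonneg c)
    linarith
  refine (intervalIntegral.abs_integral_le_integral_abs hle).trans ?_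
  refine (intervalIntegral.integral_mono hle (hint'.sub hs).abs
    ((hi'.const_mul _).add intervalIntegrable_const) hpt).trans ?_
  rw [intervalIntegral.integral_add (hi'.const_mul _) intervalIntegrable_const,
    intervalIntegral.integral_const_mul, intervalIntegral.integral_const, smul_eq_mul,
    intervalIntegral.integral_of_le hle]
  have q : 14 * (1 + 1 / δ) * ∫ φ in Ioc (-π) π, (d R φ - c) ^ 2 ≤ 14 * (1 + 1 / δ) * δ ^ 2 :=
    mul_le_mul_of_nonneg_left hsmall (by positivity)
  have q2 : 14 * (1 + 1 / δ) * δ ^ 2 = 14 * δ ^ 2 + 14 * δ := by field_simp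
  linarith

variable {F : ℝ → ℝ} {γ : ℝ → ℝ × ℝ → ℝ × ℝ}

/-- Uniqueness, up to null sets, in the class of solutions whose deviation from a constant is
square integrable. -/
theorem ae_eq_zero_of_sq_integrable (hF : Admissible F) (hγ : IsFlow F γ) {D : ℝ → ℝ}
    {d : ℝ → ℝ → ℝ} {c : ℝ} (hd : HasTransport F d fun η φ => D η - d η φ)
    (hdm : Measurable fun p : ℝ × ℝ => d p.1 p.2) (hDm : Measurable D)
    (hper : ∀ η φ, d η (φ + 2 * π) = d η φ)
    (hD : ∀ᵐ η ∂(volume.restrict (Ici (0 : ℝ))), D η = avg d η)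
    (hL : Integrable (fun p : ℝ × ℝ => (d p.1 p.2 - c) ^ 2)
      ((volume.restrict (Ici 0)).prod (volume.restrict (Ioc (-π) π))))
    (h0 : ∀ φ ∈ Ioo 0 π, d 0 φ = 0) :
    (∀ᵐ p ∂((volume.restrict (Ici (0 : ℝ))).prod (volume.restrict (Ioc (-π) π))),
      d p.1 p.2 = 0) ∧ ∀ᵐ φ ∂(volume.restrict (Ioo (-π) 0)), d 0 φ = 0 := by
  have hpi := pi_pos
  have hle : -π ≤ π := by linarith
  set E : ℝ → ℝ := fun η => ∫ φ in (-π)..π, d η φ ^ 2 with hE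
  have hE0 : ∀ η, 0 ≤ E η := fun η =>
    intervalIntegral.integral_nonneg hle fun φ _ => sq_nonneg _
  have hgood : ∀ᵐ η ∂(volume.restrict (Ici (0 : ℝ))),
      IntegrableOn (fun φ => (d η φ - c) ^ 2) (Ioc (-π) π) ∧ D η = avg d η :=
    hL.prod_right_ae.and hD
  have hstrip : ∀ R, strip R ≤ (volume.restrict (Ici 0)).prod (volume.restrict (Ioc (-π) π)) :=
    fun R => by
      unfold strip
      rw [Measure.prod_restrict, Measure.prod_restrict]
      exact Measure.restrict_mono (prod_mono_left Icc_subset_Ici_self) le_rfl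
  have hfin : ∀ R, IsFiniteMeasure (strip R) := fun R => by unfold strip; infer_instance
  have hd2 : ∀ R, Integrable (fun p : ℝ × ℝ => d p.1 p.2 ^ 2) (strip R) := fun R =>
    have := hfin R
    (integrable_of_sub_sq hdm (hL.mono_measure (hstrip R))).2
  have hEi : ∀ R, IntegrableOn E (Icc 0 R) := fun R => by
    have := (hd2 R).integral_prod_left
    simp only [hE, intervalIntegral.integral_of_le hle]
    exact this
  have hDi : ∀ R, Integrable (fun p : ℝ × ℝ => D p.1 ^ 2) (strip R) := fun R => by
    have h1 : IntegrableOn (fun η => D η ^ 2) (Icc 0 R) := by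
      refine ((hEi R).const_mul (1 / (2 * π))).mono' (hDm.pow_const 2).aestronglyMeasurable ?_
      filter_upwards [ae_restrict_of_ae_restrict_of_subset Icc_subset_Ici_self hgood]
        with η ⟨hη, hDη⟩
      obtain ⟨i1, i2⟩ := integrable_of_sub_sq (measurable_section hdm η) hη
      have := sq_avg_le i1 i2
      rw [Real.norm_eq_abs, abs_of_nonneg (sq_nonneg _), hDη, one_div_mul_eq_div,
        le_div_iff₀ (by positivity)]
      linarith
    exact Integrable.comp_fst h1 _
  have hGm : Measurable fun p : ℝ × ℝ => energyRate F D d p.1 p.2 := by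
    have hw : Measurable fun p : ℝ × ℝ => weight p.1 p.2 := by
      have := continuous_ang (1 / 2)
      unfold weight barrier
      exact Continuous.measurable (by fun_prop)
    have hD1 : Measurable fun p : ℝ × ℝ => D p.1 := hDm.comp measurable_fst
    unfold energyRate
    exact (((measurable_const.mul hdm).mul (hD1.sub hdm)).mul hw).add
      ((hdm.pow_const 2).mul (measurable_weightDeriv hF))
  have hGi : ∀ R, Integrable (fun p : ℝ × ℝ => energyRate F D d p.1 p.2) (strip R) := fun R => by
    refine (((hDi R).const_mul 14).add ((hd2 R).const_mul 103)).mono' hGm.aestronglyMeasurable ?_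
    rw [strip, Measure.prod_restrict]
    filter_upwards [ae_restrict_mem (measurableSet_Icc.prod measurableSet_Ioc)] with p hp
    exact abs_energyRate_le hF D d hp.1.1 _
  have huper : ∀ η φ, d η (φ + 2 * π) ^ 2 * weight η (φ + 2 * π) = d η φ ^ 2 * weight η φ :=
    fun η φ => by
      have : weight η (φ + 2 * π) = weight η φ := by
        simp only [weight, barrier, ang]
        rw [show -(φ + 2 * π) = -φ - 2 * π by ring, Real.sin_sub_two_pi,
          show 2 * (-φ - 2 * π) = 2 * -φ - 2 * π - 2 * π by ring, Real.cos_sub_two_pi,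
          Real.cos_sub_two_pi]
      rw [hper, this]
  set κ : ℝ → ℝ := fun η => maxEnergy F η * (1 / 2 * exp (-(1 / 2 * η))) with hκ
  have hκ0 : ∀ η, 0 < κ η := fun η => mul_pos (maxEnergy_pos F η) (by positivity)
  have hκc : Continuous κ := by
    have := hF.continuous_maxEnergy
    fun_prop
  have hκi : ∀ R, IntegrableOn (fun η => κ η * E η) (Icc 0 R) := fun R => by
    refine Integrable.bdd_mul (c := 1) (hEi R) hκc.aestronglyMeasurable ?_
    filter_upwards [ae_restrict_mem measurableSet_Icc] with η hη
    rw [Real.norm_eq_abs, abs_of_pos (hκ0 η)]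
    exact mul_le_one₀ (hF.maxEnergy_le_one hη.1) (by positivity)
      (by linarith [exp_neg_half_le hη.1])
  -- The outgoing weighted flux at the wall. As `d` vanishes on incoming directions, this is the
  -- entire boundary term, and it is nonnegative.
  set J : ℝ := ∫ φ in Ioo 0 π, d 0 (-φ) ^ 2 * weight 0 (-φ) * sin φ with hJ
  have hodd : EqOn (fun φ => -(oddPart (fun η φ => d η φ ^ 2 * weight η φ) 0 φ * sin φ))
      (fun φ => d 0 (-φ) ^ 2 * weight 0 (-φ) * sin φ) (Ioo 0 π) := fun φ hφ => by
    simp only [oddPart]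
    rw [h0 φ hφ]; ring
  -- Dissipation up to level `R` plus outgoing flux is paid for by the flux at `R` alone.
  have hbal : ∀ R, 0 < R → IntegrableOn (fun φ => d R φ ^ 2 * weight R φ * sin φ) (Ioc (-π) π) →
      IntegrableOn (fun φ => d 0 (-φ) ^ 2 * weight 0 (-φ) * sin φ) (Ioo 0 π) ∧
      (∫ η in Icc 0 R, κ η * E η) + J ≤ |∫ φ in (-π)..π, d R φ ^ 2 * weight R φ * sin φ| := by
    intro R hR hint
    obtain ⟨i0, e0⟩ := green_strip hF hγ (hasTransport_energyRate hF hd) huper hGm hR (hGi R) hint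
    have i0' := i0.neg.congr_fun hodd measurableSet_Ioo
    refine ⟨i0', ?_⟩
    have eJ : J = -∫ φ in Ioo 0 π, oddPart (fun η φ => d η φ ^ 2 * weight η φ) 0 φ * sin φ := by
      rw [hJ, ← setIntegral_congr_fun measurableSet_Ioo hodd, integral_neg]
    have hrate : ∫ η in Icc 0 R, maxEnergy F η * ∫ φ in (-π)..π, energyRate F D d η φ ≤
        -∫ η in Icc 0 R, κ η * E η := by
      rw [← integral_neg]
      have hi : IntegrableOn (fun η => maxEnergy F η * ∫ φ in (-π)..π, energyRate F D d η φ)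
          (Icc 0 R) := by
        have h1 := (hGi R).integral_prod_left
        simp only [← intervalIntegral.integral_of_le hle] at h1
        refine Integrable.bdd_mul (c := 1) h1 hF.continuous_maxEnergy.aestronglyMeasurable ?_
        filter_upwards [ae_restrict_mem measurableSet_Icc] with η hη
        rw [Real.norm_eq_abs, abs_of_pos (maxEnergy_pos F η)]
        exact hF.maxEnergy_le_one hη.1
      refine integral_mono_ae hi (hκi R).neg ?_
      filter_upwards [ae_restrict_of_ae_restrict_of_subset Icc_subset_Ici_self hgood,
        ae_restrict_mem measurableSet_Icc] with η ⟨hη, hDη⟩ hηR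
      obtain ⟨i1, i2⟩ := integrable_of_sub_sq (measurable_section hdm η) hη
      have := mul_le_mul_of_nonneg_left (integral_energyRate_le hF hdm hηR.1 hDη i1 i2).2
        (maxEnergy_pos F η).le
      simp only [hκ, hE]
      linarith
    have hflux : -|∫ φ in (-π)..π, d R φ ^ 2 * weight R φ * sin φ| ≤
        maxEnergy F R * ∫ φ in (-π)..π, d R φ ^ 2 * weight R φ * sin φ := by
      have h1 := neg_abs_le (maxEnergy F R * ∫ φ in (-π)..π, d R φ ^ 2 * weight R φ * sin φ)
      rw [abs_mul, abs_of_pos (maxEnergy_pos F R)] at h1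
      have := mul_le_mul_of_nonneg_right (hF.maxEnergy_le_one hR.le)
        (abs_nonneg (∫ φ in (-π)..π, d R φ ^ 2 * weight R φ * sin φ))
      linarith
    linarith
  -- Square integrability supplies levels arbitrarily far out where `d` is close to `c` in the
  -- angular mean square, so the flux there is small.
  have hfar : ∀ δ, 0 < δ → ∀ R₀, ∃ R, 0 < R ∧ R₀ ≤ R ∧
      IntegrableOn (fun φ => d R φ ^ 2 * weight R φ * sin φ) (Ioc (-π) π) ∧
      |∫ φ in (-π)..π, d R φ ^ 2 * weight R φ * sin φ| ≤
        14 * δ ^ 2 + (14 + 2 * π * (27 * c ^ 2)) * δ := fun δ hδ R₀ => by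
    obtain ⟨R, hR, hR₀, ⟨hg, -⟩, hs⟩ := exists_small_far hL.integral_prod_left hgood
      (by positivity : 0 < δ ^ 2) (max R₀ (-(2 * log δ)))
    have hexp : exp (-(1 / 2 * R)) ≤ δ := by
      rw [← Real.le_log_iff_exp_le hδ]
      linarith [(le_max_right _ _).trans hR₀]
    exact ⟨R, hR, (le_max_left _ _).trans hR₀, abs_flux_le hdm hR.le hδ hg hs hexp⟩
  have hJ0 : 0 ≤ J := setIntegral_nonneg measurableSet_Ioo fun φ hφ => by
    have := (weight_bounds le_rfl (-φ)).1
    have := Real.sin_pos_of_pos_of_lt_pi hφ.1 hφ.2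
    positivity
  have hI0 : ∀ R, 0 ≤ ∫ η in Icc 0 R, κ η * E η := fun R =>
    setIntegral_nonneg measurableSet_Icc fun η _ => mul_nonneg (hκ0 η).le (hE0 η)
  have hzero : ∀ R₀, (∫ η in Icc 0 R₀, κ η * E η) + J ≤ 0 := fun R₀ => by
    have hlim : Tendsto (fun δ : ℝ => 14 * δ ^ 2 + (14 + 2 * π * (27 * c ^ 2)) * δ) (𝓝[>] 0)
        (𝓝 0) := by
      have : Continuous fun δ : ℝ => 14 * δ ^ 2 + (14 + 2 * π * (27 * c ^ 2)) * δ := by fun_prop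
      simpa using (this.tendsto 0).mono_left nhdsWithin_le_nhds
    refine ge_of_tendsto hlim ?_
    filter_upwards [self_mem_nhdsWithin] with δ hδ
    obtain ⟨R, hR, hR₀, hint, hb⟩ := hfar δ hδ R₀
    refine le_trans ?_ ((hbal R hR hint).2.trans hb)
    have := setIntegral_mono_set (hκi R)
      (ae_of_all _ fun η => mul_nonneg (hκ0 η).le (hE0 η))
      (Icc_subset_Icc_right hR₀ : Icc 0 R₀ ⊆ Icc 0 R).eventuallyLE
    linarith
  constructor
  · have hE_ae : ∀ᵐ η ∂(volume.restrict (Ici (0 : ℝ))), E η = 0 := by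
      have h1 : ∀ n : ℕ, ∀ᵐ η ∂(volume.restrict (Icc (0 : ℝ) n)), E η = 0 := fun n => by
        have h2 : ∫ η in Icc 0 (n : ℝ), κ η * E η = 0 :=
          le_antisymm (by linarith [hzero n]) (hI0 n)
        have h3 := (integral_eq_zero_iff_of_nonneg
          (fun η => mul_nonneg (hκ0 η).le (hE0 η)) (hκi n)).1 h2
        filter_upwards [h3] with η h
        exact (mul_eq_zero.1 h).resolve_left (hκ0 η).ne'
      have h4 : Ici (0 : ℝ) = ⋃ n : ℕ, Icc (0 : ℝ) n := by
        ext x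
        simp only [mem_Ici, mem_iUnion, mem_Icc]
        exact ⟨fun hx => (exists_nat_ge x).imp fun n hn => ⟨hx, hn⟩, fun ⟨n, hn⟩ => hn.1⟩
      rw [h4, ae_restrict_iUnion_iff]
      exact h1
    rw [Measure.ae_prod_iff_ae_ae (measurableSet_eq_fun hdm measurable_const)]
    filter_upwards [hE_ae, hgood] with η hη ⟨hg, _⟩
    have i2 := (integrable_of_sub_sq (measurable_section hdm η) hg).2
    simp only [hE, intervalIntegral.integral_of_le hle] at hη
    have := (integral_eq_zero_iff_of_nonneg (fun φ => sq_nonneg (d η φ)) i2).1 hη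
    filter_upwards [this] with φ h
    exact pow_eq_zero_iff two_ne_zero |>.1 h
  · obtain ⟨R, hR, -, hint, -⟩ := hfar 1 one_pos 0
    have h1 : J = 0 := le_antisymm (by linarith [hzero 0, hI0 0]) hJ0
    have h2 := (setIntegral_eq_zero_iff_of_nonneg_ae (by
      filter_upwards [ae_restrict_mem measurableSet_Ioo] with φ hφ
      have := (weight_bounds le_rfl (-φ)).1
      have := Real.sin_pos_of_pos_of_lt_pi hφ.1 hφ.2
      simp only [Pi.zero_apply]
      positivity) (hbal R hR hint).1).1 h1
    have h3 : ∀ᵐ φ ∂(volume.restrict (Ioo 0 π)), d 0 (-φ) = 0 := by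
      filter_upwards [h2, ae_restrict_mem measurableSet_Ioo] with φ h hφ
      have hw := (weight_bounds le_rfl (-φ)).1
      have hs := Real.sin_pos_of_pos_of_lt_pi hφ.1 hφ.2
      simp only [Pi.zero_apply] at h
      have h4 := (mul_eq_zero.1 h).resolve_right hs.ne'
      have h5 := (mul_eq_zero.1 h4).resolve_right (by linarith)
      exact pow_eq_zero_iff two_ne_zero |>.1 h5
    rw [← measurePreserving_neg_half.map_eq, ae_map_iff measurable_neg.aemeasurable
      (measurableSet_eq_fun (measurable_section hdm 0) measurable_const)]
    exact h3

/-! ### Passing between forces, boundary conditions and notions of solution. -/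

section Congruence

variable {F F' : ℝ → ℝ} {h : ℝ → ℝ} {S f g : ℝ → ℝ → ℝ} {fInf gInf M K : ℝ}

lemma IsCharacteristic.congr_force (hF : ∀ η, 0 ≤ η → F η = F' η) {a b : ℝ} {X Φ : ℝ → ℝ}
    (hX : IsCharacteristic F a b X Φ) : IsCharacteristic F' a b X Φ := fun t ht => by
  obtain ⟨h0, h1, h2⟩ := hX t ht
  exact ⟨h0, h1, hF _ h0 ▸ h2⟩

lemma IsTransportSolution.congr_force (hF : ∀ η, 0 ≤ η → F η = F' η)
    (hf : IsTransportSolution F S f) : IsTransportSolution F' S f :=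
  ⟨hf.measurable, hf.periodic, hf.integrable, fun a b X Φ hab hX =>
    hf.along a b X Φ hab (hX.congr_force fun η hη => (hF η hη).symm)⟩

lemma IsInflowSolution.congr_force (hF : ∀ η, 0 ≤ η → F η = F' η)
    (hf : IsInflowSolution F h S f fInf) : IsInflowSolution F' h S f fInf :=
  ⟨hf.transport.congr_force hF, hf.boundary, hf.limit⟩

lemma IsDiffusiveSolution.congr_force (hF : ∀ η, 0 ≤ η → F η = F' η)
    (hf : IsDiffusiveSolution F h S f fInf) : IsDiffusiveSolution F' h S f fInf :=
  ⟨hf.transport.congr_force hF, hf.integrable_outflow, hf.boundary, hf.limit⟩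

lemma IsDiffusiveSolution.isInflowSolution (hf : IsDiffusiveSolution F h S f fInf) :
    IsInflowSolution F (fun φ => h φ + boundaryP f 0) S f fInf :=
  ⟨hf.transport, hf.boundary, hf.limit⟩

lemma IsDiffusiveSolution.isInflowSolution_of_boundaryP (hf : IsDiffusiveSolution F h S f fInf)
    (h0 : boundaryP f 0 = 0) : IsInflowSolution F h S f fInf :=
  ⟨hf.transport, fun φ hφ => by rw [hf.boundary φ hφ, h0, add_zero], hf.limit⟩

lemma IsInflowSolution.isDiffusiveSolution (hf : IsInflowSolution F h S f fInf)
    (hi : IntegrableOn (fun φ => f 0 φ * sin φ) outflow) (h0 : boundaryP f 0 = 0) :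
    IsDiffusiveSolution F h S f fInf :=
  ⟨hf.transport, hi, fun φ hφ => by rw [hf.boundary φ hφ, h0, add_zero], hf.limit⟩

lemma IsData.nonneg (hd : IsData M K h S) : 0 ≤ M :=
  (abs_nonneg _).trans (hd.bound_h (π / 2) (by
    rw [inflow_eq]; constructor <;> linarith [pi_pos]))

lemma IsData.mono (hd : IsData M K h S) {k : ℝ} (hk : k ≤ K) : IsData M k h S :=
  ⟨hd.measurable_h, hd.measurable_S, hd.periodic_S, hd.bound_h, fun η hη φ =>
    (hd.bound_S η hη φ).trans (mul_le_mul_of_nonneg_left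
      (Real.exp_le_exp.2 (by nlinarith)) hd.nonneg)⟩

lemma IsData.add_const (hd : IsData M K h S) (c : ℝ) :
    IsData (M + |c|) K (fun φ => h φ + c) S :=
  ⟨hd.measurable_h.add_const c, hd.measurable_S, hd.periodic_S,
    fun φ hφ => (abs_add_le _ _).trans (by linarith [hd.bound_h φ hφ]), fun η hη φ =>
    (hd.bound_S η hη φ).trans (mul_le_mul_of_nonneg_right
      (le_add_of_nonneg_right (abs_nonneg c)) (exp_pos _).le)⟩

/-- Boundedness upgrades integrability of almost every slice to that of every slice with `η ≥ 0`. -/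
lemma IsTransportSolution.isSol (hf : IsTransportSolution F S f) (hb : IsBounded f) :
    IsSol F S f := by
  obtain ⟨B, hB⟩ := hb
  exact ⟨hf.along, fun η hη => intervalIntegrable_of_bounded
    (measurable_section hf.measurable η) (by linarith [pi_pos]) fun φ _ => hB η hη φ⟩

lemma EqOffGrazing.symm (hfg : EqOffGrazing f g) : EqOffGrazing g f := fun η φ hη h0 =>
  (hfg η φ hη h0).symm

/-- Two functions agreeing in the open half space have the same limit at infinity. -/
lemma EqOffGrazing.limit_eq (hfg : EqOffGrazing f g)
    (hf : ∀ φ, Tendsto (fun η => f η φ) atTop (𝓝 fInf))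
    (hg : ∀ φ, Tendsto (fun η => g η φ) atTop (𝓝 gInf)) : fInf = gInf := by
  refine tendsto_nhds_unique (hf 0) ((hg 0).congr' ?_)
  filter_upwards [eventually_gt_atTop (0 : ℝ)] with η hη
  exact (hfg η 0 hη.le (Or.inl hη.ne')).symm

lemma EqOffGrazing.boundaryP_eq (hfg : EqOffGrazing f g) : boundaryP f 0 = boundaryP g 0 := by
  unfold boundaryP
  congr 1
  refine setIntegral_congr_fun (by rw [outflow_eq]; exact measurableSet_Ioo) fun φ hφ => ?_
  rw [hfg 0 φ le_rfl (Or.inr hφ.2.ne)]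

end Congruence

/-! ### Uniqueness of bounded solutions. -/

section BoundedUniqueness

variable {F : ℝ → ℝ} {γ : ℝ → ℝ × ℝ → ℝ × ℝ}

/-- The values at outgoing boundary points are determined by those in the open half space. -/
lemma IsSol.eq_zero_of_sin_neg (hF : Admissible F) (hγ : IsFlow F γ) {d : ℝ → ℝ → ℝ}
    (hd : IsSol F (fun _ _ => 0) d) (h0 : ∀ η, 0 < η → ∀ φ, d η φ = 0) {φ : ℝ}
    (hφ : sin φ < 0) : d 0 φ = 0 := by
  have hcont : Continuous fun s => sin (γ (-s) (0, φ)).2 := Real.continuous_sin.comp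
    ((continuous_snd.comp (hγ.cont_left (0, φ))).comp continuous_neg)
  have hev : ∀ᶠ s in 𝓝 (0 : ℝ), sin (γ (-s) (0, φ)).2 < 0 :=
    hcont.continuousAt.eventually (gt_mem_nhds (by simpa [hγ.zero] using hφ))
  obtain ⟨T, hT, hTs⟩ := Metric.eventually_nhds_iff.1 hev
  -- Traced backward, an outgoing boundary point enters the open half space at once.
  have hpos : ∀ s, 0 < s → s < T → 0 < (γ (-s) (0, φ)).1 := fun s hs hsT => by
    have h1 := hTs (y := s) (by rw [Real.dist_eq, sub_zero, abs_of_pos hs]; exact hsT)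
    have h2 := (hγ.fst_sub_le hF (0, φ) (s := -s) (t := 0) (by linarith)).1
    simp only [hγ.zero] at h2
    nlinarith
  have hb := hd.backward hγ (0, φ) (T := T / 2) (by linarith) fun s hs => by
    rcases hs.1.eq_or_lt with h | h
    · simp [← h, hγ.zero]
    · exact (hpos s h (by linarith [hs.2])).le
  have hav : ∀ η, 0 < η → avg d η = 0 := fun η hη => by simp [avg, h0 η hη]
  rw [hb.2, h0 _ (hpos (T / 2) (by linarith) (by linarith)), mul_zero, zero_add,
    intervalIntegral.integral_of_le (by linarith)]
  refine setIntegral_eq_zero_of_forall_eq_zero fun s hs => ?_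
  rw [hav _ (hpos s hs.1 (by linarith [hs.2]))]
  simp

/-- Bounded solutions of the in-flow problem are unique. -/
theorem eqOffGrazing_of_bounded (hF : Admissible F) (hγ : IsFlow F γ) {h : ℝ → ℝ}
    {S f g : ℝ → ℝ → ℝ} {fInf gInf : ℝ} (hf : IsInflowSolution F h S f fInf)
    (hg : IsInflowSolution F h S g gInf) (hfb : IsBounded f) (hgb : IsBounded g) :
    EqOffGrazing f g := by
  have hbdry : ∀ φ, 0 < sin φ → f 0 φ = g 0 φ := fun φ hφ => by
    -- The boundary condition is imposed on `[-π, π)` only; periodicity carries it to all angles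
    -- with positive sine, as `comparison` requires.
    have hp : Function.Periodic (fun φ => (f 0 φ, g 0 φ, sin φ)) (2 * π) := fun φ => by
      simp only [hf.transport.periodic, hg.transport.periodic, Real.sin_add_two_pi]
    obtain ⟨φ', hφ', he⟩ := hp.exists_mem_Ico (by linarith [pi_pos] : 0 < 2 * π) φ (-π)
    simp only [Prod.mk.injEq] at he
    obtain ⟨e1, e2, e3⟩ := he
    have hin : φ' ∈ inflow := ⟨⟨hφ'.1, by linarith [hφ'.2]⟩, e3 ▸ hφ⟩
    rw [e1, e2, hf.boundary φ' hin, hg.boundary φ' hin]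
  have hdiff : ∀ {f g : ℝ → ℝ → ℝ}, IsSol F S f → IsSol F S g →
      IsSol F (fun _ _ => 0) fun η φ => f η φ + -1 * g η φ := fun hf hg =>
    (hf.add (hg.const_mul (-1))).congr_right fun η _ φ => by ring
  have hle : ∀ {f g : ℝ → ℝ → ℝ}, IsSol F S f → IsSol F S g → IsBounded f → IsBounded g →
      (∀ φ, 0 < sin φ → f 0 φ = g 0 φ) → ∀ η, 0 < η → ∀ φ, f η φ ≤ g η φ := by
    rintro f g hf hg ⟨B, hB⟩ ⟨B', hB'⟩ h0 η hη φ
    have := comparison hF hγ (hdiff hf hg) le_rfl (B := B + B') (fun _ _ _ => le_rfl)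
      (fun η hη φ => by
        have h1 := (abs_le.1 (hB η hη.le φ)).2
        have h2 := (abs_le.1 (hB' η hη.le φ)).1
        linarith) (fun φ hφ => by rw [h0 φ hφ]; linarith) η hη φ
    linarith
  have hfs := hf.transport.isSol hfb
  have hgs := hg.transport.isSol hgb
  have hint : ∀ η, 0 < η → ∀ φ, f η φ = g η φ := fun η hη φ =>
    le_antisymm (hle hfs hgs hfb hgb hbdry η hη φ)
      (hle hgs hfs hgb hfb (fun φ hφ => (hbdry φ hφ).symm) η hη φ)
  intro η φ hη h0
  rcases hη.eq_or_lt with rfl | hη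
  · rcases lt_trichotomy (sin φ) 0 with hs | hs | hs
    · have := (hdiff hfs hgs).eq_zero_of_sin_neg hF hγ
        (fun η hη φ => by rw [hint η hη φ]; ring) hs
      linarith
    · simp [hs] at h0
    · exact hbdry φ hs
  · exact hint η hη φ

end BoundedUniqueness

/-! ### Square integrability on the half space. -/

section HalfSpace

/-- The measure of the half space `[0, ∞) × (-π, π]`. -/
def halfSpace : Measure (ℝ × ℝ) :=
  (volume.restrict (Ici 0)).prod (volume.restrict (Ioc (-π) π))

lemma restrict_eq_halfSpace :
    (volume : Measure (ℝ × ℝ)).restrict (Ici (0 : ℝ) ×ˢ Ico (-π) π) = halfSpace := by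
  rw [halfSpace, Measure.volume_eq_prod, ← Measure.prod_restrict,
    Measure.restrict_congr_set Ico_ae_eq_Ioc]

lemma isL2_iff {f : ℝ → ℝ → ℝ} {c : ℝ} :
    IsL2 f c ↔ Integrable (fun p : ℝ × ℝ => (f p.1 p.2 - c) ^ 2) halfSpace := by
  rw [IsL2, IntegrableOn, restrict_eq_halfSpace]

lemma eqAE_iff {f g : ℝ → ℝ → ℝ} : EqAE f g ↔ ∀ᵐ p ∂halfSpace, f p.1 p.2 = g p.1 p.2 := by
  rw [EqAE, restrict_eq_halfSpace]

lemma halfSpace_univ : halfSpace univ = ⊤ := by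
  rw [halfSpace, ← univ_prod_univ, Measure.prod_prod, Measure.restrict_apply_univ,
    Measure.restrict_apply_univ, Real.volume_Ici, Real.volume_Ioc, ENNReal.top_mul]
  simp only [ne_eq, ENNReal.ofReal_eq_zero, not_le]
  linarith [pi_pos]

lemma ae_halfSpace_fst_pos : ∀ᵐ p ∂halfSpace, 0 < p.1 := by
  have h1 : ∀ᵐ η ∂(volume.restrict (Ici (0 : ℝ))), 0 < η := by
    rw [← Measure.restrict_congr_set (Ioi_ae_eq_Ici (a := (0 : ℝ)))]
    exact ae_restrict_mem measurableSet_Ioi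
  exact Measure.quasiMeasurePreserving_fst.ae h1

lemma EqOffGrazing.eqAE {f g : ℝ → ℝ → ℝ} (h : EqOffGrazing f g) : EqAE f g := by
  rw [eqAE_iff]
  filter_upwards [ae_halfSpace_fst_pos] with p hp
  exact h _ _ hp.le (Or.inl hp.ne')

lemma IsL2.congr {f g : ℝ → ℝ → ℝ} {c : ℝ} (hf : IsL2 f c) (h : EqAE f g) : IsL2 g c := by
  rw [isL2_iff] at hf ⊢
  rw [eqAE_iff] at h
  refine hf.congr ?_
  filter_upwards [h] with p hp
  rw [hp]

/-- The half space has infinite measure, so the constant `(a - b) ^ 2` is integrable there only if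
it vanishes. -/
lemma IsL2.limit_eq {f g : ℝ → ℝ → ℝ} {a b : ℝ} (hf : IsL2 f a) (hg : IsL2 g b)
    (h : EqAE f g) : a = b := by
  have hg' := hf.congr h
  rw [isL2_iff] at hg hg'
  have hc : Integrable (fun _ : ℝ × ℝ => (a - b) ^ 2) halfSpace := by
    refine ((hg.const_mul 2).add (hg'.const_mul 2)).mono' aestronglyMeasurable_const
      (ae_of_all _ fun p => ?_)
    simp only [Pi.add_apply]
    rw [Real.norm_eq_abs, abs_of_nonneg (sq_nonneg _)]
    nlinarith [sq_nonneg ((g p.1 p.2 - a) + (g p.1 p.2 - b))]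
  rw [integrable_const_iff] at hc
  rcases hc with h | h
  · exact sub_eq_zero.1 (pow_eq_zero_iff two_ne_zero |>.1 h)
  · exact absurd h.measure_univ_lt_top (by simp [halfSpace_univ])

lemma isL2_of_decay {f : ℝ → ℝ → ℝ} {c C κ : ℝ} (hfm : Measurable fun p : ℝ × ℝ => f p.1 p.2)
    (hκ : 0 < κ) (h : ∀ η, 0 ≤ η → ∀ φ, |f η φ - c| ≤ C * exp (-(κ * η))) : IsL2 f c := by
  rw [isL2_iff]
  have h1 : IntegrableOn (fun η => C ^ 2 * exp (-(2 * κ) * η)) (Ici 0) := by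
    rw [integrableOn_Ici_iff_integrableOn_Ioi]
    exact (integrableOn_exp_mul_Ioi (by linarith : -(2 * κ) < 0) 0).const_mul _
  have h2 : Integrable (fun p : ℝ × ℝ => C ^ 2 * exp (-(2 * κ) * p.1)) halfSpace :=
    Integrable.comp_fst h1 _
  refine h2.mono' ((hfm.sub_const c).pow_const 2).aestronglyMeasurable ?_
  filter_upwards [ae_halfSpace_fst_pos] with p hp
  rw [Real.norm_eq_abs, abs_of_nonneg (sq_nonneg _), ← sq_abs]
  calc _ ≤ (C * exp (-(κ * p.1))) ^ 2 := pow_le_pow_left₀ (abs_nonneg _) (h _ hp.le _) 2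
    _ = _ := by rw [mul_pow, ← Real.exp_nat_mul]; push_cast; ring_nf

end HalfSpace
open scoped NNReal

/-! ### The force of the `ε`-Milne problem is admissible. -/

section Force

variable {ψ : ℝ → ℝ} {ε : ℝ}

/-- The force, continued by a constant to `η < 0`. -/
def extForce (ψ : ℝ → ℝ) (ε η : ℝ) : ℝ := force ψ ε (max η 0)

lemma extForce_eq {η : ℝ} (hη : 0 ≤ η) : force ψ ε η = extForce ψ ε η := by
  rw [extForce, max_eq_left hη]

lemma pot_extForce {η : ℝ} (hη : 0 ≤ η) : potential ψ ε η = pot (extForce ψ ε) η := by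
  rw [potential, pot]
  congr 1
  refine intervalIntegral.integral_congr fun y hy => ?_
  rw [uIcc_of_le hη] at hy
  exact extForce_eq hy.1

/-- As `ψ` vanishes from `3/4` on, the argument may be clamped to `[0, 3/4]`, away from the
singularity at `1`. This exhibits the force as a Lipschitz function of a Lipschitz clamp. -/
lemma extForce_eq_clamp (hψ : IsCutoff ψ) (hε : 0 < ε) (η : ℝ) : extForce ψ ε η =
    -ε * (fun y => ψ y / (1 - y)) (max 0 (min (ε * max η 0) (3 / 4))) := by
  have h0 : 0 ≤ ε * max η 0 := mul_nonneg hε.le (le_max_right _ _)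
  rw [extForce, force]
  set y := ε * max η 0
  rcases le_total y (3 / 4) with h | h
  · rw [min_eq_left h, max_eq_right h0]; ring
  · rw [min_eq_right h, max_eq_right (by norm_num), hψ.eq_zero y h]
    simp [hψ.eq_zero _ le_rfl]

/-- On the clamped range `1 - y ≥ 1/4`, whence the bound `4`, uniformly in `ε < 1`. -/
lemma admissible_extForce (hψ : IsCutoff ψ) (hε : 0 < ε) (hε' : ε < 1) :
    Admissible (extForce ψ ε) := by
  have hrange : ∀ η : ℝ, max 0 (min (ε * max η 0) (3 / 4)) ∈ Icc (0 : ℝ) (3 / 4) := fun η =>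
    ⟨le_max_left _ _, max_le (by norm_num) (min_le_right _ _)⟩
  refine ⟨?_, fun η => ?_, fun η => ?_⟩
  · have hc : ContDiffOn ℝ ∞ (fun y => ψ y / (1 - y)) (Icc 0 (3 / 4)) :=
      hψ.smooth.contDiffOn.div (contDiffOn_const.sub contDiffOn_id) fun y hy => by
        have := hy.2; intro h; linarith
    obtain ⟨L, hL⟩ := hc.exists_lipschitzOnWith (by simp) (convex_Icc 0 (3 / 4)) isCompact_Icc
    have hclamp : LipschitzWith ‖ε‖₊ fun η : ℝ => max 0 (min (ε * max η 0) (3 / 4)) := by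
      have h1 : LipschitzWith 1 fun η : ℝ => max η 0 := LipschitzWith.id.max_const 0
      have h2 : LipschitzWith (‖ε‖₊ * 1) fun η : ℝ => ε * max η 0 :=
        (lipschitzWith_smul ε).comp h1
      simpa using (h2.min_const (3 / 4)).const_max 0
    have h3 := hL.comp (hclamp.lipschitzOnWith (s := univ)) fun η _ => hrange η
    have h4 := (lipschitzWith_smul (-ε)).comp (lipschitzOnWith_univ.1 h3)
    refine ⟨‖-ε‖₊ * (L * ‖ε‖₊), ?_⟩
    rw [funext (extForce_eq_clamp hψ hε)]
    exact h4
  all_goals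
    rw [extForce_eq_clamp hψ hε]
    have hy := hrange η
    set y := max 0 (min (ε * max η 0) (3 / 4))
    have h1 := hψ.nonneg y hy.1
    have h2 := hψ.le_one y hy.1
    have h3 : 1 / 4 ≤ 1 - y := by linarith [hy.2]
    have h4 : 0 ≤ ψ y / (1 - y) := div_nonneg h1 (by linarith)
    have h5 : ψ y / (1 - y) ≤ 4 := by rw [div_le_iff₀ (by linarith)]; linarith
    simp only
    nlinarith

lemma compatible_extForce {h : ℝ → ℝ} {S : ℝ → ℝ → ℝ} :
    Compatible (potential ψ ε) h S ↔ Compatible (pot (extForce ψ ε)) h S := by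
  have : ∫ s in Ici (0 : ℝ), ∫ φ in (-π)..π, exp (-potential ψ ε s) * S s φ =
      ∫ s in Ici (0 : ℝ), ∫ φ in (-π)..π, exp (-pot (extForce ψ ε) s) * S s φ :=
    setIntegral_congr_fun measurableSet_Ici fun s hs => by simp only [pot_extForce hs]
  rw [Compatible, Compatible, this]

end Force

/-! ### Compatibility, reduction to in-flow data and the main theorem. -/

/-- The bounded solution of the in-flow problem, with its decay. -/
theorem exists_decaying_solution {k : ℝ} (hk : 0 < k) (hk' : k ≤ 1 / 2) :
    ∃ C > 0, ∃ κ > 0, ∀ (F : ℝ → ℝ) (γ : ℝ → ℝ × ℝ → ℝ × ℝ), Admissible F → IsFlow F γ →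
      ∀ (M : ℝ) (h : ℝ → ℝ) (S : ℝ → ℝ → ℝ), IsData M k h S →
      ∃ (f : ℝ → ℝ → ℝ) (fInf : ℝ), IsInflowSolution F h S f fInf ∧ IsBounded f ∧
        (∀ η, 0 ≤ η → ∀ φ, |f η φ - fInf| ≤ C * M * exp (-(κ * η))) ∧
        ((∀ η, 0 ≤ η → ∀ φ, S η φ = 0) → ∀ η, 0 ≤ η → ∀ φ,
          sInf (h '' inflow) ≤ f η φ ∧ f η φ ≤ sSup (h '' inflow)) := by
  obtain ⟨D, hD, κ, hκ, hdecay⟩ := exists_decay hk hk'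
  have hsb := one_le_solBound hk
  refine ⟨D * (1 + solBound k), by positivity, κ, hκ, fun F γ hF hγ M h S hd => ?_⟩
  obtain ⟨f, hfm, hfp, hfs, hfb, hf0, hmax⟩ := exists_bounded_solution hk hk' hF hγ
    hd.measurable_h hd.measurable_S hd.periodic_S hd.bound_h hd.bound_S
  obtain ⟨fInf, hfi⟩ := hdecay F γ hF hγ S f M _ hfs hfm hd.bound_S hfb
  have hfi' : ∀ η, 0 ≤ η → ∀ φ, |f η φ - fInf| ≤ D * (1 + solBound k) * M * exp (-(κ * η)) :=
    fun η hη φ => (hfi η hη φ).trans_eq (by ring)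
  refine ⟨f, fInf, ⟨⟨hfm, hfp, ?_, hfs.transport⟩, fun φ hφ => ?_, fun φ => ?_⟩, ⟨_, hfb⟩, hfi',
    hmax⟩
  · filter_upwards [ae_restrict_mem measurableSet_Ici] with η hη
    exact hfs.int η hη
  · rw [hf0 φ hφ.2, bdry_cos h hφ]
  · have hexp : Tendsto (fun η : ℝ => D * (1 + solBound k) * M * exp (-(κ * η))) atTop (𝓝 0) := by
      simpa using (Real.tendsto_exp_neg_atTop_nhds_zero.comp
        (tendsto_id.const_mul_atTop hκ)).const_mul (D * (1 + solBound k) * M)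
    refine tendsto_iff_norm_sub_tendsto_zero.2 (squeeze_zero'
      (Eventually.of_forall fun _ => norm_nonneg _) ?_ hexp)
    filter_upwards [eventually_ge_atTop (0 : ℝ)] with η hη
    exact hfi' η hη φ

lemma IsTransportSolution.hasTransport {F : ℝ → ℝ} {S f : ℝ → ℝ → ℝ}
    (hf : IsTransportSolution F S f) :
    HasTransport F f fun η φ => avg f η - f η φ + S η φ := hf.along

section Main

variable {F : ℝ → ℝ} {γ : ℝ → ℝ × ℝ → ℝ × ℝ} {h : ℝ → ℝ} {S f : ℝ → ℝ → ℝ} {fInf M k : ℝ}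

lemma IsInflowSolution.integrableOn_outflow (hf : IsInflowSolution F h S f fInf)
    (hb : IsBounded f) : IntegrableOn (fun φ => f 0 φ * sin φ) outflow := by
  have h1 := ((hf.transport.isSol hb).int 0 le_rfl).mul_continuousOn
    Real.continuous_sin.continuousOn
  rw [intervalIntegrable_iff_integrableOn_Ioc_of_le (by linarith [pi_pos])] at h1
  rw [outflow_eq]
  exact (integral_halves h1).2.1

/-- The balance between the incoming flux, the source and the outgoing flux. -/
theorem IsInflowSolution.balance (hF : Admissible F) (hγ : IsFlow F γ) (hk : 0 < k)
    (hk' : k ≤ 1 / 2) (hd : IsData M k h S) (hf : IsInflowSolution F h S f fInf)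
    (hb : IsBounded f) :
    (∫ φ in inflow, h φ * sin φ) +
      (∫ s in Ici (0 : ℝ), ∫ φ in (-π)..π, exp (-pot F s) * S s φ) = 2 * boundaryP f 0 := by
  obtain ⟨C, -, κ, hκ, hex⟩ := exists_decaying_solution hk hk'
  obtain ⟨f', fInf', hf', hfb', hdec, -⟩ := hex F γ hF hγ M h S hd
  -- The given solution is replaced by the constructed one, which decays as the flux balance
  -- requires; the grazing set is invisible to `boundaryP`.
  rw [(eqOffGrazing_of_bounded hF hγ hf hf' hb hfb').boundaryP_eq]
  obtain ⟨B, hB⟩ := hfb'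
  have hs := hf'.transport.isSol ⟨B, hB⟩
  have hflux := flux_eq hF hγ hs hf'.transport.measurable hf'.transport.periodic hd.measurable_S
    hk hd.bound_S hB hκ hdec
  have h1 := (hs.int 0 le_rfl).mul_continuousOn Real.continuous_sin.continuousOn
  rw [intervalIntegrable_iff_integrableOn_Ioc_of_le (by linarith [pi_pos])] at h1
  have hin : ∫ φ in Ioo 0 π, f' 0 φ * sin φ = ∫ φ in inflow, h φ * sin φ := by
    rw [inflow_eq]
    exact setIntegral_congr_fun measurableSet_Ioo fun φ hφ => by
      rw [hf'.boundary φ (by rw [inflow_eq]; exact hφ)]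
  rw [(integral_halves h1).2.2, hin, ← outflow_eq] at hflux
  simp only [boundaryP]
  simp only [maxEnergy] at hflux
  linarith

/-- A bounded solution of the diffusive problem forces the compatibility condition. -/
theorem IsDiffusiveSolution.compatible (hF : Admissible F) (hγ : IsFlow F γ) (hk : 0 < k)
    (hk' : k ≤ 1 / 2) (hd : IsData M k h S) (hf : IsDiffusiveSolution F h S f fInf)
    (hb : IsBounded f) : Compatible (pot F) h S := by
  have hbal := hf.isInflowSolution.balance hF hγ hk hk' (hd.add_const _) hb
  set c := boundaryP f 0
  have hpi := pi_pos
  have hfin : IsFiniteMeasure (volume.restrict inflow) := by rw [inflow_eq]; infer_instance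
  have hi : IntegrableOn (fun φ => h φ * sin φ) inflow := by
    refine Integrable.of_bound (hd.measurable_h.mul Real.measurable_sin).aestronglyMeasurable M ?_
    have hmeas : MeasurableSet inflow := by rw [inflow_eq]; exact measurableSet_Ioo
    filter_upwards [ae_restrict_mem hmeas] with φ hφ
    rw [norm_mul]
    exact (mul_le_of_le_one_right (norm_nonneg _) (Real.abs_sin_le_one φ)).trans (hd.bound_h φ hφ)
  have hc : IntegrableOn (fun φ => c * sin φ) inflow := by
    rw [inflow_eq]
    exact (Continuous.integrableOn_Icc (by fun_prop)).mono_set Ioo_subset_Icc_self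
  -- The constant re-emitted by the wall adds `2 * c` to the incoming flux, exactly the outgoing
  -- term on the other side of the balance.
  have hcs : ∫ φ in inflow, c * sin φ = 2 * c := by
    rw [inflow_eq, ← integral_Ioc_eq_integral_Ioo, ← intervalIntegral.integral_of_le hpi.le,
      intervalIntegral.integral_const_mul, integral_sin]
    simp; ring
  simp only [add_mul] at hbal
  rw [integral_add hi hc, hcs] at hbal
  rw [Compatible]
  linarith

/-- Square integrable solutions of the in-flow problem agree almost everywhere with the bounded
one. -/
theorem IsInflowSolution.eqAE_of_isL2 (hF : Admissible F) (hγ : IsFlow F γ) {g : ℝ → ℝ → ℝ}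
    {gInf : ℝ} (hf : IsInflowSolution F h S f fInf) (hfL : IsL2 f fInf)
    (hg : IsInflowSolution F h S g gInf) (hgL : IsL2 g gInf) :
    EqAE f g ∧ ∀ᵐ φ ∂(volume.restrict outflow), f 0 φ = g 0 φ := by
  have hfm := hf.transport.measurable
  have hgm := hg.transport.measurable
  -- `D` is the difference of the averages rather than the average of the difference: the two agree
  -- only where both slices are known to be integrable, that is for almost every `η`.
  have key := ae_eq_zero_of_sq_integrable hF hγ (D := fun η => avg f η - avg g η)
    (d := fun η φ => f η φ + -1 * g η φ) (c := fInf - gInf)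
    ((hf.transport.hasTransport.add (hg.transport.hasTransport.const_mul (-1))).congr_right fun η _ φ => by ring)
    (hfm.add (hgm.const_mul _)) ((measurable_avg hfm).sub (measurable_avg hgm))
    (fun η φ => by rw [hf.transport.periodic, hg.transport.periodic]) (by
      filter_upwards [hf.transport.integrable, hg.transport.integrable] with η h1 h2
      rw [avg_add h1 (h2.const_mul (-1)) (g := fun η φ => -1 * g η φ), avg_const_mul]
      ring)
    (by
      rw [isL2_iff] at hfL hgL
      refine ((hfL.const_mul 2).add (hgL.const_mul 2)).mono'
        (((hfm.add (hgm.const_mul _)).sub_const _).pow_const 2).aestronglyMeasurable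
        (ae_of_all _ fun p => ?_)
      simp only [Pi.add_apply]
      rw [Real.norm_eq_abs, abs_of_nonneg (sq_nonneg _)]
      nlinarith [sq_nonneg ((f p.1 p.2 - fInf) + (g p.1 p.2 - gInf))])
    (fun φ hφ => by
      rw [← inflow_eq] at hφ
      rw [hf.boundary φ hφ, hg.boundary φ hφ]; ring)
  rw [eqAE_iff, outflow_eq]
  constructor
  · filter_upwards [key.1] with p hp
    linarith
  · filter_upwards [key.2] with φ hφ
    linarith

/-- Under the compatibility condition an in-flow solution, bounded or square integrable, solves
the diffusive problem. -/
theorem IsInflowSolution.isDiffusive (hF : Admissible F) (hγ : IsFlow F γ) (hk : 0 < k)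
    (hk' : k ≤ 1 / 2) (hd : IsData M k h S) (hc : Compatible (pot F) h S)
    (hf : IsInflowSolution F h S f fInf) (hbL : IsBounded f ∨ IsL2 f fInf) :
    IsDiffusiveSolution F h S f fInf ∧ boundaryP f 0 = 0 ∧ IsL2 f fInf := by
  obtain ⟨C, -, κ, hκ, hex⟩ := exists_decaying_solution hk hk'
  obtain ⟨g, gInf, hg, hgb, hdec, -⟩ := hex F γ hF hγ M h S hd
  have hgL := isL2_of_decay hg.transport.measurable hκ hdec
  have hbal : ∀ {f fInf}, IsInflowSolution F h S f fInf → IsBounded f → boundaryP f 0 = 0 :=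
    fun hf hb => by
      have := hf.balance hF hγ hk hk' hd hb
      rw [Compatible] at hc
      linarith
  rcases hbL with hb | hL
  · have heq := eqOffGrazing_of_bounded hF hγ hf hg hb hgb
    have h0 := hbal hf hb
    refine ⟨hf.isDiffusiveSolution (hf.integrableOn_outflow hb) h0, h0, ?_⟩
    rw [heq.limit_eq hf.limit hg.limit]
    exact hgL.congr heq.symm.eqAE
  -- `L²` uniqueness also identifies the outgoing traces at the wall, so the balance known for the
  -- bounded solution passes to `f`.
  · have hae : (fun φ => f 0 φ * sin φ) =ᵐ[volume.restrict outflow] fun φ => g 0 φ * sin φ := by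
      filter_upwards [(hf.eqAE_of_isL2 hF hγ hL hg hgL).2] with φ hφ
      rw [hφ]
    have h0 : boundaryP f 0 = 0 := by
      rw [boundaryP, integral_congr_ae hae]
      exact hbal hg hgb
    exact ⟨hf.isDiffusiveSolution ((hg.integrableOn_outflow hgb).congr hae.symm) h0, h0, hL⟩

end Main

end Milne

end

theorem lemma5p2 (ψ : ℝ → ℝ) (hψ : Milne.IsCutoff ψ) :
    -- bounded solutions exist only under the compatibility condition
    (∀ ε M K : ℝ, 0 < ε → ε < 1 → 0 < K →
      ∀ (h : ℝ → ℝ) (S : ℝ → ℝ → ℝ), Milne.IsData M K h S →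
      ∀ (f : ℝ → ℝ → ℝ) (fInf : ℝ),
        Milne.IsDiffusiveSolution (Milne.force ψ ε) h S f fInf → Milne.IsBounded f →
        Milne.Compatible (Milne.potential ψ ε) h S ∧
        ((∀ η, 0 ≤ η → ∀ φ, S η φ = 0) → ∫ φ in Milne.inflow, h φ * sin φ = 0)) ∧
    -- reduction to the problem with in-flow boundary
    (∀ ε M K : ℝ, 0 < ε → ε < 1 → 0 < K →
      ∀ (h : ℝ → ℝ) (S : ℝ → ℝ → ℝ), Milne.IsData M K h S →
      Milne.Compatible (Milne.potential ψ ε) h S →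
      ∀ (f : ℝ → ℝ → ℝ) (fInf : ℝ),
        Milne.IsInflowSolution (Milne.force ψ ε) h S f fInf →
        (Milne.IsBounded f ∨ Milne.IsL2 f fInf) →
        Milne.IsDiffusiveSolution (Milne.force ψ ε) h S f fInf ∧
        Milne.boundaryP f 0 = 0 ∧ Milne.IsL2 f fInf ∧
        ∀ (g : ℝ → ℝ → ℝ) (gInf : ℝ),
          Milne.IsDiffusiveSolution (Milne.force ψ ε) h S g gInf →
          Milne.boundaryP g 0 = 0 → Milne.IsL2 g gInf →
          gInf = fInf ∧ Milne.EqAE g f) ∧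
    -- well-posedness, decay and maximum principle
    (∀ Kmin : ℝ, 0 < Kmin → ∃ C > 0, ∃ κ > 0,
      ∀ ε M K : ℝ, 0 < ε → ε < 1 → Kmin ≤ K →
      ∀ (h : ℝ → ℝ) (S : ℝ → ℝ → ℝ), Milne.IsData M K h S →
      Milne.Compatible (Milne.potential ψ ε) h S →
      ∃ (f : ℝ → ℝ → ℝ) (fInf : ℝ),
        Milne.IsDiffusiveSolution (Milne.force ψ ε) h S f fInf ∧
        Milne.boundaryP f 0 = 0 ∧
        (∀ η, 0 ≤ η → ∀ φ, |f η φ - fInf| ≤ C * (1 + M + M / K)) ∧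
        (∀ K₀, 0 < K₀ → K₀ ≤ κ → ∀ η, 0 ≤ η → ∀ φ,
          |exp (K₀ * η) * (f η φ - fInf)| ≤ C * (1 + M + M / K)) ∧
        ((∀ η, 0 ≤ η → ∀ φ, S η φ = 0) → ∀ η, 0 ≤ η → ∀ φ,
          sInf (h '' Milne.inflow) ≤ f η φ ∧ f η φ ≤ sSup (h '' Milne.inflow)) ∧
        (∀ (g : ℝ → ℝ → ℝ) (gInf : ℝ),
          Milne.IsDiffusiveSolution (Milne.force ψ ε) h S g gInf →
          Milne.boundaryP g 0 = 0 → Milne.IsBounded g →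
          gInf = fInf ∧ Milne.EqOffGrazing g f)) := by
  refine ⟨?_, ?_, ?_⟩
  · intro ε M K hε hε' hK h S hd f fInf hf hb
    have hF := Milne.admissible_extForce hψ hε hε'
    obtain ⟨γ, hγ⟩ := Milne.exists_flow hF
    -- Weakening the decay rate to at most `1/2` costs nothing and meets the requirement of the
    -- barrier.
    have hk : 0 < min K (1 / 2) := lt_min hK (by norm_num)
    have hc : Milne.Compatible (Milne.potential ψ ε) h S := Milne.compatible_extForce.2 <|
      (hf.congr_force fun η hη => Milne.extForce_eq hη).compatible hF hγ hk (min_le_right _ _)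
        (hd.mono (min_le_left _ _)) hb
    refine ⟨hc, fun hS => ?_⟩
    have h0 : ∫ s in Ici (0 : ℝ), ∫ φ in (-π)..π, exp (-Milne.potential ψ ε s) * S s φ = 0 :=
      setIntegral_eq_zero_of_forall_eq_zero fun s hs => by
        simp only [hS s hs, mul_zero, intervalIntegral.integral_zero]
    rwa [Milne.Compatible, h0, add_zero] at hc
  · intro ε M K hε hε' hK h S hd hc f fInf hf hbL
    have hF := Milne.admissible_extForce hψ hε hε'
    obtain ⟨γ, hγ⟩ := Milne.exists_flow hF
    have hk : 0 < min K (1 / 2) := lt_min hK (by norm_num)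
    have hf' := hf.congr_force fun η hη => Milne.extForce_eq (ψ := ψ) (ε := ε) hη
    obtain ⟨h1, h2, h3⟩ := hf'.isDiffusive hF hγ hk (min_le_right _ _)
      (hd.mono (min_le_left _ _)) (Milne.compatible_extForce.1 hc) hbL
    refine ⟨h1.congr_force fun η hη => (Milne.extForce_eq hη).symm, h2, h3,
      fun g gInf hg hg0 hgL => ?_⟩
    have hg' := (hg.congr_force fun η hη =>
      Milne.extForce_eq (ψ := ψ) (ε := ε) hη).isInflowSolution_of_boundaryP hg0
    have heq := (hg'.eqAE_of_isL2 hF hγ hgL hf' h3).1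
    exact ⟨hgL.limit_eq h3 heq, heq⟩
  · intro Kmin hKmin
    -- The rate depends on `Kmin` alone, and the constants below serve all admissible forces; this
    -- gives uniformity in `ε`, `M` and `K`.
    have hk : 0 < min Kmin (1 / 2) := lt_min hKmin (by norm_num)
    obtain ⟨C, hC, κ, hκ, hex⟩ := Milne.exists_decaying_solution hk (min_le_right _ _)
    refine ⟨C, hC, κ, hκ, fun ε M K hε hε' hK h S hd hc => ?_⟩
    have hF := Milne.admissible_extForce hψ hε hε'
    obtain ⟨γ, hγ⟩ := Milne.exists_flow hF
    have hd' := hd.mono ((min_le_left _ (1 / 2)).trans hK)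
    have hM := hd.nonneg
    have hK0 : 0 < K := hKmin.trans_le hK
    obtain ⟨f, fInf, hf, hfb, hdec, hmax⟩ := hex _ γ hF hγ M h S hd'
    obtain ⟨h1, h2, -⟩ := hf.isDiffusive hF hγ hk (min_le_right _ _) hd'
      (Milne.compatible_extForce.1 hc) (Or.inl hfb)
    -- The argument yields the bound `C * M`, stronger than the one claimed.
    have hbound : C * M ≤ C * (1 + M + M / K) :=
      mul_le_mul_of_nonneg_left (by linarith [div_nonneg hM hK0.le]) hC.le
    have hCM : 0 ≤ C * M := mul_nonneg hC.le hM
    refine ⟨f, fInf, h1.congr_force fun η hη => (Milne.extForce_eq hη).symm, h2,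
      fun η hη φ => ?_, fun K₀ hK₀ hK₀κ η hη φ => ?_, hmax, fun g gInf hg hg0 hgb => ?_⟩
    · refine (hdec η hη φ).trans (le_trans ?_ hbound)
      exact mul_le_of_le_one_right hCM (Real.exp_le_one_iff.2 (by nlinarith))
    · rw [abs_mul, abs_of_pos (exp_pos _)]
      calc exp (K₀ * η) * |f η φ - fInf| ≤ exp (κ * η) * (C * M * exp (-(κ * η))) :=
            mul_le_mul (Real.exp_le_exp.2 (mul_le_mul_of_nonneg_right hK₀κ hη)) (hdec η hη φ)
              (abs_nonneg _) (exp_pos _).le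
        _ = C * M := by
            rw [mul_left_comm, ← Real.exp_add, add_neg_cancel, Real.exp_zero, mul_one]
        _ ≤ _ := hbound
    · have hg' := (hg.congr_force fun η hη =>
        Milne.extForce_eq (ψ := ψ) (ε := ε) hη).isInflowSolution_of_boundaryP hg0
      have heq := Milne.eqOffGrazing_of_bounded hF hγ hg' hf hgb hfb
      exact ⟨heq.limit_eq hg'.limit hf.limit, heq⟩
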